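/- **Theorem.** All graphs are finite, simple and undirected. A *proportionally dense subgraph* (PDS) of a graph $G=(V,E)$ is a set $S\subset V$ with $2\le |S|<|V|$ such that, with $\overline S=V\setminus S$, $$\frac{d_S(v)}{|S|-1}\ \ge\ \frac{d_{\overline S}(v)}{|\overline S|}\qquad\text{for every } v\in S,$$ where $d_X(v)$ is the number of neighbours of $v$ in $X$. MaxPDS is the problem of finding, for a given graph $G$, a PDS of $G$ of maximum size. The h-index $h(H)$ of a graph $H$ is the largest integer $h$ such that at least $h$ vertices of $H$ have degree at least $h$. Let $\overline G$ denote the complement of $G$. There is a single algorithm that solves MaxPDS in time $O(n^2)$ on all graphs $G$ with $n\ge 3$ vertices and $h(\overline G)\le 2$ (in particular, on those with $h(\overline G)=2$), and hence on all graphs with $n\ge 3$ vertices and minimum degree at least $n-3$. More precisely, there are a program $p$ for a word random access machine (words of $O(\log n)$ bits; constants, memory accesses with indirect addressing, addition, truncated subtraction, multiplication, tests and stores take one step each) and a constant $c$ such that on each such graph $G$, given by $n$ and its adjacency matrix, $p$ halts after at most $c\,n^2$ steps and outputs a PDS $S$ of maximum size of $G$. The set $D=V\setminus S$ (which has minimum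 size among the complements of all PDSs of $G$) dominates every non-isolated vertex of $\overline G$: each such vertex lies in $D$ or has a neighbour in $D$ in $\overline G$. If $G$ has no isolated vertex, then $S$ induces a connected subgraph of $G$. -/

import Mathlib

open Finset

/-! ### Graph notions -/

namespace SimpleGraph

variable {V : Type*} [Fintype V] [DecidableEq V]

/-- The h-index: the largest `h` such that at least `h` vertices have degree at least `h`
(the set is bounded by `|V|` and contains `0`). -/
noncomputable def hIndex (G : SimpleGraph V) [DecidableRel G.Adj] : ℕ :=
  sSup {h : ℕ | h ≤ #{v : V | h ≤ G.degree v}}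

/-- The degree of `v` into `S`, i.e. the number of neighbours of `v` in `S`. -/
def degreeIn (G : SimpleGraph V) [DecidableRel G.Adj] (S : Finset V) (v : V) : ℕ :=
  #(G.neighborFinset v ∩ S)

/-- `S` is (the vertex set of) a proportionally dense subgraph of `G`. -/
structure IsPDS (G : SimpleGraph V) [DecidableRel G.Adj] (S : Finset V) : Prop where
  two_le_card : 2 ≤ #S
  card_lt : #S < Fintype.card V
  satisfied : ∀ v ∈ S,
    (G.degreeIn Sᶜ v : ℚ) / (#Sᶜ : ℚ) ≤ (G.degreeIn S v : ℚ) / ((#S : ℚ) - 1)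

/-- `S` is a proportionally dense subgraph of maximum size. -/
def IsMaxPDS (G : SimpleGraph V) [DecidableRel G.Adj] (S : Finset V) : Prop :=
  G.IsPDS S ∧ ∀ T : Finset V, G.IsPDS T → #T ≤ #S

/-- `D` dominates every non-isolated vertex of `G`. -/
def DominatesNonisolated (G : SimpleGraph V) [DecidableRel G.Adj] (D : Finset V) : Prop :=
  ∀ v : V, 0 < G.degree v → v ∈ D ∨ ∃ w ∈ D, G.Adj v w

end SimpleGraph

/-! ### A word random access machine

Programs are finite pieces of syntax.  The memory consists of arrays of natural numbers, of which a
program uses finitely many (a scalar is a cell of an array), with indirect addressing.  Every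
operation (constant, memory access, arithmetic operation, test, store) takes one step.  All numbers
that occur have to fit into one machine word, that is, be at most `w`. -/

namespace RAM

/-- A memory: `σ a i` is the content of cell `i` of array `a`. -/
abbrev Memory := ℕ → ℕ → ℕ

inductive Expr where
  | const (k : ℕ)
  | read (a : ℕ) (i : Expr)
  | add (e f : Expr)
  | sub (e f : Expr)
  | mul (e f : Expr)

/-- The value of an expression; subtraction is truncated. -/
def Expr.eval (σ : Memory) : Expr → ℕ
  | .const k => k
  | .read a i => σ a (i.eval σ)
  | .add e f => e.eval σ + f.eval σ
  | .sub e f => e.eval σ - f.eval σ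
  | .mul e f => e.eval σ * f.eval σ

/-- The number of steps that the evaluation of an expression takes. -/
def Expr.cost : Expr → ℕ
  | .const _ => 1
  | .read _ i => i.cost + 1
  | .add e f => e.cost + f.cost + 1
  | .sub e f => e.cost + f.cost + 1
  | .mul e f => e.cost + f.cost + 1

/-- All values that occur in the evaluation of an expression are at most `w`. -/
def Expr.Fits (w : ℕ) (σ : Memory) : Expr → Prop
  | .const k => k ≤ w
  | .read a i => i.Fits w σ ∧ σ a (i.eval σ) ≤ w
  | .add e f => e.Fits w σ ∧ f.Fits w σ ∧ e.eval σ + f.eval σ ≤ w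
  | .sub e f => e.Fits w σ ∧ f.Fits w σ
  | .mul e f => e.Fits w σ ∧ f.Fits w σ ∧ e.eval σ * f.eval σ ≤ w

inductive Program where
  | skip
  /-- Write the value of `e` into cell `i` of array `a`. -/
  | store (a : ℕ) (i e : Expr)
  | seq (p q : Program)
  /-- Execute `p` if the value of `e` is nonzero, and `q` otherwise. -/
  | cond (e : Expr) (p q : Program)
  /-- Execute `p` as long as the value of `e` is nonzero. -/
  | loop (e : Expr) (p : Program)

/-- The memory after writing `v` into cell `i` of array `a`. -/
def Memory.write (σ : Memory) (a i v : ℕ) : Memory :=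
  Function.update σ a (Function.update (σ a) i v)

/-- `Exec w p σ t τ`: started on the memory `σ`, the program `p` halts after exactly `t` steps with
the memory `τ`, and all numbers that it computes with fit into words of capacity `w`. -/
inductive Exec (w : ℕ) : Program → Memory → ℕ → Memory → Prop
  | skip (σ : Memory) : Exec w .skip σ 1 σ
  | store (a : ℕ) (i e : Expr) (σ : Memory) (hi : i.Fits w σ) (he : e.Fits w σ) :
      Exec w (.store a i e) σ (i.cost + e.cost + 1) (σ.write a (i.eval σ) (e.eval σ))
  | seq {p q : Program} {σ τ ρ : Memory} {s t : ℕ} (hp : Exec w p σ s τ) (hq : Exec w q τ t ρ) :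
      Exec w (.seq p q) σ (s + t) ρ
  | cond_true {e : Expr} {p q : Program} {σ τ : Memory} {t : ℕ} (hf : e.Fits w σ)
      (he : e.eval σ ≠ 0) (hp : Exec w p σ t τ) : Exec w (.cond e p q) σ (e.cost + 1 + t) τ
  | cond_false {e : Expr} {p q : Program} {σ τ : Memory} {t : ℕ} (hf : e.Fits w σ)
      (he : e.eval σ = 0) (hq : Exec w q σ t τ) : Exec w (.cond e p q) σ (e.cost + 1 + t) τ
  | loop_true {e : Expr} {p : Program} {σ τ ρ : Memory} {s t : ℕ} (hf : e.Fits w σ)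
      (he : e.eval σ ≠ 0) (hp : Exec w p σ s τ) (hl : Exec w (.loop e p) τ t ρ) :
      Exec w (.loop e p) σ (e.cost + 1 + s + t) ρ
  | loop_false {e : Expr} {p : Program} {σ : Memory} (hf : e.Fits w σ)
      (he : e.eval σ = 0) : Exec w (.loop e p) σ (e.cost + 1) σ

/-- The input memory for a graph `G` on `{0, …, n - 1}`: cell `0` of array `0` holds `n`, array `1`
holds the adjacency matrix row by row, and all other cells are `0`. -/
def inputMemory {n : ℕ} (G : SimpleGraph (Fin n)) [DecidableRel G.Adj] : Memory := fun a k =>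
  if a = 0 ∧ k = 0 then n
  else if a = 1 ∧ ∃ i j : Fin n, k = (i : ℕ) * n + j ∧ G.Adj i j then 1
  else 0

/-- The vertex set that a memory presents as output: its indicator function is in array `2`. -/
def outputSet (n : ℕ) (τ : Memory) : Finset (Fin n) :=
  {i : Fin n | τ 2 i ≠ 0}

/-- On the input `G`, the program `p`, working with words of `c * log₂ n` bits, halts after at most
`c * n ^ 2` steps.  Its output is a proportionally dense subgraph of maximum size whose complementary
vertex set dominates every non-isolated vertex of the complement of `G`, and which is connected
if `G` has no isolated vertices. -/
def SolvesMaxPDS (p : Program) (c : ℕ) {n : ℕ} (G : SimpleGraph (Fin n)) [DecidableRel G.Adj] :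
    Prop :=
  ∃ (t : ℕ) (τ : Memory), Exec (n ^ c) p (inputMemory G) t τ ∧ t ≤ c * n ^ 2 ∧
    G.IsMaxPDS (outputSet n τ) ∧
    Gᶜ.DominatesNonisolated (outputSet n τ)ᶜ ∧
    ((∀ v : Fin n, 1 ≤ G.degree v) → (G.induce (outputSet n τ : Set (Fin n))).Connected)

end RAM

namespace RAM

/-! ### Structured programs -/

/-! Let `H` be the complement of the graph and `D` the complement of `S`. If `v ∈ S` has `p`
non-neighbours in `S` and `q` in `D`, the density inequality at `v` becomes `(p + q) * #D ≤ q * (n -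
1)`. Hence `S` is a PDS exactly if `D` satisfies `Good`, a condition on `H` (`isPDS_iff`), and a
smallest good set is sought. In `H` all vertices but two, `a` and `b`, have degree at most two.

Suppose `2 * #D < n`. A vertex of degree at most two outside `D` then satisfies its inequality
exactly if it is isolated or has a neighbour in `D`, so `D` has to dominate these vertices and to
satisfy `a` and `b` unless they belong to `D`. Fix `X = D ∩ {a, b}`. The vertices still to be
dominated (`targets`) induce paths and cycles. No vertex other than `a` and `b` dominates more than
three of them, and none helps two components, so a component with `m` vertices costs `⌈m/3⌉`
(`domSum_le`), which a residue class of positions modulo three attains.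

Among the cheapest sets, those with many neighbours of `a` and `b` are wanted. Counting the slack
`3⌈m/3⌉ - m` (`sum_part_le`) shows that a component offers a real choice between `a` and `b` only if
`m % 3 = 2`, one end is adjacent to `a` and the other one to `b`; one neighbour is then traded for
one. Giving all choices to `b` and moving them to `a` one by one until `a` is satisfied is therefore
optimal (`Candidate.good`). If `D` is not cheapest for its `X`, then either there is room for both
`a` and `b`, or `X = ∅` with a single surplus vertex, which can be exchanged for `a` or `b`
(`exists_good_exchange`). So four candidates suffice (`exists_good_candidate`).

Good sets with at least `n / 2` vertices need not be searched: the smaller side of a locally maximal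
cut is a good set with at most `n / 2` vertices (`Stable.good`). The cut has at most `4 * n` edges,
so linearly many improvements suffice, each in linear time.

The program is written in a small language of counting loops, for which the running time is governed
by the nesting depth, here two, and all numbers are polynomially bounded (`exists_exec_compile`).
Domination follows from the inequality for good sets. If `S` induced a disconnected graph, at least
four vertices would have degree at least three in `H` (`IsPDS.connected`). -/

theorem Memory.write_apply (σ : Memory) (a i v b j : ℕ) :
    σ.write a i v b j = if b = a ∧ j = i then v else σ b j := by
  unfold Memory.write
  by_cases hb : b = a
  · subst hb
    by_cases hj : j = i <;> simp [hj]
  · simp [hb]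

theorem Memory.write_array (σ : Memory) (a i v b : ℕ) :
    σ.write a i v b = if b = a then Function.update (σ a) i v else σ b := by
  unfold Memory.write
  by_cases hb : b = a
  · subst hb; simp
  · simp [hb]

theorem Memory.write_of_ne (σ : Memory) {a b : ℕ} (i v : ℕ) (h : b ≠ a) :
    σ.write a i v b = σ b := by
  simp [Memory.write_array, h]

/-- The expression cannot exceed the largest number in the memory and `3`. -/
def Expr.small : Expr → Bool
  | .const k => decide (k ≤ 3)
  | .read _ _ => true
  | .sub e _ => e.small
  | _ => false

/-- The expression reads array `a`. -/
def Expr.reads (a : ℕ) : Expr → Bool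
  | .const _ => false
  | .read b i => a == b || i.reads a
  | .add e f => e.reads a || f.reads a
  | .sub e f => e.reads a || f.reads a
  | .mul e f => e.reads a || f.reads a

theorem Expr.eval_congr {σ τ : Memory} (e : Expr) (h : ∀ a, e.reads a = true → σ a = τ a) :
    e.eval σ = e.eval τ := by
  induction e with
  | const k => rfl
  | read b i ih =>
    simp only [Expr.eval]
    rw [ih fun a ha => h a (by simp [Expr.reads, ha]), h b (by simp [Expr.reads])]
  | add e f ihe ihf | sub e f ihe ihf | mul e f ihe ihf =>
    simp only [Expr.eval]
    rw [ihe fun a ha => h a (by simp [Expr.reads, ha]),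
      ihf fun a ha => h a (by simp [Expr.reads, ha])]

theorem Expr.eval_write {σ : Memory} {e : Expr} {a : ℕ} (i v : ℕ) (h : e.reads a = false) :
    e.eval (σ.write a i v) = e.eval σ :=
  e.eval_congr fun b hb => σ.write_of_ne i v (by rintro rfl; simp [h] at hb)

/-- A memory all of whose cells are at most `n`, with `n` in cell `0` of array `0`. -/
structure Valid (n : ℕ) (σ : Memory) : Prop where
  size : σ 0 0 = n
  le : ∀ a i, σ a i ≤ n

theorem Valid.write {n : ℕ} {σ : Memory} (h : Valid n σ) {a v : ℕ} (i : ℕ) (ha : 2 ≤ a)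
    (hv : v ≤ n) : Valid n (σ.write a i v) := by
  refine ⟨?_, fun b j => ?_⟩
  · rw [Memory.write_apply, if_neg (by omega), h.size]
  · rw [Memory.write_apply]
    split_ifs
    exacts [hv, h.le b j]

/-- Stored values must not exceed `n`; the bound `3 ≤ n` admits the constants up to `3`. -/
theorem Expr.eval_le_of_small {n : ℕ} {σ : Memory} (hn : 3 ≤ n) (h : Valid n σ) :
    ∀ e : Expr, e.small = true → e.eval σ ≤ n
  | .const k, he => by
    simp only [Expr.small, decide_eq_true_eq] at he
    simpa [Expr.eval] using he.trans hn
  | .read a i, _ => h.le _ _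
  | .sub e f, he => (Nat.sub_le _ _).trans (e.eval_le_of_small hn h he)

theorem Expr.Fits.mono {w w' : ℕ} {σ : Memory} (hw : w ≤ w') :
    ∀ {e : Expr}, e.Fits w σ → e.Fits w' σ
  | .const _, h => le_trans h hw
  | .read _ _, h => ⟨h.1.mono hw, h.2.trans hw⟩
  | .add _ _, h => ⟨h.1.mono hw, h.2.1.mono hw, h.2.2.trans hw⟩
  | .sub _ _, h => ⟨h.1.mono hw, h.2.mono hw⟩
  | .mul _ _, h => ⟨h.1.mono hw, h.2.1.mono hw, h.2.2.trans hw⟩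

theorem Exec.mono {w w' : ℕ} (hw : w ≤ w') {p : Program} {σ τ : Memory} {t : ℕ}
    (h : Exec w p σ t τ) : Exec w' p σ t τ := by
  induction h with
  | skip σ => exact .skip σ
  | store a i e σ hi he => exact .store a i e σ (hi.mono hw) (he.mono hw)
  | seq _ _ ih₁ ih₂ => exact .seq ih₁ ih₂
  | cond_true hf he _ ih => exact .cond_true (hf.mono hw) he ih
  | cond_false hf he _ ih => exact .cond_false (hf.mono hw) he ih
  | loop_true hf he _ _ ih₁ ih₂ => exact .loop_true (hf.mono hw) he ih₁ ih₂
  | loop_false hf he => exact .loop_false (hf.mono hw) he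

/-- The values in the evaluation of an expression are polynomially bounded. -/
theorem Expr.exists_fits (e : Expr) : ∃ c, ∀ n σ, 3 ≤ n → Valid n σ →
    e.Fits (n ^ c) σ ∧ e.eval σ ≤ n ^ c := by
  induction e with
  | const k =>
    refine ⟨k, fun n σ hn _ => ?_⟩
    have : k ≤ n ^ k := (Nat.lt_pow_self (by omega)).le
    exact ⟨this, this⟩
  | read a i ih =>
    obtain ⟨c, hc⟩ := ih
    refine ⟨c + 1, fun n σ hn h => ?_⟩
    have h1 : n ^ c ≤ n ^ (c + 1) := Nat.pow_le_pow_right (by omega) (by omega)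
    have h2 : σ a (i.eval σ) ≤ n ^ (c + 1) :=
      (h.le _ _).trans (Nat.le_self_pow (by omega) n)
    exact ⟨⟨(hc n σ hn h).1.mono h1, h2⟩, h2⟩
  | add e f ihe ihf =>
    obtain ⟨c, hc⟩ := ihe
    obtain ⟨d, hd⟩ := ihf
    refine ⟨c + d + 1, fun n σ hn h => ?_⟩
    have h1 : n ^ c ≤ n ^ (c + d) := Nat.pow_le_pow_right (by omega) (by omega)
    have h2 : n ^ d ≤ n ^ (c + d) := Nat.pow_le_pow_right (by omega) (by omega)
    -- One more factor `n` absorbs the sum of two terms, each at most `n ^ (c + d)`.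
    have h3 : 3 * n ^ (c + d) ≤ n ^ (c + d + 1) := by
      rw [pow_succ, mul_comm]; exact Nat.mul_le_mul_left _ hn
    have he := hc n σ hn h
    have hf := hd n σ hn h
    have h4 : e.eval σ + f.eval σ ≤ n ^ (c + d + 1) := by omega
    exact ⟨⟨he.1.mono (by omega), hf.1.mono (by omega), h4⟩, h4⟩
  | sub e f ihe ihf =>
    obtain ⟨c, hc⟩ := ihe
    obtain ⟨d, hd⟩ := ihf
    refine ⟨c + d, fun n σ hn h => ?_⟩
    have h1 : n ^ c ≤ n ^ (c + d) := Nat.pow_le_pow_right (by omega) (by omega)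
    have h2 : n ^ d ≤ n ^ (c + d) := Nat.pow_le_pow_right (by omega) (by omega)
    have he := hc n σ hn h
    have hf := hd n σ hn h
    exact ⟨⟨he.1.mono h1, hf.1.mono h2⟩, (Nat.sub_le _ _).trans (he.2.trans h1)⟩
  | mul e f ihe ihf =>
    obtain ⟨c, hc⟩ := ihe
    obtain ⟨d, hd⟩ := ihf
    refine ⟨c + d, fun n σ hn h => ?_⟩
    have h1 : n ^ c ≤ n ^ (c + d) := Nat.pow_le_pow_right (by omega) (by omega)
    have h2 : n ^ d ≤ n ^ (c + d) := Nat.pow_le_pow_right (by omega) (by omega)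
    have he := hc n σ hn h
    have hf := hd n σ hn h
    have h4 : e.eval σ * f.eval σ ≤ n ^ (c + d) := by
      rw [pow_add]; exact Nat.mul_le_mul he.2 hf.2
    exact ⟨⟨he.1.mono h1, hf.1.mono h2, h4⟩, h4⟩

/-- Programs whose loops are counting loops up to `n`. -/
inductive Stmt where
  | skip
  | store (a : ℕ) (i e : Expr)
  /-- Increase a cell, unless it already holds `n`. -/
  | inc (a : ℕ) (i : Expr)
  | seq (p q : Stmt)
  | cond (e : Expr) (p q : Stmt)
  /-- Execute `p` for the values `0, …, n - 1` of cell `0` of array `I`. -/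
  | forN (I : ℕ) (p : Stmt)

/-- The number of vertices. -/
abbrev Expr.size : Expr := .read 0 (.const 0)

/-- Cell `0` of array `a`. -/
abbrev Expr.var (a : ℕ) : Expr := .read a (.const 0)

/-! ### Semantics and running time of counting programs -/

namespace Stmt

def compile : Stmt → Program
  | skip => .skip
  | store a i e => .store a i e
  | inc a i =>
    .cond (.sub .size (.read a i)) (.store a i (.add (.read a i) (.const 1))) .skip
  | seq p q => .seq p.compile q.compile
  | cond e p q => .cond e p.compile q.compile
  | forN I p =>
    .seq (.store I (.const 0) (.const 0))
      (.loop (.sub .size (.var I))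
        (.seq p.compile (.store I (.const 0) (.add (.var I) (.const 1)))))

/-- The number of iterations is read once, while the compiled loop reads `n` and its counter again
at every test. For well-formed statements both agree, because array `0` is never written and the
body leaves the counter alone. -/
def sem : Stmt → Memory → Memory
  | skip, σ => σ
  | store a i e, σ => σ.write a (i.eval σ) (e.eval σ)
  | inc a i, σ =>
    if σ a (i.eval σ) < σ 0 0 then σ.write a (i.eval σ) (σ a (i.eval σ) + 1) else σ
  | seq p q, σ => q.sem (p.sem σ)
  | cond e p q, σ => if e.eval σ ≠ 0 then p.sem σ else q.sem σ
  | forN I p, σ =>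
    Nat.rec (motive := fun _ => Memory) (σ.write I 0 0)
      (fun k τ => (p.sem τ).write I 0 (k + 1)) (σ 0 0)

/-- The statement writes to array `a`. -/
def writes (a : ℕ) : Stmt → Bool
  | skip => false
  | store b _ _ => a == b
  | inc b _ => a == b
  | seq p q => p.writes a || q.writes a
  | cond _ p q => p.writes a || q.writes a
  | forN I p => a == I || p.writes a

/-- The statement does not write to the input, stores small values only, and does not write to its
loop variables. -/
def wf : Stmt → Bool
  | skip => true
  | store a _ e => decide (2 ≤ a) && e.small
  | inc a _ => decide (2 ≤ a)
  | seq p q => p.wf && q.wf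
  | cond _ p q => p.wf && q.wf
  | forN I p => decide (2 ≤ I) && !p.writes I && p.wf

/-- The nesting depth of loops. -/
def depth : Stmt → ℕ
  | skip => 0
  | store _ _ _ => 0
  | inc _ _ => 0
  | seq p q => max p.depth q.depth
  | cond _ p q => max p.depth q.depth
  | forN _ p => p.depth + 1

/-- The frame rule. Since `writes` is computable, most non-interference claims in the verification
reduce to `rfl`. -/
theorem sem_frame {a : ℕ} : ∀ (s : Stmt) (σ : Memory), s.writes a = false → s.sem σ a = σ a
  | skip, _, _ => rfl
  | store b i e, σ, h => σ.write_of_ne _ _ (by simpa [writes] using h)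
  | inc b i, σ, h => by
    simp only [sem]
    split_ifs
    · exact σ.write_of_ne _ _ (by simpa [writes] using h)
    · rfl
  | seq p q, σ, h => by
    simp only [writes, Bool.or_eq_false_iff] at h
    rw [sem, sem_frame q _ h.2, sem_frame p _ h.1]
  | cond e p q, σ, h => by
    simp only [writes, Bool.or_eq_false_iff] at h
    rw [sem]
    split_ifs
    exacts [sem_frame p _ h.1, sem_frame q _ h.2]
  | forN I p, σ, h => by
    simp only [writes, Bool.or_eq_false_iff, beq_eq_false_iff_ne] at h
    rw [sem]
    induction σ 0 0 with
    | zero => exact σ.write_of_ne _ _ h.1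
    | succ k ih =>
      refine (Memory.write_of_ne _ _ _ h.1).trans ((sem_frame p _ h.2).trans ih)

/-- All cells stay at most `n`, so every expression of the fixed program is bounded by a fixed power
of `n`; each level of loops multiplies the time by `n`. A single `c` serves as exponent of the word
capacity and as coefficient of the time. -/
theorem exists_exec_compile (s : Stmt) (hs : s.wf = true) : ∃ c, ∀ n σ, 3 ≤ n → Valid n σ →
    Valid n (s.sem σ) ∧ ∃ t, t ≤ c * n ^ s.depth ∧ Exec (n ^ c) s.compile σ t (s.sem σ) := by
  induction s with
  | skip => exact ⟨1, fun n σ _ h => ⟨h, 1, by simp [depth], .skip σ⟩⟩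
  | store a i e =>
    simp only [wf, Bool.and_eq_true, decide_eq_true_eq] at hs
    obtain ⟨c, hc⟩ := i.exists_fits
    obtain ⟨d, hd⟩ := e.exists_fits
    refine ⟨c + d + i.cost + e.cost + 1, fun n σ hn h => ⟨?_, i.cost + e.cost + 1, ?_, ?_⟩⟩
    · exact h.write _ hs.1 (e.eval_le_of_small hn h hs.2)
    · simp only [depth, pow_zero]; omega
    · exact .store a i e σ ((hc n σ hn h).1.mono (Nat.pow_le_pow_right (by omega) (by omega)))
        ((hd n σ hn h).1.mono (Nat.pow_le_pow_right (by omega) (by omega)))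
  | inc a i =>
    simp only [wf, decide_eq_true_eq] at hs
    obtain ⟨c, hc⟩ := i.exists_fits
    obtain ⟨d, hd⟩ := (Expr.sub .size (.read a i)).exists_fits
    obtain ⟨f, hf⟩ := (Expr.add (.read a i) (.const 1)).exists_fits
    set k := (Expr.sub .size (.read a i)).cost + i.cost +
      (Expr.add (.read a i) (.const 1)).cost + 3 with hk
    refine ⟨c + d + f + k, fun n σ hn h => ?_⟩
    have hle : ∀ x, x ≤ c + d + f + k → n ^ x ≤ n ^ (c + d + f + k) := fun x hx =>
      Nat.pow_le_pow_right (by omega) hx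
    by_cases hlt : σ a (i.eval σ) < σ 0 0
    · simp only [sem, if_pos hlt]
      refine ⟨h.write _ hs (by have := h.size; omega), _, ?_, .cond_true
        ((hd n σ hn h).1.mono (hle _ (by omega))) ?_ (.store a i _ σ
          ((hc n σ hn h).1.mono (hle _ (by omega))) ((hf n σ hn h).1.mono (hle _ (by omega))))⟩
      · simp only [depth, pow_zero]; omega
      · simp only [Expr.eval]; omega
    · simp only [sem, if_neg hlt]
      refine ⟨h, _, ?_, .cond_false ((hd n σ hn h).1.mono (hle _ (by omega))) ?_ (.skip σ)⟩
      · simp only [depth, pow_zero]; omega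
      · simp only [Expr.eval]; omega
  | seq p q ihp ihq =>
    simp only [wf, Bool.and_eq_true] at hs
    obtain ⟨c, hc⟩ := ihp hs.1
    obtain ⟨d, hd⟩ := ihq hs.2
    refine ⟨c + d, fun n σ hn h => ?_⟩
    obtain ⟨hv, s, hs, hp⟩ := hc n σ hn h
    obtain ⟨hv', t, ht, hq⟩ := hd n _ hn hv
    refine ⟨hv', s + t, ?_, .seq (hp.mono (Nat.pow_le_pow_right (by omega) (by omega)))
      (hq.mono (Nat.pow_le_pow_right (by omega) (by omega)))⟩
    rw [add_mul]
    exact Nat.add_le_add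
      (hs.trans (Nat.mul_le_mul_left _ (Nat.pow_le_pow_right (by omega) (le_max_left _ _))))
      (ht.trans (Nat.mul_le_mul_left _ (Nat.pow_le_pow_right (by omega) (le_max_right _ _))))
  | cond e p q ihp ihq =>
    simp only [wf, Bool.and_eq_true] at hs
    obtain ⟨c, hc⟩ := ihp hs.1
    obtain ⟨d, hd⟩ := ihq hs.2
    obtain ⟨f, hf⟩ := e.exists_fits
    refine ⟨c + d + f + e.cost + 1, fun n σ hn h => ?_⟩
    have hle : ∀ x, x ≤ c + d + f + e.cost + 1 → n ^ x ≤ n ^ (c + d + f + e.cost + 1) :=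
      fun x hx => Nat.pow_le_pow_right (by omega) hx
    have hpos : ∀ k, 1 ≤ n ^ k := fun k => Nat.one_le_pow _ _ (by omega)
    have key : ∀ t x k, t ≤ x * n ^ k → k ≤ (cond e p q).depth → x + e.cost + 1 ≤
        c + d + f + e.cost + 1 →
        e.cost + 1 + t ≤ (c + d + f + e.cost + 1) * n ^ (cond e p q).depth := by
      intro t x k ht hk hx
      have h1 : t ≤ x * n ^ (cond e p q).depth :=
        ht.trans (Nat.mul_le_mul_left _ (Nat.pow_le_pow_right (by omega) hk))
      have h2 : e.cost + 1 ≤ (e.cost + 1) * n ^ (cond e p q).depth :=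
        Nat.le_mul_of_pos_right _ (hpos _)
      calc e.cost + 1 + t ≤ (e.cost + 1) * n ^ (cond e p q).depth +
            x * n ^ (cond e p q).depth := by omega
        _ = (x + e.cost + 1) * n ^ (cond e p q).depth := by ring
        _ ≤ _ := Nat.mul_le_mul_right _ hx
    simp only [sem]
    split_ifs with he
    · obtain ⟨hv, t, ht, hp⟩ := hc n σ hn h
      exact ⟨hv, _, key t c _ ht (le_max_left _ _) (by omega),
        .cond_true ((hf n σ hn h).1.mono (hle _ (by omega))) he (hp.mono (hle _ (by omega)))⟩
    · obtain ⟨hv, t, ht, hp⟩ := hd n σ hn h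
      exact ⟨hv, _, key t d _ ht (le_max_right _ _) (by omega),
        .cond_false ((hf n σ hn h).1.mono (hle _ (by omega))) (by omega)
          (hp.mono (hle _ (by omega)))⟩
  | forN I p ih =>
    simp only [wf, Bool.and_eq_true, Bool.not_eq_true', decide_eq_true_eq] at hs
    obtain ⟨⟨hI, hw⟩, hp⟩ := hs
    obtain ⟨c, hc⟩ := ih hp
    obtain ⟨d, hd⟩ := (Expr.sub .size (.var I)).exists_fits
    obtain ⟨f, hf⟩ := (Expr.add (.var I) (.const 1)).exists_fits
    -- The time bound below needs `c + 24`; the rest is generosity.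
    refine ⟨c + d + f + 50, fun n σ hn h => ?_⟩
    set w := c + d + f + 50 with hwdef
    have hle : ∀ x, x ≤ w → n ^ x ≤ n ^ w := fun x hx => Nat.pow_le_pow_right (by omega) hx
    have hpos : ∀ k, 1 ≤ n ^ k := fun k => Nat.one_le_pow _ _ (by omega)
    have hfit0 : (Expr.const 0).Fits (n ^ w) σ := Nat.zero_le _
    have hfit0' : ∀ τ, (Expr.const 0).Fits (n ^ w) τ := fun τ => Nat.zero_le _
    set it : ℕ → Memory := fun k => Nat.rec (motive := fun _ => Memory) (σ.write I 0 0)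
      (fun k τ => (p.sem τ).write I 0 (k + 1)) k with hit
    have hsucc : ∀ k, it (k + 1) = (p.sem (it k)).write I 0 (k + 1) := fun k => rfl
    have hidx : ∀ k, it k I 0 = k := by
      intro k
      cases k with
      | zero => simp [hit, Memory.write_apply]
      | succ k => rw [hsucc, Memory.write_apply]; simp
    have hval : ∀ k, k ≤ n → Valid n (it k) := by
      intro k
      induction k with
      | zero => intro _; exact h.write _ hI (by omega)
      | succ k ihk =>
        intro hk
        rw [hsucc]
        exact (hc n _ hn (ihk (by omega))).1.write _ hI hk
    -- `j` iterations remain. The test and the increment cost six steps each, which `15` covers; the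
    -- last, failing test costs another six.
    have hloop : ∀ j k, k + j = n → ∃ t, t ≤ j * (c * n ^ p.depth + 15) + 6 ∧
        Exec (n ^ w) (.loop (.sub .size (.var I))
          (.seq p.compile (.store I (.const 0) (.add (.var I) (.const 1))))) (it k) t (it n) := by
      intro j
      induction j with
      | zero =>
        intro k hk
        obtain rfl : k = n := by omega
        refine ⟨_, ?_, .loop_false ((hd k _ hn (hval k le_rfl)).1.mono (hle _ (by omega))) ?_⟩
        · simp [Expr.cost]
        · simp [Expr.eval, (hval k le_rfl).size, hidx k]
      | succ j ihj =>
        intro k hk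
        obtain ⟨t, ht, hex⟩ := ihj (k + 1) (by omega)
        have hvk := hval k (by omega)
        obtain ⟨hv1, s, hs, hex1⟩ := hc n _ hn hvk
        have hI' : p.sem (it k) I 0 = k := by rw [sem_frame p _ hw, hidx]
        have hst : Exec (n ^ w) (.store I (.const 0) (.add (.var I) (.const 1)))
            (p.sem (it k)) _ _ :=
          .store I (.const 0) (.add (.var I) (.const 1)) (p.sem (it k)) (hfit0' _)
            ((hf n _ hn hv1).1.mono (hle _ (by omega)))
        have heq : (p.sem (it k)).write I ((Expr.const 0).eval (p.sem (it k)))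
            ((Expr.add (.var I) (.const 1)).eval (p.sem (it k))) = it (k + 1) := by
          simp only [Expr.eval, hI', hsucc]
        rw [heq] at hst
        refine ⟨_, ?_, .loop_true ((hd n _ hn hvk).1.mono (hle _ (by omega))) ?_
          (.seq (hex1.mono (hle _ (by omega))) hst) hex⟩
        · simp only [Expr.cost]
          have : (j + 1) * (c * n ^ p.depth + 15) = j * (c * n ^ p.depth + 15) +
            (c * n ^ p.depth + 15) := by ring
          omega
        · simp only [Expr.eval, hvk.size, hidx k]; omega
    obtain ⟨t, ht, hex⟩ := hloop n 0 (by omega)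
    have hsem : (forN I p).sem σ = it n := by
      simp only [sem, h.size, hit]
    rw [hsem]
    refine ⟨hval n le_rfl, _, ?_, .seq (.store I (.const 0) (.const 0) σ hfit0 hfit0) hex⟩
    simp only [Expr.cost, depth]
    have h1 : n ^ (p.depth + 1) = n * n ^ p.depth := by ring
    have h2 : n ≤ n * n ^ p.depth := Nat.le_mul_of_pos_right _ (hpos _)
    calc 1 + 1 + 1 + t ≤ n * (c * n ^ p.depth + 15) + 9 := by omega
      _ = c * (n * n ^ p.depth) + 15 * n + 9 := by ring
      _ ≤ c * (n * n ^ p.depth) + 15 * (n * n ^ p.depth) + 9 * (n * n ^ p.depth) := by omega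
      _ = (c + 24) * (n * n ^ p.depth) := by ring
      _ ≤ w * n ^ (p.depth + 1) := by
        rw [h1]; exact Nat.mul_le_mul_right _ (by omega)

/-- The invariant rule for counting loops. -/
theorem forN_induction {I : ℕ} {p : Stmt} {σ : Memory} {n : ℕ} (hσ : σ 0 0 = n)
    (hI : I ≠ 0) (hp : p.writes 0 = false) (P : ℕ → Memory → Prop)
    (h0 : P 0 (σ.write I 0 0))
    (hs : ∀ k τ, k < n → τ 0 0 = n → τ I 0 = k → P k τ → P (k + 1) ((p.sem τ).write I 0 (k + 1))) :
    P n ((forN I p).sem σ) := by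
  simp only [sem, hσ]
  set it : ℕ → Memory := fun k => Nat.rec (motive := fun _ => Memory) (σ.write I 0 0)
      (fun k τ => (p.sem τ).write I 0 (k + 1)) k with hit
  have hsucc : ∀ k, it (k + 1) = (p.sem (it k)).write I 0 (k + 1) := fun k => rfl
  have hidx : ∀ k, it k I 0 = k := by
    intro k
    cases k with
    | zero => simp [hit, Memory.write_apply]
    | succ k => rw [hsucc, Memory.write_apply]; simp
  have hn : ∀ k, it k 0 0 = n := by
    intro k
    induction k with
    | zero => simpa [hit, Memory.write_apply, hI.symm] using hσ
    | succ k ih => rw [hsucc, Memory.write_of_ne _ _ _ hI.symm, sem_frame p _ hp, ih]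
  have : ∀ k, k ≤ n → P k (it k) := by
    intro k
    induction k with
    | zero => intro _; exact h0
    | succ k ih => intro hk; rw [hsucc]; exact hs k _ (by omega) (hn k) (hidx k) (ih (by omega))
  exact this n le_rfl

end Stmt

end RAM

namespace RAM

/-! ### Derived expressions and statements -/

/-- Equality test. -/
def Expr.eq (e f : Expr) : Expr := .sub (.const 1) (.add (.sub e f) (.sub f e))

@[simp] theorem Expr.eval_eq (e f : Expr) (σ : Memory) :
    (e.eq f).eval σ = if e.eval σ = f.eval σ then 1 else 0 := by
  simp only [Expr.eq, Expr.eval]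
  split_ifs <;> omega

/-- Adjacency in the complement of the input graph. -/
def Expr.coadj (e f : Expr) : Expr :=
  .sub (.sub (.const 1) (.read 1 (.add (.mul e .size) f))) (e.eq f)

/-- The memory contains `n` and the adjacency matrix of the complement of `H`. -/
structure Input (n : ℕ) (H : SimpleGraph ℕ) (σ : Memory) : Prop where
  size : σ 0 0 = n
  entry : ∀ x y, x < n → y < n → x ≠ y → (H.Adj x y ↔ σ 1 (x * n + y) = 0)

theorem Input.congr {n : ℕ} {H : SimpleGraph ℕ} {σ τ : Memory} (h : Input n H σ)
    (h0 : τ 0 = σ 0) (h1 : τ 1 = σ 1) : Input n H τ :=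
  ⟨by rw [h0, h.size], fun x y hx hy hxy => by rw [h1, h.entry x y hx hy hxy]⟩

open scoped Classical in
theorem Input.eval_coadj {n : ℕ} {H : SimpleGraph ℕ} {σ : Memory} (h : Input n H σ) {e f : Expr}
    (he : e.eval σ < n) (hf : f.eval σ < n) :
    (e.coadj f).eval σ = if H.Adj (e.eval σ) (f.eval σ) then 1 else 0 := by
  simp only [Expr.coadj, Expr.eval, Expr.eval_eq, h.size]
  by_cases hxy : e.eval σ = f.eval σ
  · simp [hxy]
  · have := h.entry _ _ he hf hxy
    simp only [this, if_neg hxy]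
    split_ifs <;> omega

/-- The last `j < k` that satisfies `p`, and `d` if there is none. -/
def findLast (p : ℕ → Prop) [DecidablePred p] (d : ℕ) : ℕ → ℕ
  | 0 => d
  | k + 1 => if p k then k else findLast p d k

theorem findLast_spec (p : ℕ → Prop) [DecidablePred p] (d k : ℕ) :
    (findLast p d k < k ∧ p (findLast p d k)) ∨ (findLast p d k = d ∧ ∀ j < k, ¬p j) := by
  induction k with
  | zero => exact .inr ⟨rfl, by simp⟩
  | succ k ih =>
    rw [findLast]
    split_ifs with h
    · exact .inl ⟨by omega, h⟩
    · rcases ih with ih | ih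
      · exact .inl ⟨by omega, ih.2⟩
      · refine .inr ⟨ih.1, fun j hj => ?_⟩
        rcases Nat.lt_succ_iff_lt_or_eq.1 hj with hj | rfl
        exacts [ih.2 j hj, h]

namespace Stmt

/-- Store the number of `j < n` for which `e` is nonzero; the loop variable is `I`. -/
def count (I a : ℕ) (i e : Expr) : Stmt :=
  seq (store a i (.const 0)) (forN I (cond e (inc a i) skip))

/-- Store some `j < n` for which `e` is nonzero, or `n` if there is none. -/
def find (I a : ℕ) (e : Expr) : Stmt :=
  seq (store a (.const 0) .size) (forN I (cond e (store a (.const 0) (.var I)) skip))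

/-- Store `e` in the first `n` cells of array `a`. -/
def map (I a : ℕ) (e : Expr) : Stmt := forN I (store a (.var I) e)

/-- Store in cell `v` the number of `j < n` for which `e` is nonzero, for all `v < n`. -/
def countAll (I J a : ℕ) (e : Expr) : Stmt := forN I (count J a (.var I) e)

/-- The whole final memory is determined, so that a count inside another loop can be evaluated
further. The expression `e` must not read the cell that is being computed, but it may read the loop
variable. -/
theorem sem_count {I a n : ℕ} {i e : Expr} {σ : Memory} (hσ : σ 0 0 = n) (hI : I ≠ 0)
    (ha : a ≠ 0) (hIa : I ≠ a) (hia : i.reads a = false) (hiI : i.reads I = false)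
    (hea : e.reads a = false) :
    (count I a i e).sem σ = (σ.write a (i.eval σ)
      #{j ∈ range n | e.eval (σ.write I 0 j) ≠ 0}).write I 0 n := by
  rw [count, sem]
  refine forN_induction (P := fun k τ => τ = (σ.write a (i.eval σ)
    #{j ∈ range k | e.eval (σ.write I 0 j) ≠ 0}).write I 0 k) ?_ hI ?_ ?_ ?_
  · simp [sem, Memory.write_apply, ha.symm, hσ]
  · simp [writes, ha.symm]
  · simp [sem, Expr.eval]
  · rintro k τ hk h0 hτI rfl
    have hc : e.eval ((σ.write a (i.eval σ) #{j ∈ range k | e.eval (σ.write I 0 j) ≠ 0}).write I 0 k)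
        = e.eval (σ.write I 0 k) := by
      refine e.eval_congr fun b hb => ?_
      have hba : b ≠ a := by rintro rfl; simp [hea] at hb
      simp [Memory.write_array, hba, hIa]
    have hi : ∀ v, i.eval ((σ.write a (i.eval σ) v).write I 0 k) = i.eval σ := fun v => by
      rw [Expr.eval_write _ _ hiI, Expr.eval_write _ _ hia]
    -- The count is still below `n`, so the guard of `inc` lets every increment pass.
    have hcard : #{j ∈ range k | e.eval (σ.write I 0 j) ≠ 0} < n :=
      ((card_filter_le _ _).trans (card_range k).le).trans_lt hk
    simp only [sem, hc, hi, h0]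
    rw [range_add_one, filter_insert]
    split_ifs with h1 h2
    · rw [card_insert_of_notMem (by simp)]
      funext b j
      simp only [Memory.write_apply]
      grind
    · exact absurd (by simpa [Memory.write_apply, hIa.symm] using hcard) h2
    · funext b j
      simp only [Memory.write_apply]
      grind

theorem sem_find {I a n : ℕ} {e : Expr} {σ : Memory} (hσ : σ 0 0 = n) (hI : I ≠ 0)
    (ha : a ≠ 0) (hIa : I ≠ a) (hea : e.reads a = false) :
    (find I a e).sem σ =
      (σ.write a 0 (findLast (fun j => e.eval (σ.write I 0 j) ≠ 0) n n)).write I 0 n := by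
  rw [find, sem]
  refine forN_induction (P := fun k τ => τ = (σ.write a 0
    (findLast (fun j => e.eval (σ.write I 0 j) ≠ 0) n k)).write I 0 k) ?_ hI ?_ ?_ ?_
  · simp [sem, Memory.write_apply, ha.symm, hσ]
  · simp [writes, ha.symm]
  · simp [sem, Expr.eval, hσ, findLast]
  · rintro k τ hk h0 hτI rfl
    have hc : ∀ v, e.eval ((σ.write a 0 v).write I 0 k) = e.eval (σ.write I 0 k) := fun v => by
      refine e.eval_congr fun b hb => ?_
      have hba : b ≠ a := by rintro rfl; simp [hea] at hb
      simp [Memory.write_array, hba, hIa]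
    simp only [sem, hc, findLast]
    split_ifs with h1
    · funext b j
      simp only [Memory.write_apply, Expr.eval]
      grind
    · funext b j
      simp only [Memory.write_apply]
      grind

theorem sem_map {I a n : ℕ} {e : Expr} {σ : Memory} (hσ : σ 0 0 = n) (hI : I ≠ 0)
    (ha : a ≠ 0) (hIa : I ≠ a) (hea : e.reads a = false) {v : ℕ} (hv : v < n) :
    (map I a e).sem σ a v = e.eval (σ.write I 0 v) := by
  have := forN_induction (p := store a (.var I) e) hσ hI (by simp [writes, ha.symm])
    (fun k τ => (∀ b, b ≠ a → b ≠ I → τ b = σ b) ∧ (∀ j, j ≠ 0 → τ I j = σ I j) ∧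
      ∀ v < k, τ a v = e.eval (σ.write I 0 v)) ?_ ?_
  · exact this.2.2 v hv
  · refine ⟨fun b _ hb => σ.write_of_ne _ _ hb, fun j hj => by simp [Memory.write_apply, hj], by simp⟩
  · rintro k τ hk h0 hτ ⟨h1, h2, h3⟩
    have hc : e.eval τ = e.eval (σ.write I 0 k) := by
      refine e.eval_congr fun b hb => ?_
      have hba : b ≠ a := by rintro rfl; simp [hea] at hb
      by_cases hbI : b = I
      · subst hbI
        funext j
        rw [Memory.write_apply]
        by_cases hj : j = 0
        · simp [hj, hτ]
        · simp [hj, h2 j hj]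
      · rw [h1 b hba hbI, σ.write_of_ne _ _ hbI]
    refine ⟨fun b hb hbI => ?_, fun j hj => ?_, fun v hv => ?_⟩
    · simp [sem, Memory.write_array, hb, hbI, h1]
    · simp [sem, Memory.write_apply, hj, hIa, h2]
    · simp only [sem, Expr.eval, Memory.write_apply, hIa.symm, hτ, hc, false_and, if_false,
        true_and]
      split_ifs with h
      · rw [h]
      · exact h3 v (by omega)

/-- The invariant also records that the loop arrays change in cell `0` only; otherwise the value of
`e` could not be transferred back to the initial memory. -/
theorem sem_countAll {I J a n : ℕ} {e : Expr} {σ : Memory} (hσ : σ 0 0 = n) (hI : I ≠ 0)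
    (hJ : J ≠ 0) (ha : a ≠ 0) (hIa : I ≠ a) (hJa : J ≠ a) (hIJ : I ≠ J)
    (hea : e.reads a = false) {v : ℕ} (hv : v < n) :
    (countAll I J a e).sem σ a v =
      #{j ∈ range n | e.eval ((σ.write I 0 v).write J 0 j) ≠ 0} := by
  have hw : (count J a (.var I) e).writes 0 = false := by
    simp [count, writes, ha.symm, hJ.symm]
  have := forN_induction (p := count J a (.var I) e) hσ hI hw
    (fun k τ => (∀ b, b ≠ a → b ≠ I → b ≠ J → τ b = σ b) ∧ (∀ j, j ≠ 0 → τ I j = σ I j) ∧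
      (∀ j, j ≠ 0 → τ J j = σ J j) ∧
      ∀ v < k, τ a v = #{j ∈ range n | e.eval ((σ.write I 0 v).write J 0 j) ≠ 0}) ?_ ?_
  · exact this.2.2.2 v hv
  · refine ⟨fun b _ hb _ => σ.write_of_ne _ _ hb, fun j hj => by simp [Memory.write_apply, hj],
      fun j hj => by simp [Memory.write_apply, hj], by simp⟩
  · rintro k τ hk h0 hτ ⟨h1, h2, h3, h4⟩
    have hc : ∀ j, e.eval (τ.write J 0 j) = e.eval ((σ.write I 0 k).write J 0 j) := fun j => by
      refine e.eval_congr fun b hb => ?_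
      have hba : b ≠ a := by rintro rfl; simp [hea] at hb
      funext i
      simp only [Memory.write_apply]
      by_cases hbI : b = I
      · subst hbI
        by_cases hi : i = 0
        · simp [hi, hτ, hIJ]
        · simp [hi, h2 i hi]
      · by_cases hbJ : b = J
        · subst hbJ
          by_cases hi : i = 0
          · simp [hi]
          · simp [hi, h3 i hi]
        · simp [hbI, hbJ, h1 b hba hbI hbJ]
    rw [sem_count h0 hJ ha hJa (by simp [Expr.reads, hIa.symm]) (by simp [Expr.reads, hIJ.symm]) hea]
    simp only [hc]
    refine ⟨fun b hb hbI hbJ => ?_, fun j hj => ?_, fun j hj => ?_, fun v hv => ?_⟩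
    · simp [Memory.write_array, hb, hbI, hbJ, h1]
    · simp [Memory.write_apply, hj, hIa, h2]
    · simp [Memory.write_apply, hj, hJa, h3]
    · simp only [Expr.eval, Memory.write_apply, hIa.symm, hJa.symm, hτ, false_and, if_false,
        true_and]
      split_ifs with h
      · rw [h]
      · exact h4 v (by omega)

end Stmt

end RAM

/-! ### Graphs all of whose vertices but two have degree at most two -/

namespace PDS

open scoped Classical in
/-- The number of neighbours of `v` in `D`. -/
noncomputable def nb (H : SimpleGraph ℕ) (D : Finset ℕ) (v : ℕ) : ℕ := #{x ∈ D | H.Adj v x}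

/-- `D` is the complement of a proportionally dense subgraph of the complement of `H`. -/
structure Good (n : ℕ) (H : SimpleGraph ℕ) (D : Finset ℕ) : Prop where
  sub : D ⊆ range n
  pos : 1 ≤ #D
  card : #D + 2 ≤ n
  sat : ∀ v < n, v ∉ D → nb H (range n) v * #D ≤ nb H D v * (n - 1)

/-- All vertices of `H` but `a` and `b` have degree at most two. -/
structure LowGraph (n : ℕ) (H : SimpleGraph ℕ) (a b : ℕ) : Prop where
  lt : ∀ {u v}, H.Adj u v → v < n
  a_lt : a < n
  b_lt : b < n
  ne : a ≠ b
  low : ∀ v, v ≠ a → v ≠ b → nb H (range n) v ≤ 2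

section nb

variable {H : SimpleGraph ℕ} {D E : Finset ℕ} {v : ℕ}

theorem nb_mono (h : D ⊆ E) : nb H D v ≤ nb H E v := by
  classical exact card_le_card (filter_subset_filter _ h)

theorem nb_pos : 0 < nb H D v ↔ ∃ x ∈ D, H.Adj v x := by
  classical simp [nb, card_pos, Finset.Nonempty]

theorem nb_union (h : Disjoint D E) : nb H (D ∪ E) v = nb H D v + nb H E v := by
  classical rw [nb, filter_union, card_union_of_disjoint (disjoint_filter_filter h)]; rfl

theorem nb_le_card : nb H D v ≤ #D := by
  classical exact card_filter_le _ _

theorem sum_nb_comm (D E : Finset ℕ) : ∑ x ∈ D, nb H E x = ∑ z ∈ E, nb H D z := by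
  classical
  simp only [nb, card_filter]
  rw [sum_comm]
  simp only [H.adj_comm]

theorem nb_singleton (z : ℕ) [Decidable (H.Adj v z)] :
    nb H {z} v = if H.Adj v z then 1 else 0 := by
  by_cases h : H.Adj v z <;> simp [nb, filter_singleton, h]

end nb

theorem LowGraph.lt_left {n a b : ℕ} {H : SimpleGraph ℕ} (h : LowGraph n H a b) {u v : ℕ}
    (huv : H.Adj u v) : u < n := h.lt huv.symm

theorem LowGraph.card_le_two {n a b : ℕ} {H : SimpleGraph ℕ} (h : LowGraph n H a b) {v : ℕ}
    (ha : v ≠ a) (hb : v ≠ b) {T : Finset ℕ} (hT : ∀ x ∈ T, H.Adj v x) : #T ≤ 2 := by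
  classical
  refine le_trans (card_le_card fun x hx => ?_) (h.low v ha hb)
  exact mem_filter.2 ⟨mem_range.2 (h.lt (hT x hx)), hT x hx⟩

theorem LowGraph.not_three {n a b : ℕ} {H : SimpleGraph ℕ} (h : LowGraph n H a b) {v x y z : ℕ}
    (ha : v ≠ a) (hb : v ≠ b) (hx : H.Adj v x) (hy : H.Adj v y) (hz : H.Adj v z)
    (hxy : x ≠ y) (hxz : x ≠ z) (hyz : y ≠ z) : False := by
  have := h.card_le_two ha hb (T := {x, y, z}) (by simp [hx, hy, hz])
  rw [card_eq_three.2 ⟨x, y, z, hxy, hxz, hyz, rfl⟩] at this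
  omega

open scoped Classical in
/-- The vertices that have to be dominated without `a` and `b` if `X ⊆ {a, b}` is selected. -/
noncomputable def targets (n : ℕ) (H : SimpleGraph ℕ) (a b : ℕ) (X : Finset ℕ) : Finset ℕ :=
  {v ∈ range n | v ≠ a ∧ v ≠ b ∧ 0 < nb H (range n) v ∧ ∀ z ∈ X, ¬H.Adj v z}

theorem LowGraph.mem_targets {n a b : ℕ} {H : SimpleGraph ℕ} (h : LowGraph n H a b)
    {X : Finset ℕ} {v w : ℕ} (hvw : H.Adj v w) :
    v ∈ targets n H a b X ↔ v ≠ a ∧ v ≠ b ∧ ∀ z ∈ X, ¬H.Adj v z := by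
  have : 0 < nb H (range n) v := nb_pos.2 ⟨w, mem_range.2 (h.lt hvw), hvw⟩
  simp [targets, this, h.lt_left hvw]

/-- A partition of `U` into the components of the graph induced by `U`, which are ordered in such a
way that consecutive vertices are adjacent. -/
structure Decomp (H : SimpleGraph ℕ) (U : Finset ℕ) (comp pos : ℕ → ℕ) : Prop where
  closed : ∀ v ∈ U, ∀ w ∈ U, H.Adj v w → comp v = comp w
  inj : ∀ v ∈ U, ∀ w ∈ U, comp v = comp w → pos v = pos w → v = w
  pred : ∀ v ∈ U, pos v ≠ 0 → ∃ w ∈ U, H.Adj w v ∧ comp w = comp v ∧ pos w + 1 = pos v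

/-- The component with name `c`. -/
def cls (U : Finset ℕ) (comp : ℕ → ℕ) (c : ℕ) : Finset ℕ := {v ∈ U | comp v = c}

/-- The vertices of a component whose positions are congruent to `r`. -/
def sel (U : Finset ℕ) (comp pos : ℕ → ℕ) (c r : ℕ) : Finset ℕ :=
  {v ∈ cls U comp c | pos v % 3 = r}

/-- The vertices whose positions are congruent to the number that `s` assigns to their component. -/
def selection (U : Finset ℕ) (comp pos s : ℕ → ℕ) : Finset ℕ :=
  {v ∈ U | pos v % 3 = s (comp v)}

/-- The sum of the domination numbers of the components. -/
def domSum (U : Finset ℕ) (comp : ℕ → ℕ) : ℕ := ∑ c ∈ U.image comp, (#(cls U comp c) + 2) / 3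

/-- The positions congruent to `s` dominate a path with `m` vertices, and there are as few of them
as possible. -/
def ValidShift (m s : ℕ) : Prop :=
  (m % 3 = 0 ∧ s = 1) ∨ (m % 3 = 1 ∧ s = 0) ∨ (m % 3 = 2 ∧ s ≤ 1)

theorem mem_cls {U : Finset ℕ} {comp : ℕ → ℕ} {c v : ℕ} :
    v ∈ cls U comp c ↔ v ∈ U ∧ comp v = c := by simp [cls]

theorem mem_sel {U : Finset ℕ} {comp pos : ℕ → ℕ} {c r v : ℕ} :
    v ∈ sel U comp pos c r ↔ (v ∈ U ∧ comp v = c) ∧ pos v % 3 = r := by simp [sel, mem_cls]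

theorem mem_selection {U : Finset ℕ} {comp pos s : ℕ → ℕ} {v : ℕ} :
    v ∈ selection U comp pos s ↔ v ∈ U ∧ pos v % 3 = s (comp v) := by simp [selection]

theorem eq_range_card {S : Finset ℕ} (h : ∀ k, k + 1 ∈ S → k ∈ S) : S = range #S := by
  have hdown : ∀ k, k ∈ S → ∀ j ≤ k, j ∈ S := by
    intro k
    induction k with
    | zero => intro hk j hj; rwa [Nat.le_zero.1 hj]
    | succ k ih =>
      intro hk j hj
      rcases Nat.le_succ_iff.1 hj with hj | rfl
      exacts [ih (h k hk) j hj, hk]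
  refine eq_of_subset_of_card_le (fun k hk => ?_) (by simp)
  have : range (k + 1) ⊆ S := fun j hj => hdown k hk j (by simpa [Nat.lt_succ_iff] using hj)
  simpa using card_le_card this

theorem card_mod_three (m : ℕ) : #{k ∈ range m | k % 3 = 0} = (m + 2) / 3 ∧
    #{k ∈ range m | k % 3 = 1} = (m + 1) / 3 ∧ #{k ∈ range m | k % 3 = 2} = m / 3 := by
  induction m with
  | zero => simp
  | succ m ih =>
    obtain ⟨h0, h1, h2⟩ := ih
    simp only [range_add_one, filter_insert]
    have : m % 3 = 0 ∨ m % 3 = 1 ∨ m % 3 = 2 := by omega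
    rcases this with h | h | h <;> simp [h, h0, h1, h2] <;> omega

/-! ### Domination of paths and cycles by residue classes of positions -/

namespace Decomp

variable {H : SimpleGraph ℕ} {U : Finset ℕ} {comp pos : ℕ → ℕ} {c : ℕ}

theorem injOn (hd : Decomp H U comp pos) (c : ℕ) : Set.InjOn pos (cls U comp c) := by
  intro v hv w hw h
  have hv := mem_cls.1 (mem_coe.1 hv)
  have hw := mem_cls.1 (mem_coe.1 hw)
  exact hd.inj v hv.1 w hw.1 (hv.2.trans hw.2.symm) h

/-- Predecessors make the set of positions downward closed, and an initial segment of the natural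
numbers is determined by its size. -/
theorem image_pos (hd : Decomp H U comp pos) (c : ℕ) :
    (cls U comp c).image pos = range #(cls U comp c) := by
  conv_rhs => rw [← card_image_of_injOn (hd.injOn c)]
  refine eq_range_card fun k hk => ?_
  obtain ⟨v, hv, hvk⟩ := mem_image.1 hk
  obtain ⟨hvU, hvc⟩ := mem_cls.1 hv
  obtain ⟨w, hwU, -, hwc, hw⟩ := hd.pred v hvU (by omega)
  exact mem_image.2 ⟨w, mem_cls.2 ⟨hwU, hwc.trans hvc⟩, by omega⟩

theorem pos_lt (hd : Decomp H U comp pos) {v : ℕ} (hv : v ∈ cls U comp c) :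
    pos v < #(cls U comp c) := by
  rw [← mem_range, ← hd.image_pos c]
  exact mem_image_of_mem _ hv

theorem exists_pos (hd : Decomp H U comp pos) {k : ℕ} (hk : k < #(cls U comp c)) :
    ∃ v ∈ cls U comp c, pos v = k := by
  rwa [← mem_range, ← hd.image_pos c, mem_image] at hk

/-- The vertex at the next position has a predecessor in the same component, at the position of `v`;
by injectivity this is `v`. -/
theorem exists_succ (hd : Decomp H U comp pos) {v : ℕ} (hv : v ∈ cls U comp c)
    (h : pos v + 1 < #(cls U comp c)) : ∃ w ∈ cls U comp c, H.Adj v w ∧ pos w = pos v + 1 := by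
  obtain ⟨w, hw, hwp⟩ := hd.exists_pos h
  obtain ⟨hwU, hwc⟩ := mem_cls.1 hw
  obtain ⟨hvU, hvc⟩ := mem_cls.1 hv
  obtain ⟨x, hxU, hxw, hxc, hxp⟩ := hd.pred w hwU (by omega)
  obtain rfl : x = v := hd.inj x hxU v hvU (by rw [hxc, hwc, hvc]) (by omega)
  exact ⟨w, hw, hxw, hwp⟩

theorem card_sel (hd : Decomp H U comp pos) (c r : ℕ) :
    #(sel U comp pos c r) = #{k ∈ range #(cls U comp c) | k % 3 = r} := by
  have h : (sel U comp pos c r).image pos = {k ∈ range #(cls U comp c) | k % 3 = r} := by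
    rw [← hd.image_pos c, filter_image]; rfl
  rw [← h, card_image_of_injOn]
  exact (hd.injOn c).mono (coe_subset.2 (filter_subset _ _))

theorem card_sel_of_valid (hd : Decomp H U comp pos) {c r : ℕ}
    (h : ValidShift #(cls U comp c) r) : #(sel U comp pos c r) = (#(cls U comp c) + 2) / 3 := by
  rw [hd.card_sel]
  obtain ⟨h0, h1, h2⟩ := card_mod_three #(cls U comp c)
  rcases h with ⟨hm, rfl⟩ | ⟨hm, rfl⟩ | ⟨hm, hr⟩
  · omega
  · exact h0
  · interval_cases r <;> omega

theorem exists_mem_sel (hd : Decomp H U comp pos) {r v : ℕ} (hv : v ∈ cls U comp c)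
    (h : pos v % 3 = r ∨ (pos v ≠ 0 ∧ (pos v + 2) % 3 = r) ∨
      (pos v + 1 < #(cls U comp c) ∧ (pos v + 1) % 3 = r)) :
    ∃ x ∈ sel U comp pos c r, x = v ∨ H.Adj v x := by
  obtain ⟨hvU, hvc⟩ := mem_cls.1 hv
  rcases h with h | ⟨h0, h⟩ | ⟨h0, h⟩
  · exact ⟨v, mem_sel.2 ⟨⟨hvU, hvc⟩, h⟩, .inl rfl⟩
  · obtain ⟨w, hwU, hwv, hwc, hwp⟩ := hd.pred v hvU h0
    exact ⟨w, mem_sel.2 ⟨⟨hwU, hwc.trans hvc⟩, by omega⟩, .inr hwv.symm⟩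
  · obtain ⟨w, hw, hvw, hwp⟩ := hd.exists_succ hv h0
    exact ⟨w, mem_sel.2 ⟨mem_cls.1 hw, by omega⟩, .inr hvw⟩

/-- Every third position is taken, so only the ends could fail. A valid shift takes position `0` or
`1`, and the last or the last but one position (for one vertex, the vertex itself). -/
theorem exists_mem_sel_of_valid (hd : Decomp H U comp pos) {r v : ℕ} (hv : v ∈ cls U comp c)
    (h : ValidShift #(cls U comp c) r) : ∃ x ∈ sel U comp pos c r, x = v ∨ H.Adj v x := by
  refine hd.exists_mem_sel hv ?_
  have := hd.pos_lt hv
  unfold ValidShift at h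
  omega

theorem sel_subset_selection {s : ℕ → ℕ} (c : ℕ) :
    sel U comp pos c (s c) ⊆ selection U comp pos s := by
  intro v hv
  obtain ⟨⟨h1, rfl⟩, h2⟩ := mem_sel.1 hv
  exact mem_selection.2 ⟨h1, h2⟩

theorem selection_eq_biUnion (s : ℕ → ℕ) :
    selection U comp pos s = (U.image comp).biUnion fun c => sel U comp pos c (s c) := by
  ext v
  simp only [mem_selection, mem_biUnion, mem_image, mem_sel]
  constructor
  · rintro ⟨h1, h2⟩
    exact ⟨comp v, ⟨v, h1, rfl⟩, ⟨h1, rfl⟩, h2⟩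
  · rintro ⟨c, -, ⟨h1, rfl⟩, h2⟩
    exact ⟨h1, h2⟩

theorem pairwiseDisjoint_sel (s : ℕ → ℕ) (K : Set ℕ) :
    K.PairwiseDisjoint fun c => sel U comp pos c (s c) := by
  intro c _ c' _ hne
  refine disjoint_left.2 fun v hv hv' => hne ?_
  rw [← (mem_sel.1 hv).1.2, (mem_sel.1 hv').1.2]

theorem card_selection (hd : Decomp H U comp pos) {s : ℕ → ℕ}
    (hs : ∀ c ∈ U.image comp, ValidShift #(cls U comp c) (s c)) :
    #(selection U comp pos s) = domSum U comp := by
  rw [selection_eq_biUnion, card_biUnion (pairwiseDisjoint_sel s _)]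
  exact sum_congr rfl fun c hc => hd.card_sel_of_valid (hs c hc)

theorem exists_mem_selection (hd : Decomp H U comp pos) {s : ℕ → ℕ}
    (hs : ∀ c ∈ U.image comp, ValidShift #(cls U comp c) (s c)) {v : ℕ} (hv : v ∈ U) :
    ∃ x ∈ selection U comp pos s, x = v ∨ H.Adj v x := by
  obtain ⟨x, hx, h⟩ := hd.exists_mem_sel_of_valid (mem_cls.2 ⟨hv, rfl⟩)
    (hs _ (mem_image_of_mem _ hv))
  exact ⟨x, sel_subset_selection _ hx, h⟩

end Decomp

open scoped Classical in
/-- The vertices of `E` that dominate a vertex of component `c`. -/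
noncomputable def part (H : SimpleGraph ℕ) (U : Finset ℕ) (comp : ℕ → ℕ) (E : Finset ℕ) (c : ℕ) :
    Finset ℕ :=
  {x ∈ E | ∃ u ∈ cls U comp c, x = u ∨ H.Adj u x}

theorem mem_part {H : SimpleGraph ℕ} {U : Finset ℕ} {comp : ℕ → ℕ} {E : Finset ℕ} {c x : ℕ} :
    x ∈ part H U comp E c ↔ x ∈ E ∧ ∃ u ∈ cls U comp c, x = u ∨ H.Adj u x := by simp [part]

/-! ### Optimality of the residue classes -/

section Parts

variable {n a b : ℕ} {H : SimpleGraph ℕ} {X E : Finset ℕ} {comp pos : ℕ → ℕ} {c : ℕ}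

local notation "𝓤" => targets n H a b X

/-- Ends of components only are adjacent to `a` or `b`. -/
theorem pos_eq_of_adj (hl : LowGraph n H a b) (hd : Decomp H 𝓤 comp pos) {v z : ℕ}
    (hz : z = a ∨ z = b) (hv : v ∈ cls 𝓤 comp c) (hvz : H.Adj v z) :
    pos v = 0 ∨ pos v + 1 = #(cls 𝓤 comp c) := by
  by_contra! hne
  obtain ⟨hvU, hvc⟩ := mem_cls.1 hv
  have hlt := hd.pos_lt hv
  obtain ⟨p, hpU, hpv, -, hpp⟩ := hd.pred v hvU hne.1
  obtain ⟨q, hq, hvq, hqp⟩ := hd.exists_succ hv (by omega)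
  have hqU := (mem_cls.1 hq).1
  have h1 := (hl.mem_targets hvz).1 hvU
  have h2 := (hl.mem_targets hpv).1 hpU
  have h3 := (hl.mem_targets hvq.symm).1 hqU
  -- An inner vertex would be adjacent to its predecessor, its successor and `z`, but targets have
  -- degree at most two.
  refine hl.not_three h1.1 h1.2.1 hvz hpv.symm hvq ?_ ?_ ?_
  · rintro rfl; rcases hz with rfl | rfl <;> tauto
  · rintro rfl; rcases hz with rfl | rfl <;> tauto
  · rintro rfl; omega

/-- In a component with at least two vertices no vertex is adjacent to both `a` and `b`. -/
theorem not_adj_both (hl : LowGraph n H a b) (hd : Decomp H 𝓤 comp pos) {v : ℕ}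
    (hv : v ∈ cls 𝓤 comp c) (h2 : 2 ≤ #(cls 𝓤 comp c)) (ha : H.Adj v a) (hb : H.Adj v b) :
    False := by
  obtain ⟨hvU, hvc⟩ := mem_cls.1 hv
  have hlow := (hl.mem_targets ha).1 hvU
  obtain ⟨w, hwU, hvw⟩ : ∃ w ∈ 𝓤, H.Adj v w := by
    by_cases h0 : pos v = 0
    · obtain ⟨w, hw, hvw, -⟩ := hd.exists_succ hv (by omega)
      exact ⟨w, (mem_cls.1 hw).1, hvw⟩
    · obtain ⟨w, hw, hvw, -⟩ := hd.pred v hvU h0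
      exact ⟨w, hw, hvw.symm⟩
  have hlw := (hl.mem_targets hvw.symm).1 hwU
  exact hl.not_three hlow.1 hlow.2.1 ha hb hvw hl.ne (Ne.symm hlw.1) (Ne.symm hlw.2.1)

/-- A target has target neighbours in its own component only. A vertex outside of `{a, b}` that is
adjacent to a target without being one must have a neighbour in `X`, which leaves room for a single
target neighbour. So no vertex of `E` serves two components. -/
theorem disjoint_part (hl : LowGraph n H a b) (hd : Decomp H 𝓤 comp pos) (hX : X ⊆ {a, b})
    (hE : ∀ x ∈ E, x ≠ a ∧ x ≠ b) (K : Set ℕ) :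
    K.PairwiseDisjoint (part H 𝓤 comp E) := by
  intro c _ c' _ hne
  refine disjoint_left.2 fun x hx hx' => hne ?_
  obtain ⟨hxE, u, hu, hxu⟩ := mem_part.1 hx
  obtain ⟨-, u', hu', hxu'⟩ := mem_part.1 hx'
  obtain ⟨huU, rfl⟩ := mem_cls.1 hu
  obtain ⟨huU', rfl⟩ := mem_cls.1 hu'
  by_cases hxU : x ∈ 𝓤
  · have h1 : comp u = comp x := by
      rcases hxu with rfl | h
      exacts [rfl, hd.closed _ huU _ hxU h]
    have h2 : comp u' = comp x := by
      rcases hxu' with rfl | h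
      exacts [rfl, hd.closed _ huU' _ hxU h]
    rw [h1, h2]
  · have h1 : H.Adj u x := hxu.resolve_left (by rintro rfl; exact hxU huU)
    have h2 : H.Adj u' x := hxu'.resolve_left (by rintro rfl; exact hxU huU')
    rw [hl.mem_targets h1.symm] at hxU
    obtain ⟨hxa, hxb⟩ := hE x hxE
    push Not at hxU
    obtain ⟨z, hz, hxz⟩ := hxU hxa hxb
    have hu1 := (hl.mem_targets h1).1 huU
    have hu2 := (hl.mem_targets h2).1 huU'
    have hzab := hX hz
    by_contra hcc
    refine hl.not_three hxa hxb h1.symm h2.symm hxz (by rintro rfl; exact hcc rfl) ?_ ?_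
    all_goals
      rintro rfl
      simp only [mem_insert, mem_singleton] at hzab
      tauto

/-- A vertex that dominates a vertex of a component and is adjacent to `a` or `b` while this is not
selected belongs to the component. -/
theorem mem_cls_of_part (hl : LowGraph n H a b) (hd : Decomp H 𝓤 comp pos) (hX : X ⊆ {a, b})
    (hE : ∀ x ∈ E, x ≠ a ∧ x ≠ b) {x z : ℕ} (hx : x ∈ part H 𝓤 comp E c)
    (hz : z ∈ ({a, b} : Finset ℕ) \ X) (hxz : H.Adj x z) : x ∈ cls 𝓤 comp c := by
  obtain ⟨hxE, u, hu, hxu⟩ := mem_part.1 hx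
  obtain ⟨huU, rfl⟩ := mem_cls.1 hu
  rcases hxu with rfl | h
  · exact hu
  obtain ⟨hxa, hxb⟩ := hE x hxE
  have hxU : x ∈ 𝓤 := by
    by_contra hxU
    rw [hl.mem_targets h.symm] at hxU
    push Not at hxU
    obtain ⟨z', hz', hxz'⟩ := hxU hxa hxb
    have hu1 := (hl.mem_targets h).1 huU
    have hzab := hX hz'
    simp only [mem_sdiff, mem_insert, mem_singleton] at hz hzab
    refine hl.not_three hxa hxb h.symm hxz hxz' ?_ ?_ ?_
    · rintro rfl; tauto
    · rintro rfl; tauto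
    · rintro rfl; tauto
  exact mem_cls.2 ⟨hxU, (hd.closed _ huU _ hxU h).symm⟩

/-- The vertices that dominate a component: each of them dominates at most three vertices of the
component and unselected vertices among `a` and `b`. -/
theorem card_cls_add_le (hl : LowGraph n H a b)
    (hE : ∀ x ∈ E, x ≠ a ∧ x ≠ b) (hcov : ∀ u ∈ cls 𝓤 comp c, ∃ x ∈ E, x = u ∨ H.Adj u x) :
    #(cls 𝓤 comp c) + ∑ x ∈ part H 𝓤 comp E c, nb H ({a, b} \ X) x
      ≤ 3 * #(part H 𝓤 comp E c) := by
  classical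
  have h1 : #(cls 𝓤 comp c) ≤
      ∑ x ∈ part H 𝓤 comp E c, #{u ∈ cls 𝓤 comp c | x = u ∨ H.Adj u x} := by
    refine le_trans (card_le_card fun u hu => ?_) card_biUnion_le
    obtain ⟨x, hx, hxu⟩ := hcov u hu
    exact mem_biUnion.2 ⟨x, mem_part.2 ⟨hx, u, hu, hxu⟩, mem_filter.2 ⟨hu, hxu⟩⟩
  have h2 : ∀ x ∈ part H 𝓤 comp E c,
      #{u ∈ cls 𝓤 comp c | x = u ∨ H.Adj u x} + nb H ({a, b} \ X) x ≤ 3 := by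
    intro x hx
    obtain ⟨hxE, -⟩ := mem_part.1 hx
    obtain ⟨hxa, hxb⟩ := hE x hxE
    set S := {u ∈ cls 𝓤 comp c | H.Adj u x} with hS
    set T := {z ∈ ({a, b} : Finset ℕ) \ X | H.Adj x z} with hT
    have hdisj : Disjoint S T := by
      refine disjoint_left.2 fun z hzS hzT => ?_
      simp only [hS, hT, mem_filter, mem_sdiff, mem_insert, mem_singleton, mem_cls] at hzS hzT
      have := (hl.mem_targets hzS.2).1 hzS.1.1
      tauto
    have h3 : #S + #T ≤ 2 := by
      rw [← card_union_of_disjoint hdisj]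
      refine hl.card_le_two hxa hxb fun z hz => ?_
      rcases mem_union.1 hz with hz | hz
      exacts [(mem_filter.1 hz).2.symm, (mem_filter.1 hz).2]
    have h4 : #{u ∈ cls 𝓤 comp c | x = u ∨ H.Adj u x} ≤ #S + 1 := by
      refine le_trans (card_le_card (t := insert x S) fun u hu => ?_) (card_insert_le _ _)
      obtain ⟨hu, hux⟩ := mem_filter.1 hu
      rcases hux with rfl | hux
      exacts [mem_insert_self _ _, mem_insert_of_mem (mem_filter.2 ⟨hu, hux⟩)]
    have h5 : nb H ({a, b} \ X) x = #T := by rw [nb, hT]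
    omega
  have h3 := sum_le_sum h2
  rw [sum_add_distrib, sum_const, smul_eq_mul] at h3
  omega

theorem le_card_part (hl : LowGraph n H a b)
    (hE : ∀ x ∈ E, x ≠ a ∧ x ≠ b) (hcov : ∀ u ∈ 𝓤, ∃ x ∈ E, x = u ∨ H.Adj u x) (c : ℕ) :
    (#(cls 𝓤 comp c) + 2) / 3 ≤ #(part H 𝓤 comp E c) := by
  have := card_cls_add_le (comp := comp) (c := c) hl hE fun u hu => hcov u (mem_cls.1 hu).1
  omega

theorem sum_card_part_le (hl : LowGraph n H a b) (hd : Decomp H 𝓤 comp pos) (hX : X ⊆ {a, b})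
    (hE : ∀ x ∈ E, x ≠ a ∧ x ≠ b) : ∑ c ∈ image comp 𝓤, #(part H 𝓤 comp E c) ≤ #E := by
  classical
  rw [← card_biUnion (disjoint_part hl hd hX hE _)]
  exact card_le_card (biUnion_subset.2 fun c _ x hx => (mem_part.1 hx).1)

/-- Each part needs `⌈m/3⌉` vertices, by the count of three targets per vertex, and the parts are
disjoint subsets of `E`. -/
theorem domSum_le (hl : LowGraph n H a b) (hd : Decomp H 𝓤 comp pos) (hX : X ⊆ {a, b})
    (hE : ∀ x ∈ E, x ≠ a ∧ x ≠ b) (hcov : ∀ u ∈ 𝓤, ∃ x ∈ E, x = u ∨ H.Adj u x) :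
    domSum 𝓤 comp ≤ #E :=
  (sum_le_sum fun c _ => le_card_part hl hE hcov c).trans (sum_card_part_le hl hd hX hE)

/-- The selection contains an end that is adjacent to `Z` of every component that has such an end
and in which there is a choice. -/
def Hits (H : SimpleGraph ℕ) (U : Finset ℕ) (comp pos s : ℕ → ℕ) (Z : Finset ℕ) : Prop :=
  ∀ c, #(cls U comp c) % 3 = 2 → (∃ v ∈ cls U comp c, ∃ z ∈ Z, H.Adj v z) →
    ∃ w ∈ sel U comp pos c (s c), ∃ z ∈ Z, H.Adj w z

/-- A tight part has slack `3⌈m/3⌉ - m`, which bounds its edges to unselected vertices among `a` and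
`b`. For `m % 3 = 0` the slack is zero and there are none. For `m % 3 = 1` such edges start at ends
of the component, and the selection contains both ends. For `m % 3 = 2` there is at most one such
edge, and `Hits` provides one in the selection. -/
theorem sum_part_le (hl : LowGraph n H a b) (hd : Decomp H 𝓤 comp pos) (hX : X ⊆ {a, b})
    (hE : ∀ x ∈ E, x ≠ a ∧ x ≠ b) (hcov : ∀ u ∈ 𝓤, ∃ x ∈ E, x = u ∨ H.Adj u x) {s : ℕ → ℕ}
    (hs : ValidShift #(cls 𝓤 comp c) (s c)) {Z : Finset ℕ} (hZ : Z ⊆ {a, b} \ X)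
    (hh : Hits H 𝓤 comp pos s Z)
    (hcard : #(part H 𝓤 comp E c) = (#(cls 𝓤 comp c) + 2) / 3) :
    ∑ x ∈ part H 𝓤 comp E c, nb H Z x ≤ ∑ x ∈ sel 𝓤 comp pos c (s c), nb H Z x := by
  have h1 := card_cls_add_le (comp := comp) (c := c) hl hE fun u hu => hcov u (mem_cls.1 hu).1
  have h2 : ∑ x ∈ part H 𝓤 comp E c, nb H Z x ≤
      ∑ x ∈ part H 𝓤 comp E c, nb H ({a, b} \ X) x := sum_le_sum fun x _ => nb_mono hZ
  have hmem : ∀ x ∈ part H 𝓤 comp E c, nb H Z x ≠ 0 → x ∈ cls 𝓤 comp c := by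
    intro x hx hne
    obtain ⟨z, hz, hxz⟩ := nb_pos.1 (Nat.pos_of_ne_zero hne)
    exact mem_cls_of_part hl hd hX hE hx (hZ hz) hxz
  rcases hs with ⟨hm, hr⟩ | ⟨hm, hr⟩ | ⟨hm, hr⟩
  · omega
  · have h3 : {x ∈ part H 𝓤 comp E c | nb H Z x ≠ 0} ⊆ sel 𝓤 comp pos c (s c) := by
      intro x hx
      obtain ⟨hx, hne⟩ := mem_filter.1 hx
      have hxc := hmem x hx hne
      obtain ⟨z, hz, hxz⟩ := nb_pos.1 (Nat.pos_of_ne_zero hne)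
      have hzab : z = a ∨ z = b := by simpa using (mem_sdiff.1 (hZ hz)).1
      have := pos_eq_of_adj hl hd hzab hxc hxz
      exact mem_sel.2 ⟨mem_cls.1 hxc, by omega⟩
    rw [← sum_filter_ne_zero]
    exact sum_le_sum_of_subset h3
  · by_cases h0 : ∑ x ∈ part H 𝓤 comp E c, nb H Z x = 0
    · omega
    · obtain ⟨x, hx, hne⟩ := exists_ne_zero_of_sum_ne_zero h0
      obtain ⟨z, hz, hxz⟩ := nb_pos.1 (Nat.pos_of_ne_zero hne)
      obtain ⟨w, hw, hz⟩ := hh c hm ⟨x, hmem x hx hne, z, hz, hxz⟩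
      have h3 : 0 < nb H Z w := nb_pos.2 hz
      have h4 : nb H Z w ≤ ∑ x ∈ sel 𝓤 comp pos c (s c), nb H Z x :=
        single_le_sum (f := fun x => nb H Z x) (fun _ _ => Nat.zero_le _) hw
      omega

/-- Equality in the total size forces every part to be tight and `E` to be the union of the parts.
The edges to `Z` can then be compared component by component. -/
theorem sum_le_sum_selection (hl : LowGraph n H a b) (hd : Decomp H 𝓤 comp pos) (hX : X ⊆ {a, b})
    (hE : ∀ x ∈ E, x ≠ a ∧ x ≠ b) (hcov : ∀ u ∈ 𝓤, ∃ x ∈ E, x = u ∨ H.Adj u x) {s : ℕ → ℕ}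
    (hs : ∀ c ∈ image comp 𝓤, ValidShift #(cls 𝓤 comp c) (s c)) {Z : Finset ℕ}
    (hZ : Z ⊆ {a, b} \ X) (hh : Hits H 𝓤 comp pos s Z) (hcard : #E = domSum 𝓤 comp) :
    ∑ z ∈ Z, nb H E z ≤ ∑ z ∈ Z, nb H (selection 𝓤 comp pos s) z := by
  have h1 := sum_card_part_le hl hd hX hE
  have h2 : ∀ c ∈ image comp 𝓤, (#(cls 𝓤 comp c) + 2) / 3 ≤ #(part H 𝓤 comp E c) :=
    fun c _ => le_card_part hl hE hcov c
  have h3 : ∑ c ∈ image comp 𝓤, #(part H 𝓤 comp E c) = domSum 𝓤 comp :=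
    le_antisymm (h1.trans hcard.le) (sum_le_sum h2)
  have h4 := (sum_eq_sum_iff_of_le h2).1 h3.symm
  have h5 : (image comp 𝓤).biUnion (part H 𝓤 comp E) = E := by
    refine eq_of_subset_of_card_le (biUnion_subset.2 fun c _ x hx => (mem_part.1 hx).1) ?_
    rw [card_biUnion (disjoint_part hl hd hX hE _), h3, hcard]
  rw [← sum_nb_comm E Z, ← sum_nb_comm (selection 𝓤 comp pos s) Z]
  conv_lhs => rw [← h5]
  rw [Decomp.selection_eq_biUnion, sum_biUnion (disjoint_part hl hd hX hE _),
    sum_biUnion (Decomp.pairwiseDisjoint_sel s _)]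
  exact sum_le_sum fun c hc => sum_part_le hl hd hX hE hcov (hs c hc) hZ hh (h4 c hc).symm

end Parts

end PDS

/-! ### Candidates for the four choices of `X`, and the exchange argument -/

namespace PDS

variable {n a b : ℕ} {H : SimpleGraph ℕ}

/-- The vertex set `C` consists of `X` and a smallest set that dominates the other vertices, which
is as favourable for `a` and `b` as possible. -/
structure Candidate (n : ℕ) (H : SimpleGraph ℕ) (a b : ℕ) (X C : Finset ℕ) (comp pos s : ℕ → ℕ) :
    Prop where
  decomp : Decomp H (targets n H a b X) comp pos
  valid : ∀ c ∈ image comp (targets n H a b X), ValidShift #(cls (targets n H a b X) comp c) (s c)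
  eq_union : C = X ∪ selection (targets n H a b X) comp pos s
  hits_both : Hits H (targets n H a b X) comp pos s ({a, b} \ X)
  hits_right : b ∉ X → Hits H (targets n H a b X) comp pos s {b} ∨
    (a ∉ X ∧ nb H C a * (n - 1) < nb H (range n) a * #C + (n - 1))
  hits_left : a ∉ X → Hits H (targets n H a b X) comp pos s {a} ∨
    nb H (range n) a * #C ≤ nb H C a * (n - 1)

theorem targets_anti {X Y : Finset ℕ} (h : X ⊆ Y) : targets n H a b Y ⊆ targets n H a b X := by
  intro v hv
  simp only [targets, mem_filter] at hv ⊢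
  exact ⟨hv.1, hv.2.1, hv.2.2.1, hv.2.2.2.1, fun z hz => hv.2.2.2.2 z (h hz)⟩

theorem ne_of_mem_targets {X : Finset ℕ} {v : ℕ} (h : v ∈ targets n H a b X) : v ≠ a ∧ v ≠ b := by
  simp only [targets, mem_filter] at h
  exact ⟨h.2.1, h.2.2.1⟩

theorem targets_subset {X : Finset ℕ} : targets n H a b X ⊆ range n := by
  classical exact filter_subset _ _

/-- A dominating set with at most `(n - 1) / 2` vertices is good if it satisfies `a` and `b`. -/
theorem good_union (hl : LowGraph n H a b) {X E : Finset ℕ} (hX : X ⊆ {a, b}) (hEn : E ⊆ range n)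
    (hcov : ∀ u ∈ targets n H a b X, ∃ x ∈ E, x = u ∨ H.Adj u x)
    (hpos : 1 ≤ #(X ∪ E)) (hcard : 2 * #(X ∪ E) < n)
    (hsat : ∀ z ∈ ({a, b} : Finset ℕ) \ X,
      nb H (range n) z * #(X ∪ E) ≤ nb H (X ∪ E) z * (n - 1)) :
    Good n H (X ∪ E) := by
  refine ⟨union_subset (fun x hx => ?_) hEn, hpos, by omega, fun v hv hvD => ?_⟩
  · have := hX hx
    have ha := hl.a_lt
    have hb := hl.b_lt
    simp only [mem_insert, mem_singleton] at this
    exact mem_range.2 (by omega)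
  · simp only [mem_union, not_or] at hvD
    by_cases hab : v ∈ ({a, b} : Finset ℕ)
    · exact hsat v (mem_sdiff.2 ⟨hab, hvD.1⟩)
    simp only [mem_insert, mem_singleton, not_or] at hab
    have h2 := hl.low v hab.1 hab.2
    by_cases h0 : nb H (range n) v = 0
    · simp [h0]
    have h1 : 1 ≤ nb H (X ∪ E) v := by
      refine nb_pos.2 ?_
      by_contra! hno
      have hvU : v ∈ targets n H a b X := by
        simp only [targets, mem_filter, mem_range]
        exact ⟨hv, hab.1, hab.2, by omega, fun z hz => hno z (mem_union_left _ hz)⟩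
      obtain ⟨x, hx, hxv⟩ := hcov v hvU
      rcases hxv with rfl | hxv
      · exact hvD.2 hx
      · exact hno x (mem_union_right _ hx) hxv
    calc nb H (range n) v * #(X ∪ E) ≤ 2 * #(X ∪ E) := Nat.mul_le_mul_right _ h2
      _ ≤ 1 * (n - 1) := by omega
      _ ≤ _ := Nat.mul_le_mul_right _ h1

theorem disjoint_of_ne {X E : Finset ℕ} (hX : X ⊆ {a, b})
    (hE : ∀ x ∈ E, x ≠ a ∧ x ≠ b) : Disjoint X E := by
  refine disjoint_left.2 fun x hx hxE => ?_
  have := hX hx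
  have := hE x hxE
  simp only [mem_insert, mem_singleton] at *
  tauto

/-- The part of a good set outside of `{a, b}` dominates the targets. -/
theorem Good.cover {D : Finset ℕ} (hg : Good n H D) :
    ∀ u ∈ targets n H a b (D ∩ {a, b}), ∃ x ∈ D \ {a, b}, x = u ∨ H.Adj u x := by
  intro u hu
  simp only [targets, mem_filter, mem_range] at hu
  obtain ⟨hun, hua, hub, hdeg, hX⟩ := hu
  by_cases huD : u ∈ D
  · exact ⟨u, by simp [huD, hua, hub], .inl rfl⟩
  have h1 := hg.sat u hun huD
  have h2 : 1 * 1 ≤ nb H (range n) u * #D := Nat.mul_le_mul hdeg hg.pos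
  have h3 : nb H D u ≠ 0 := by intro h0; rw [h0] at h1; omega
  obtain ⟨x, hx, hux⟩ := nb_pos.1 (Nat.pos_of_ne_zero h3)
  refine ⟨x, mem_sdiff.2 ⟨hx, fun hxab => hX x (mem_inter.2 ⟨hx, hxab⟩) hux⟩, .inr hux⟩

namespace Candidate

variable {X C : Finset ℕ} {comp pos s : ℕ → ℕ}

theorem ne_of_mem {v : ℕ} (hv : v ∈ selection (targets n H a b X) comp pos s) : v ≠ a ∧ v ≠ b :=
  ne_of_mem_targets (mem_selection.1 hv).1

theorem card_eq (hc : Candidate n H a b X C comp pos s) (hX : X ⊆ {a, b}) :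
    #C = #X + domSum (targets n H a b X) comp := by
  rw [hc.eq_union, card_union_of_disjoint (disjoint_of_ne hX fun x hx => ne_of_mem hx),
    hc.decomp.card_selection hc.valid]

/-- A candidate is good if there is a good set of the same size with the same vertices among
`a` and `b`. -/
theorem good (hl : LowGraph n H a b) (hc : Candidate n H a b X C comp pos s) {D : Finset ℕ}
    (hD : Good n H D) (hX : D ∩ {a, b} = X) (hsmall : 2 * #D < n)
    (hcard : #(D \ {a, b}) = domSum (targets n H a b X) comp) : Good n H C ∧ #C = #D := by
  have hXab : X ⊆ {a, b} := hX ▸ inter_subset_right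
  have hE : ∀ x ∈ D \ {a, b}, x ≠ a ∧ x ≠ b := by
    intro x hx
    simpa using (mem_sdiff.1 hx).2
  have hDX : D = X ∪ D \ {a, b} := by rw [← hX, union_comm, sdiff_union_inter]
  have hdisj := disjoint_of_ne hXab hE
  have hCD : #C = #D := by
    rw [hc.card_eq hXab, ← hcard]
    conv_rhs => rw [hDX, card_union_of_disjoint hdisj]
  have hcov := hD.cover (a := a) (b := b)
  rw [hX] at hcov
  have hdisj' : Disjoint X (selection (targets n H a b X) comp pos s) :=
    disjoint_of_ne hXab fun x hx => ne_of_mem hx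
  have hsum : ∀ Z ⊆ ({a, b} : Finset ℕ) \ X, Hits H (targets n H a b X) comp pos s Z →
      ∑ z ∈ Z, nb H D z ≤ ∑ z ∈ Z, nb H C z := by
    intro Z hZ hh
    have := sum_le_sum_selection hl hc.decomp hXab hE hcov hc.valid hZ hh hcard
    rw [hc.eq_union, hDX]
    simp only [nb_union hdisj, nb_union hdisj', sum_add_distrib]
    omega
  have hsatD : ∀ z ∈ ({a, b} : Finset ℕ) \ X,
      nb H (range n) z * #D ≤ nb H D z * (n - 1) := by
    intro z hz
    obtain ⟨hzab, hzX⟩ := mem_sdiff.1 hz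
    refine hD.sat z ?_ fun hzD => hzX (hX ▸ mem_inter.2 ⟨hzD, hzab⟩)
    simp only [mem_insert, mem_singleton] at hzab
    have ha := hl.a_lt
    have hb := hl.b_lt
    omega
  have hle : ∀ z ∈ ({a, b} : Finset ℕ) \ X, nb H D z ≤ nb H C z →
      nb H (range n) z * #C ≤ nb H C z * (n - 1) := fun z hz h => by
    rw [hCD]
    exact (hsatD z hz).trans (Nat.mul_le_mul_right _ h)
  refine ⟨?_, hCD⟩
  have hCn : 1 ≤ #C := by rw [hCD]; exact hD.pos
  rw [hc.eq_union] at hCn hCD ⊢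
  refine good_union hl hXab ((filter_subset _ _).trans targets_subset) ?_ hCn (by omega) ?_
  · intro u hu
    exact hc.decomp.exists_mem_selection hc.valid hu
  rw [← hc.eq_union]
  intro z hz
  have hz' := hz
  obtain ⟨hzab, hzX⟩ := mem_sdiff.1 hz'
  simp only [mem_insert, mem_singleton] at hzab
  rcases hzab with rfl | rfl
  · rcases hc.hits_left hzX with h | h
    · exact hle _ hz (by simpa using hsum {z} (by simpa using hz) h)
    · exact h
  · rcases hc.hits_right hzX with h | ⟨haX, h⟩
    · exact hle _ hz (by simpa using hsum {z} (by simpa using hz) h)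
    -- Here `z` stands for `b`, and choices have been moved to `a`. With one neighbour less, `a`
    -- would be unsatisfied, so `D`, which satisfies `a`, has at least as many neighbours of `a` as
    -- `C`. Since `C` is at least as good as `D` for the sum over `a` and `b`, it is at least as
    -- good for `b`.
    · have ha : a ∈ ({a, z} : Finset ℕ) \ X := by simp [haX]
      have h1 := hsatD a ha
      rw [hc.eq_union, hCD, ← hc.eq_union] at h
      have h2 : nb H C a * (n - 1) < (nb H D a + 1) * (n - 1) := by
        rw [add_mul]; omega
      have h3 := Nat.lt_of_mul_lt_mul_right h2
      have h4 := hsum _ Subset.rfl hc.hits_both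
      have h5 : ({a, z} : Finset ℕ) \ X = {a, z} := by
        refine sdiff_eq_self_of_disjoint (disjoint_left.2 fun x hx hxX => ?_)
        simp only [mem_insert, mem_singleton] at hx
        rcases hx with rfl | rfl
        exacts [haX hxX, hzX hxX]
      rw [h5, sum_pair hl.ne, sum_pair hl.ne] at h4
      exact hle _ hz (by omega)

end Candidate

/-- A component with one vertex more than necessary can be dominated with one vertex less by a set
with all neighbours of one of the vertices `a` and `b`, if the other one is selected. -/
theorem exists_replacement (hl : LowGraph n H a b) {comp pos s : ℕ → ℕ}
    (hd : Decomp H (targets n H a b ∅) comp pos) {c : ℕ}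
    (hs : ValidShift #(cls (targets n H a b ∅) comp c) (s c)) :
    ∃ z y, ((z = a ∧ y = b) ∨ (z = b ∧ y = a)) ∧ ∃ R ⊆ cls (targets n H a b ∅) comp c,
      #R ≤ (#(cls (targets n H a b ∅) comp c) + 2) / 3 ∧
      (∀ u ∈ cls (targets n H a b ∅) comp c, u ∈ targets n H a b {z} →
        ∃ x ∈ R, x = u ∨ H.Adj u x) ∧
      ∀ v ∈ cls (targets n H a b ∅) comp c, H.Adj v y → v ∈ R := by
  set U := targets n H a b ∅ with hU
  have hvalid : sel U comp pos c (s c) ⊆ cls U comp c ∧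
      #(sel U comp pos c (s c)) ≤ (#(cls U comp c) + 2) / 3 ∧
      ∀ z, ∀ u ∈ cls U comp c, u ∈ targets n H a b {z} →
        ∃ x ∈ sel U comp pos c (s c), x = u ∨ H.Adj u x :=
    ⟨filter_subset _ _, (hd.card_sel_of_valid hs).le,
      fun _ u hu _ => hd.exists_mem_sel_of_valid hu hs⟩
  -- If `a` or `b` has no neighbour in the component, the other one is selected: the last condition
  -- is vacuous and the given valid shift works.
  by_cases hA : ∃ v ∈ cls U comp c, H.Adj v a
  swap
  · push Not at hA
    exact ⟨b, a, .inr ⟨rfl, rfl⟩, _, hvalid.1, hvalid.2.1, hvalid.2.2 b,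
      fun v hv h => absurd h (hA v hv)⟩
  by_cases hB : ∃ v ∈ cls U comp c, H.Adj v b
  swap
  · push Not at hB
    exact ⟨a, b, .inl ⟨rfl, rfl⟩, _, hvalid.1, hvalid.2.1, hvalid.2.2 a,
      fun v hv h => absurd h (hB v hv)⟩
  obtain ⟨v, hv, hva⟩ := hA
  obtain ⟨w, hw, hwb⟩ := hB
  refine ⟨a, b, .inl ⟨rfl, rfl⟩, ?_⟩
  set m := #(cls U comp c) with hm
  have hvp : pos v = 0 ∨ pos v + 1 = m := pos_eq_of_adj hl hd (.inl rfl) hv hva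
  have hwp : pos w = 0 ∨ pos w + 1 = m := pos_eq_of_adj hl hd (.inr rfl) hw hwb
  have hinj := hd.injOn c
  -- Both ends have positions divisible by three, so the given selection already contains all
  -- neighbours of `b`.
  by_cases hm1 : m % 3 = 1
  · have hs0 : s c = 0 := by unfold ValidShift at hs; omega
    refine ⟨_, hvalid.1, hvalid.2.1, hvalid.2.2 a, fun x hx hxb => mem_sel.2 ⟨mem_cls.1 hx, ?_⟩⟩
    have : pos x = 0 ∨ pos x + 1 = m := pos_eq_of_adj hl hd (.inr rfl) hx hxb
    omega
  have hm2 : 2 ≤ m := by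
    have := hd.pos_lt hv
    omega
  have hends : ∀ x ∈ cls U comp c, H.Adj x b → x = w := by
    intro x hx hxb
    have hxp : pos x = 0 ∨ pos x + 1 = m := pos_eq_of_adj hl hd (.inr rfl) hx hxb
    have h1 : pos x ≠ pos v := fun h => by
      obtain rfl := hinj hx hv h
      exact not_adj_both hl hd hx hm2 hva hxb
    have h2 : pos w ≠ pos v := fun h => by
      obtain rfl := hinj hw hv h
      exact not_adj_both hl hd hw hm2 hva hwb
    exact hinj hx hw (by omega)
  have hvw : pos v ≠ pos w := fun h => by
    obtain rfl := hinj hv hw h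
    exact not_adj_both hl hd hv hm2 hva hwb
  have hnot : ∀ u ∈ cls U comp c, u ∈ targets n H a b {a} → pos u ≠ pos v := by
    intro u hu hua h
    obtain rfl := hinj hu hv h
    exact ((hl.mem_targets hva).1 hua).2.2 a (by simp) hva
  -- Counting in threes from the end `w`, the only neighbour of `b`, leaves at most the opposite end
  -- undominated. That end is `v`, which is dominated by the selected vertex `a`.
  refine ⟨sel U comp pos c (pos w % 3), filter_subset _ _, ?_, fun u hu hua => ?_,
    fun x hx hxb => ?_⟩
  · rw [hd.card_sel]
    change #{k ∈ range m | _} ≤ _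
    obtain ⟨h0, h1, h2⟩ := card_mod_three m
    have : pos w % 3 = 0 ∨ pos w % 3 = 1 ∨ pos w % 3 = 2 := by omega
    rcases this with h | h | h <;> rw [h] <;> omega
  · have h1 := hnot u hu hua
    have h2 : pos u < m := hd.pos_lt hu
    refine hd.exists_mem_sel hu ?_
    rw [← hm]
    omega
  · rw [hends x hx hxb]
    exact mem_sel.2 ⟨mem_cls.1 hw, rfl⟩

/-- A good set without `a` and `b` that is larger than necessary by one vertex can be replaced by
a good set of at most the same size that contains `a` or `b`. -/
theorem exists_good_exchange (hl : LowGraph n H a b) {comp pos s : ℕ → ℕ} {D : Finset ℕ}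
    (hd : Decomp H (targets n H a b ∅) comp pos)
    (hs : ∀ c ∈ image comp (targets n H a b ∅), ValidShift #(cls (targets n H a b ∅) comp c) (s c))
    (hD : Good n H D) (hX : D ∩ {a, b} = ∅) (hsmall : 2 * #D < n)
    (hcard : #D = domSum (targets n H a b ∅) comp + 1) :
    ∃ D', Good n H D' ∧ #D' ≤ #D ∧ (D' ∩ {a, b}).Nonempty := by
  set U := targets n H a b ∅ with hU
  have hE : ∀ x ∈ D, x ≠ a ∧ x ≠ b := by
    intro x hx
    have : x ∉ ({a, b} : Finset ℕ) := fun h => by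
      have : x ∈ D ∩ {a, b} := mem_inter.2 ⟨hx, h⟩
      rw [hX] at this; simp at this
    simpa using this
  have hDab : D \ {a, b} = D := by
    refine sdiff_eq_self_of_disjoint (disjoint_iff_inter_eq_empty.2 hX)
  have hcov := hD.cover (a := a) (b := b)
  rw [hX, hDab] at hcov
  have hdisj := disjoint_part hl hd (by simp) hE (image comp U)
  have hple := fun c => le_card_part (comp := comp) hl hE hcov c
  have hpart : ∀ x ∈ D, ∀ z, z = a ∨ z = b → H.Adj x z → x ∈ U := by
    intro x hx z hz hxz
    exact (hl.mem_targets hxz).2 ⟨(hE x hx).1, (hE x hx).2, by simp⟩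
  -- Adding `z` to `E` uses up the surplus vertex. The remaining vertex `y` stays satisfied, since
  -- the set is no larger than `D` and no neighbour of `y` is lost.
  suffices ∃ z y, ((z = a ∧ y = b) ∨ (z = b ∧ y = a)) ∧ ∃ E, (∀ x ∈ E, x ≠ a ∧ x ≠ b) ∧
      E ⊆ range n ∧ #E ≤ domSum U comp ∧
      (∀ u ∈ targets n H a b {z}, ∃ x ∈ E, x = u ∨ H.Adj u x) ∧ nb H D y ≤ nb H E y by
    obtain ⟨z, y, hzy, E, hE', hEn, hEcard, hEcov, hEnb⟩ := this
    have hz : ({z} : Finset ℕ) ⊆ {a, b} := by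
      rcases hzy with ⟨rfl, rfl⟩ | ⟨rfl, rfl⟩ <;> simp
    have hc : #({z} ∪ E) ≤ #D := (card_union_le _ _).trans (by simp; omega)
    refine ⟨{z} ∪ E, good_union hl hz hEn hEcov (card_pos.2 ⟨z, by simp⟩) (by omega) ?_, hc,
      z, mem_inter.2 ⟨by simp, hz (by simp)⟩⟩
    intro x hx
    obtain rfl : x = y := by
      simp only [mem_sdiff, mem_insert, mem_singleton] at hx
      rcases hzy with ⟨rfl, rfl⟩ | ⟨rfl, rfl⟩ <;> tauto
    have hxn : x < n := by
      have ha := hl.a_lt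
      have hb := hl.b_lt
      omega
    have hxD : x ∉ D := fun h => by
      have := hE x h
      omega
    calc nb H (range n) x * #({z} ∪ E) ≤ nb H (range n) x * #D := Nat.mul_le_mul_left _ hc
      _ ≤ nb H D x * (n - 1) := hD.sat x hxn hxD
      _ ≤ _ := Nat.mul_le_mul_right _ (hEnb.trans (nb_mono subset_union_right))
  -- Either the surplus sits in some part, which is then replaced, or it lies outside of all parts.
  by_cases hbig : ∃ c ∈ image comp U, (#(cls U comp c) + 2) / 3 < #(part H U comp D c)
  · obtain ⟨c, hc, hlt⟩ := hbig
    obtain ⟨z, y, hzy, R, hR, hRcard, hRcov, hRnb⟩ := exists_replacement hl hd (hs c hc)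
    refine ⟨z, y, hzy, (D \ part H U comp D c) ∪ R, ?_, ?_, ?_, ?_, ?_⟩
    · intro x hx
      rcases mem_union.1 hx with hx | hx
      · exact hE x (mem_sdiff.1 hx).1
      · exact ne_of_mem_targets (mem_cls.1 (hR hx)).1
    · refine union_subset (sdiff_subset.trans hD.sub) fun x hx => ?_
      exact targets_subset (mem_cls.1 (hR hx)).1
    · have h1 : #(D \ part H U comp D c) = #D - #(part H U comp D c) :=
        card_sdiff_of_subset fun x hx => (mem_part.1 hx).1
      have h2 : #R ≤ (#(cls U comp c) + 2) / 3 := hRcard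
      have h3 : #(part H U comp D c) ≤ #D := card_le_card fun x hx => (mem_part.1 hx).1
      refine (card_union_le _ _).trans ?_
      omega
    · intro u hu
      have huU : u ∈ U := targets_anti (by simp) hu
      by_cases huc : comp u = c
      · obtain ⟨x, hx, hxu⟩ := hRcov u (mem_cls.2 ⟨huU, huc⟩) hu
        exact ⟨x, mem_union_right _ hx, hxu⟩
      · obtain ⟨x, hx, hxu⟩ := hcov u huU
        refine ⟨x, mem_union_left _ (mem_sdiff.2 ⟨hx, fun hxc => ?_⟩), hxu⟩
        have hxu' : x ∈ part H U comp D (comp u) :=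
          mem_part.2 ⟨hx, u, mem_cls.2 ⟨huU, rfl⟩, hxu⟩
        exact disjoint_left.1 (hdisj (mem_coe.2 (mem_image_of_mem comp huU)) (mem_coe.2 hc) huc)
          hxu' hxc
    · classical
      refine card_le_card fun x hx => ?_
      obtain ⟨hxD, hyx⟩ := mem_filter.1 hx
      have hxU : x ∈ U := hpart x hxD y (by tauto) hyx.symm
      refine mem_filter.2 ⟨?_, hyx⟩
      by_cases hxc : comp x = c
      · exact mem_union_right _ (hRnb x (mem_cls.2 ⟨hxU, hxc⟩) hyx.symm)
      · refine mem_union_left _ (mem_sdiff.2 ⟨hxD, fun hxp => ?_⟩)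
        have hxu' : x ∈ part H U comp D (comp x) :=
          mem_part.2 ⟨hxD, x, mem_cls.2 ⟨hxU, rfl⟩, .inl rfl⟩
        exact disjoint_left.1 (hdisj (mem_coe.2 (mem_image_of_mem comp hxU)) (mem_coe.2 hc) hxc)
          hxu' hxp
  -- The parts alone have at most `domSum` vertices and cover everything. Every vertex of `D`
  -- adjacent to `b` is a target and thus lies in the part of its own component, so discarding the
  -- rest costs `b` nothing.
  · push Not at hbig
    refine ⟨a, b, .inl ⟨rfl, rfl⟩, (image comp U).biUnion (part H U comp D), ?_, ?_, ?_, ?_, ?_⟩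
    · intro x hx
      obtain ⟨c, -, hx⟩ := mem_biUnion.1 hx
      exact hE x (mem_part.1 hx).1
    · intro x hx
      obtain ⟨c, -, hx⟩ := mem_biUnion.1 hx
      exact hD.sub (mem_part.1 hx).1
    · exact card_biUnion_le.trans (sum_le_sum fun c hc => hbig c hc)
    · intro u hu
      have huU : u ∈ U := targets_anti (by simp) hu
      obtain ⟨x, hx, hxu⟩ := hcov u huU
      exact ⟨x, mem_biUnion.2 ⟨comp u, mem_image_of_mem _ huU,
        mem_part.2 ⟨hx, u, mem_cls.2 ⟨huU, rfl⟩, hxu⟩⟩, hxu⟩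
    · classical
      refine card_le_card fun x hx => ?_
      obtain ⟨hxD, hyx⟩ := mem_filter.1 hx
      have hxU : x ∈ U := hpart x hxD b (.inr rfl) hyx.symm
      exact mem_filter.2 ⟨mem_biUnion.2 ⟨comp x, mem_image_of_mem _ hxU,
        mem_part.2 ⟨hxD, x, mem_cls.2 ⟨hxU, rfl⟩, .inl rfl⟩⟩, hyx⟩

/-- `C` is a candidate, for some order of the components. -/
def IsCandidate (n : ℕ) (H : SimpleGraph ℕ) (a b : ℕ) (X C : Finset ℕ) : Prop :=
  ∃ comp pos s, Candidate n H a b X C comp pos s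

/-- If there is a good set with at most `(n - 1) / 2` vertices, then one of the four candidates is
a good set of at most the same size. -/
theorem exists_good_candidate (hl : LowGraph n H a b) {C : Finset ℕ → Finset ℕ}
    (hC : ∀ X ⊆ {a, b}, IsCandidate n H a b X (C X)) {D : Finset ℕ} (hD : Good n H D)
    (hsmall : 2 * #D < n) : ∃ X ⊆ {a, b}, Good n H (C X) ∧ #(C X) ≤ #D := by
  -- With two vertices to spare, both `a` and `b` can be selected. Then only domination matters, and
  -- the targets become fewer.
  have hab : ∀ D', Good n H D' → 2 * #D' < n → ∀ comp pos s,
      Candidate n H a b (D' ∩ {a, b}) (C (D' ∩ {a, b})) comp pos s →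
      2 + domSum (targets n H a b (D' ∩ {a, b})) comp ≤ #D' →
      ∃ X ⊆ {a, b}, Good n H (C X) ∧ #(C X) ≤ #D' := by
    intro D' hD' hsm comp pos s hcand hle
    obtain ⟨comp', pos', s', hc'⟩ := hC {a, b} Subset.rfl
    have hcov : ∀ u ∈ targets n H a b {a, b}, ∃ x ∈ selection (targets n H a b (D' ∩ {a, b}))
        comp pos s, x = u ∨ H.Adj u x := fun u hu =>
      hcand.decomp.exists_mem_selection hcand.valid (targets_anti inter_subset_right hu)
    have h1 := domSum_le hl hc'.decomp Subset.rfl (fun x hx => Candidate.ne_of_mem hx) hcov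
    rw [hcand.decomp.card_selection hcand.valid] at h1
    have h2 := hc'.card_eq Subset.rfl
    rw [card_pair hl.ne] at h2
    refine ⟨{a, b}, Subset.rfl, ?_, by omega⟩
    have h3 : 1 ≤ #(C {a, b}) := by omega
    have h4 : 2 * #(C {a, b}) < n := by omega
    rw [hc'.eq_union] at h3 h4 ⊢
    refine good_union hl Subset.rfl ((filter_subset _ _).trans targets_subset)
      (fun u hu => hc'.decomp.exists_mem_selection hc'.valid hu) h3 h4 (by simp)
  -- If `X` is nonempty and the rest is not cheapest, then one selected vertex and one surplus
  -- vertex already pay for both `a` and `b`.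
  have hne : ∀ D', Good n H D' → 2 * #D' < n → (D' ∩ {a, b}).Nonempty →
      ∃ X ⊆ {a, b}, Good n H (C X) ∧ #(C X) ≤ #D' := by
    intro D' hD' hsm hX
    obtain ⟨comp, pos, s, hc⟩ := hC (D' ∩ {a, b}) inter_subset_right
    have hdom := domSum_le hl hc.decomp inter_subset_right (E := D' \ {a, b})
      (fun x hx => by simpa using (mem_sdiff.1 hx).2) hD'.cover
    have hsplit : #(D' \ {a, b}) + #(D' ∩ {a, b}) = #D' := card_sdiff_add_card_inter _ _
    have hXpos := card_pos.2 hX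
    by_cases heq : #(D' \ {a, b}) = domSum (targets n H a b (D' ∩ {a, b})) comp
    · obtain ⟨h1, h2⟩ := hc.good hl hD' rfl hsm heq
      exact ⟨_, inter_subset_right, h1, h2.le⟩
    · exact hab D' hD' hsm comp pos s hc (by omega)
  by_cases hX : (D ∩ {a, b}).Nonempty
  · exact hne D hD hsmall hX
  rw [not_nonempty_iff_eq_empty] at hX
  have hDab : D \ {a, b} = D := sdiff_eq_self_of_disjoint (disjoint_iff_inter_eq_empty.2 hX)
  obtain ⟨comp, pos, s, hc⟩ := hC ∅ (by simp)
  have hcov := hD.cover (a := a) (b := b)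
  have hdom := domSum_le hl (X := ∅) hc.decomp (by simp) (E := D \ {a, b})
      (fun x hx => by simpa using (mem_sdiff.1 hx).2) (by rwa [hX] at hcov)
  rw [hDab] at hdom
  by_cases heq : #D = domSum (targets n H a b ∅) comp
  · obtain ⟨h1, h2⟩ := hc.good hl hD hX hsmall (by rwa [hDab])
    exact ⟨∅, by simp, h1, h2.le⟩
  -- Neither `a` nor `b` is selected and one surplus vertex is not enough to select both: the case
  -- for the exchange.
  by_cases heq' : #D = domSum (targets n H a b ∅) comp + 1
  · obtain ⟨D', h1, h2, h3⟩ := exists_good_exchange hl hc.decomp hc.valid hD hX hsmall heq'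
    obtain ⟨X, hX, hg, hle⟩ := hne D' h1 (by omega) h3
    exact ⟨X, hX, hg, hle.trans h2⟩
  · exact hab D hD hsmall comp pos s (by rwa [hX]) (by rw [hX]; omega)

end PDS

namespace PDS

/-! ### Listing the components by walks -/

/-- The vertices in `W` have been visited by walks that run through the components of the graph
induced by `U`; the current walk is at `cur`. -/
structure Walk (H : SimpleGraph ℕ) (U W : Finset ℕ) (comp pos last : ℕ → ℕ) (cur : ℕ) : Prop where
  sub : W ⊆ U
  comp_mem : ∀ v ∈ W, comp v ∈ W
  comp_comp : ∀ v ∈ W, comp (comp v) = comp v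
  pos_comp : ∀ v ∈ W, pos (comp v) = 0
  inj : ∀ v ∈ W, ∀ w ∈ W, comp v = comp w → pos v = pos w → v = w
  pred : ∀ v ∈ W, pos v ≠ 0 → ∃ w ∈ W, H.Adj w v ∧ comp w = comp v ∧ pos w + 1 = pos v
  last_mem : ∀ v ∈ W, last (comp v) ∈ W
  comp_last : ∀ v ∈ W, comp (last (comp v)) = comp v
  pos_le_last : ∀ v ∈ W, pos v ≤ pos (last (comp v))
  closed : ∀ v ∈ W, ∀ w ∈ U, H.Adj v w → comp v ≠ comp cur → w ∈ W ∧ comp w = comp v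
  cur_mem : cur ∈ W ∨ W = ∅
  last_cur : cur ∈ W → last (comp cur) = cur
  start : cur ∈ W → nb H U (comp cur) ≤ 1 ∨
    ∀ w ∈ U, (w ∉ W ∨ comp w = comp cur) → 2 ≤ nb H U w

namespace Walk

variable {H : SimpleGraph ℕ} {U W : Finset ℕ} {comp pos last : ℕ → ℕ} {cur : ℕ}

theorem empty (comp pos last : ℕ → ℕ) (cur : ℕ) :
    Walk H U ∅ comp pos last cur := by
  constructor <;> simp

theorem mem_of_nb_le_one {v p w : ℕ} (h : nb H U v ≤ 1) (hp : p ∈ U) (hvp : H.Adj v p)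
    (hw : w ∈ U) (hvw : H.Adj v w) : w = p := by
  classical
  by_contra hne
  have : #({w, p} : Finset ℕ) ≤ nb H U v := by
    refine card_le_card fun x hx => ?_
    simp only [mem_insert, mem_singleton] at hx
    rcases hx with rfl | rfl <;> simp [*]
  rw [card_pair hne] at this
  omega

theorem mem_of_nb_le_two {v p q w : ℕ} (h : nb H U v ≤ 2) (hp : p ∈ U) (hvp : H.Adj v p)
    (hq : q ∈ U) (hvq : H.Adj v q) (hpq : p ≠ q) (hw : w ∈ U) (hvw : H.Adj v w) :
    w = p ∨ w = q := by
  classical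
  by_contra! hne
  have : #({w, p, q} : Finset ℕ) ≤ nb H U v := by
    refine card_le_card fun x hx => ?_
    simp only [mem_insert, mem_singleton] at hx
    rcases hx with rfl | rfl | rfl <;> simp [*]
  rw [card_eq_three.2 ⟨w, p, q, hne.1, hne.2, hpq, rfl⟩] at this
  omega

theorem exists_pos (h : Walk H U W comp pos last cur) {v : ℕ} (hv : v ∈ W) :
    ∀ j k, k + j = pos v → ∃ q ∈ W, comp q = comp v ∧ pos q = k
  | 0, k, hk => ⟨v, hv, rfl, by omega⟩
  | j + 1, k, hk => by
    obtain ⟨q, hq, hqc, hqp⟩ := h.exists_pos hv j (k + 1) (by omega)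
    obtain ⟨p, hp, -, hpc, hpp⟩ := h.pred q hq (by omega)
    exact ⟨p, hp, hpc.trans hqc, by omega⟩

theorem pos_le_cur (h : Walk H U W comp pos last cur) (hcur : cur ∈ W) {v : ℕ} (hv : v ∈ W)
    (hvc : comp v = comp cur) : pos v ≤ pos cur := by
  have := h.pos_le_last v hv
  rwa [hvc, h.last_cur hcur] at this

theorem exists_succ (h : Walk H U W comp pos last cur) (hcur : cur ∈ W) {v : ℕ} (hv : v ∈ W)
    (hvc : comp v = comp cur) (hne : v ≠ cur) :
    ∃ q ∈ W, H.Adj v q ∧ comp q = comp v ∧ pos q = pos v + 1 := by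
  have hle := h.pos_le_cur hcur hv hvc
  have hlt : pos v ≠ pos cur := fun he => hne (h.inj v hv cur hcur hvc he)
  obtain ⟨q, hq, hqc, hqp⟩ := h.exists_pos hcur (pos cur - (pos v + 1)) (pos v + 1) (by omega)
  obtain ⟨p, hp, hpq, hpc, hpp⟩ := h.pred q hq (by omega)
  obtain rfl : p = v := h.inj p hp v hv (by rw [hpc, hqc, hvc]) (by omega)
  exact ⟨q, hq, hpq, hpc.symm, hqp⟩

/-- If the current walk cannot be continued, then its component is complete. -/
theorem closed_of_stuck (h : Walk H U W comp pos last cur) (hU : ∀ v ∈ U, nb H U v ≤ 2)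
    (hstuck : cur ∈ W → ∀ x ∈ U, x ∉ W → ¬H.Adj cur x) :
    ∀ v ∈ W, ∀ w ∈ U, H.Adj v w → w ∈ W ∧ comp w = comp v := by
  intro v hv w hw hvw
  by_cases hvc : comp v ≠ comp cur
  · exact h.closed v hv w hw hvw hvc
  push Not at hvc
  have hcur : cur ∈ W := h.cur_mem.resolve_right (by rintro rfl; simp at hv)
  have hin : ∀ v ∈ W, comp v = comp cur → ∀ w ∈ W, H.Adj v w → comp w = comp v := by
    intro v hv hvc w hw hvw
    by_contra hne
    exact hne (h.closed w hw v (h.sub hv) hvw.symm (hvc ▸ hne)).2.symm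
  have hcurW : ∀ x ∈ U, H.Adj cur x → x ∈ W := fun x hx hcx => by
    by_contra hxW
    exact hstuck hcur x hx hxW hcx
  suffices w ∈ W from ⟨this, hin v hv hvc w this hvw⟩
  by_cases hvcur : v = cur
  · subst hvcur; exact hcurW w hw hvw
  obtain ⟨q, hq, hvq, hqc, hqp⟩ := h.exists_succ hcur hv hvc hvcur
  have hqU := h.sub hq
  have h2 := hU v (h.sub hv)
  -- Predecessor and successor exhaust the two neighbours of an inner vertex.
  by_cases hp0 : pos v ≠ 0
  · obtain ⟨p, hp, hpv, hpc, hpp⟩ := h.pred v hv hp0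
    rcases mem_of_nb_le_two h2 (h.sub hp) hpv.symm hqU hvq (by rintro rfl; omega) hw hvw with
      rfl | rfl
    exacts [hp, hq]
  push Not at hp0
  have hvhead : v = comp cur := by
    rw [← hvc]
    exact h.inj v hv _ (h.comp_mem v hv) (h.comp_comp v hv).symm (by rw [h.pos_comp v hv, hp0])
  -- Now `v` is the head of the walk. Either it has a single neighbour, its successor, or the walk
  -- was started when only vertices of degree two were left, and it has to close up to a cycle.
  rcases h.start hcur with h1 | hall
  · rw [← hvhead] at h1
    rwa [mem_of_nb_le_one h1 hqU hvq hw hvw]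
  have hcurpos : pos cur ≠ 0 := fun h0 => hvcur (h.inj v hv cur hcur hvc (by omega))
  obtain ⟨p, hp, hpcur, hpc, hpp⟩ := h.pred cur hcur hcurpos
  -- The end `cur` has a second neighbour `z`, already visited since the walk is stuck. If `z` were
  -- not the head, its predecessor and successor would be all its neighbours, and `cur` is neither
  -- of them. So `z` is the head, whose two neighbours are `cur` and `q`.
  obtain ⟨z, hz, hcz, hzp⟩ : ∃ z ∈ U, H.Adj cur z ∧ z ≠ p := by
    classical
    have : 1 < nb H U cur := hall cur (h.sub hcur) (.inr rfl)
    obtain ⟨z, hz, hzp⟩ := exists_mem_ne this p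
    exact ⟨z, (mem_filter.1 hz).1, (mem_filter.1 hz).2, hzp⟩
  have hzW := hcurW z hz hcz
  have hzc := hin cur hcur rfl z hzW hcz
  have hzcur : z ≠ cur := fun he => H.irrefl (he ▸ hcz)
  by_cases hz0 : pos z = 0
  · obtain rfl : z = v := h.inj z hzW v hv (by rw [hzc, hvc]) (by omega)
    have hqcur : q ≠ cur := by
      rintro rfl
      exact hzp (h.inj z hzW p hp (by rw [hpc, hvc]) (by omega))
    rcases mem_of_nb_le_two h2 (h.sub hcur) hcz.symm hqU hvq hqcur.symm hw hvw with rfl | rfl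
    exacts [hcur, hq]
  · exfalso
    obtain ⟨x, hx, hxz, hxc, hxp⟩ := h.pred z hzW hz0
    obtain ⟨y, hy, hzy, hyc, hyp⟩ := h.exists_succ hcur hzW hzc hzcur
    have hle := h.pos_le_cur hcur hzW hzc
    rcases mem_of_nb_le_two (hU z hz) (h.sub hx) hxz.symm (h.sub hy) hzy (by rintro rfl; omega)
      (h.sub hcur) hcz.symm with rfl | rfl
    · omega
    · exact hzp (h.inj z hzW p hp (by rw [hpc, hzc]) (by omega))

/-- Position `pos cur + 1` is free because `cur` has the largest position in its component.
Closedness is demanded of the other components only, so the new vertex does not disturb it. -/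
theorem extend (h : Walk H U W comp pos last cur) (hcur : cur ∈ W) {x : ℕ} (hx : x ∈ U)
    (hxW : x ∉ W) (hcx : H.Adj cur x) :
    Walk H U (insert x W) (Function.update comp x (comp cur))
      (Function.update pos x (pos cur + 1)) (Function.update last (comp cur) x) x := by
  have hne : ∀ v ∈ W, v ≠ x := fun v hv he => hxW (he ▸ hv)
  have hccW := h.comp_mem cur hcur
  have hcc : comp cur ≠ x := hne _ hccW
  have hcurx : cur ≠ x := hne _ hcur
  have hcompx : ∀ v ∈ W, comp v ≠ x := fun v hv => hne _ (h.comp_mem v hv)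
  refine ⟨?_, ?_, ?_, ?_, ?_, ?_, ?_, ?_, ?_, ?_, ?_, ?_, ?_⟩
  · exact insert_subset hx h.sub
  · simp only [forall_mem_insert, Function.update_self]
    exact ⟨mem_insert_of_mem hccW, fun v hv => by
      rw [Function.update_of_ne (hne v hv)]; exact mem_insert_of_mem (h.comp_mem v hv)⟩
  · simp only [forall_mem_insert, Function.update_self]
    refine ⟨by rw [Function.update_of_ne hcc, h.comp_comp cur hcur], fun v hv => ?_⟩
    rw [Function.update_of_ne (hne v hv), Function.update_of_ne (hcompx v hv), h.comp_comp v hv]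
  · simp only [forall_mem_insert, Function.update_self]
    refine ⟨by rw [Function.update_of_ne hcc, h.pos_comp cur hcur], fun v hv => ?_⟩
    rw [Function.update_of_ne (hne v hv), Function.update_of_ne (hcompx v hv), h.pos_comp v hv]
  · have key : ∀ v ∈ W, comp v = comp cur → pos v ≠ pos cur + 1 := fun v hv hvc => by
      have := h.pos_le_cur hcur hv hvc
      omega
    simp only [forall_mem_insert, Function.update_self]
    refine ⟨⟨fun _ _ => trivial, fun w hw => ?_⟩, fun v hv => ⟨?_, fun w hw => ?_⟩⟩
    · rw [Function.update_of_ne (hne w hw), Function.update_of_ne (hne w hw)]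
      exact fun h1 h2 => absurd h2.symm (key w hw h1.symm)
    · rw [Function.update_of_ne (hne v hv), Function.update_of_ne (hne v hv)]
      exact fun h1 h2 => absurd h2 (key v hv h1)
    · rw [Function.update_of_ne (hne v hv), Function.update_of_ne (hne v hv),
        Function.update_of_ne (hne w hw), Function.update_of_ne (hne w hw)]
      exact h.inj v hv w hw
  · simp only [forall_mem_insert, Function.update_self]
    refine ⟨fun _ => ⟨cur, mem_insert_of_mem hcur, hcx, ?_, ?_⟩, fun v hv hv0 => ?_⟩
    · rw [Function.update_of_ne hcurx]
    · rw [Function.update_of_ne hcurx]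
    · rw [Function.update_of_ne (hne v hv)] at hv0
      obtain ⟨w, hw, h1, h2, h3⟩ := h.pred v hv hv0
      refine ⟨w, mem_insert_of_mem hw, h1, ?_, ?_⟩
      · rw [Function.update_of_ne (hne v hv), Function.update_of_ne (hne w hw), h2]
      · rw [Function.update_of_ne (hne v hv), Function.update_of_ne (hne w hw), h3]
  · simp only [forall_mem_insert, Function.update_self]
    refine ⟨mem_insert_self _ _, fun v hv => ?_⟩
    rw [Function.update_of_ne (hne v hv), Function.update_apply]
    split_ifs
    exacts [mem_insert_self _ _, mem_insert_of_mem (h.last_mem v hv)]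
  · simp only [forall_mem_insert, Function.update_self]
    refine ⟨trivial, fun v hv => ?_⟩
    rw [Function.update_of_ne (hne v hv), Function.update_apply last]
    split_ifs with hvc
    · rw [Function.update_self, hvc]
    · rw [Function.update_of_ne (hne _ (h.last_mem v hv)), h.comp_last v hv]
  · simp only [forall_mem_insert, Function.update_self]
    refine ⟨le_rfl, fun v hv => ?_⟩
    rw [Function.update_of_ne (hne v hv), Function.update_of_ne (hne v hv),
      Function.update_apply last]
    split_ifs with hvc
    · have := h.pos_le_cur hcur hv hvc
      rw [Function.update_self]; omega
    · rw [Function.update_of_ne (hne _ (h.last_mem v hv))]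
      exact h.pos_le_last v hv
  · simp only [forall_mem_insert, Function.update_self]
    refine ⟨fun _ _ _ h => absurd rfl h, fun v hv w hw hvw hvc => ?_⟩
    rw [Function.update_of_ne (hne v hv)] at hvc ⊢
    obtain ⟨h1, h2⟩ := h.closed v hv w hw hvw hvc
    exact ⟨mem_insert_of_mem h1, by rw [Function.update_of_ne (hne w h1), h2]⟩
  · exact .inl (mem_insert_self _ _)
  · simp
  · intro _
    rw [Function.update_self]
    refine (h.start hcur).imp_right fun h1 w hw hww => ?_
    by_cases hwx : w = x
    · subst hwx; exact h1 w hw (.inl hxW)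
    · rw [Function.update_of_ne hwx] at hww
      refine h1 w hw (hww.imp_left fun h2 h3 => h2 (mem_insert_of_mem h3))

/-- The former current component loses its exemption from closedness, which is why `hcl` is needed.
The name `x` is fresh, because names of components are visited vertices. -/
theorem restart (h : Walk H U W comp pos last cur)
    (hcl : ∀ v ∈ W, ∀ w ∈ U, H.Adj v w → w ∈ W ∧ comp w = comp v) {x : ℕ} (hx : x ∈ U)
    (hxW : x ∉ W) (hstart : nb H U x ≤ 1 ∨ ∀ w ∈ U, w ∉ W → 2 ≤ nb H U w) :
    Walk H U (insert x W) (Function.update comp x x)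
      (Function.update pos x 0) (Function.update last x x) x := by
  have hne : ∀ v ∈ W, v ≠ x := fun v hv he => hxW (he ▸ hv)
  have hcompx : ∀ v ∈ W, comp v ≠ x := fun v hv => hne _ (h.comp_mem v hv)
  refine ⟨?_, ?_, ?_, ?_, ?_, ?_, ?_, ?_, ?_, ?_, ?_, ?_, ?_⟩
  · exact insert_subset hx h.sub
  · simp only [forall_mem_insert, Function.update_self]
    exact ⟨mem_insert_self _ _, fun v hv => by
      rw [Function.update_of_ne (hne v hv)]; exact mem_insert_of_mem (h.comp_mem v hv)⟩
  · simp only [forall_mem_insert, Function.update_self]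
    refine ⟨trivial, fun v hv => ?_⟩
    rw [Function.update_of_ne (hne v hv), Function.update_of_ne (hcompx v hv), h.comp_comp v hv]
  · simp only [forall_mem_insert, Function.update_self]
    refine ⟨trivial, fun v hv => ?_⟩
    rw [Function.update_of_ne (hne v hv), Function.update_of_ne (hcompx v hv), h.pos_comp v hv]
  · simp only [forall_mem_insert, Function.update_self]
    refine ⟨⟨fun _ _ => trivial, fun w hw => ?_⟩, fun v hv => ⟨?_, fun w hw => ?_⟩⟩
    · rw [Function.update_of_ne (hne w hw)]
      exact fun h1 => absurd h1.symm (hcompx w hw)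
    · rw [Function.update_of_ne (hne v hv)]
      exact fun h1 => absurd h1 (hcompx v hv)
    · rw [Function.update_of_ne (hne v hv), Function.update_of_ne (hne v hv),
        Function.update_of_ne (hne w hw), Function.update_of_ne (hne w hw)]
      exact h.inj v hv w hw
  · simp only [forall_mem_insert, Function.update_self]
    refine ⟨fun h0 => absurd rfl h0, fun v hv hv0 => ?_⟩
    rw [Function.update_of_ne (hne v hv)] at hv0
    obtain ⟨w, hw, h1, h2, h3⟩ := h.pred v hv hv0
    refine ⟨w, mem_insert_of_mem hw, h1, ?_, ?_⟩
    · rw [Function.update_of_ne (hne v hv), Function.update_of_ne (hne w hw), h2]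
    · rw [Function.update_of_ne (hne v hv), Function.update_of_ne (hne w hw), h3]
  · simp only [forall_mem_insert, Function.update_self]
    refine ⟨mem_insert_self _ _, fun v hv => ?_⟩
    rw [Function.update_of_ne (hne v hv), Function.update_of_ne (hcompx v hv)]
    exact mem_insert_of_mem (h.last_mem v hv)
  · simp only [forall_mem_insert, Function.update_self]
    refine ⟨trivial, fun v hv => ?_⟩
    rw [Function.update_of_ne (hne v hv), Function.update_of_ne (hcompx v hv),
      Function.update_of_ne (hne _ (h.last_mem v hv)), h.comp_last v hv]
  · simp only [forall_mem_insert, Function.update_self]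
    refine ⟨le_rfl, fun v hv => ?_⟩
    rw [Function.update_of_ne (hne v hv), Function.update_of_ne (hne v hv),
      Function.update_of_ne (hcompx v hv), Function.update_of_ne (hne _ (h.last_mem v hv))]
    exact h.pos_le_last v hv
  · simp only [forall_mem_insert, Function.update_self]
    refine ⟨fun _ _ _ h => absurd rfl h, fun v hv w hw hvw hvc => ?_⟩
    obtain ⟨h1, h2⟩ := hcl v hv w hw hvw
    rw [Function.update_of_ne (hne v hv)]
    exact ⟨mem_insert_of_mem h1, by rw [Function.update_of_ne (hne w h1), h2]⟩
  · exact .inl (mem_insert_self _ _)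
  · simp
  · intro _
    rw [Function.update_self]
    refine hstart.imp_right fun h1 w hw hww => ?_
    by_cases hwx : w = x
    · subst hwx; exact h1 w hw hxW
    · rw [Function.update_of_ne hwx] at hww
      refine h1 w hw ?_
      rcases hww with h2 | h2
      · exact fun h3 => h2 (mem_insert_of_mem h3)
      · exact fun h3 => hcompx w h3 h2

theorem decomp (h : Walk H U U comp pos last cur) (hU : ∀ v ∈ U, nb H U v ≤ 2) :
    Decomp H U comp pos :=
  ⟨fun v hv w hw hvw => (h.closed_of_stuck hU (fun _ _ hx hxU => absurd hx hxU) v hv w hw hvw).2.symm,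
    h.inj, h.pred⟩

/-- The size of a component can be read off from its last vertex. The program uses this modulo
three, as it stores residues of positions only. -/
theorem pos_last (h : Walk H U U comp pos last cur) (hU : ∀ v ∈ U, nb H U v ≤ 2) {c : ℕ}
    (hc : c ∈ image comp U) : pos (last c) + 1 = #(cls U comp c) := by
  obtain ⟨v, hv, rfl⟩ := mem_image.1 hc
  have hd := h.decomp hU
  have h1 : last (comp v) ∈ cls U comp (comp v) := mem_cls.2 ⟨h.last_mem v hv, h.comp_last v hv⟩
  have h2 := hd.pos_lt h1
  obtain ⟨w, hw, hwp⟩ := hd.exists_pos (c := comp v) (k := #(cls U comp (comp v)) - 1) (by omega)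
  obtain ⟨hwU, hwc⟩ := mem_cls.1 hw
  have h3 := h.pos_le_last w hwU
  rw [hwc] at h3
  omega

end Walk

/-! ### Local search for a large cut -/

section Cut

variable {n : ℕ} {H : SimpleGraph ℕ} {D : Finset ℕ}

/-- The number of edges between `D` and its complement. -/
noncomputable def cut (n : ℕ) (H : SimpleGraph ℕ) (D : Finset ℕ) : ℕ :=
  ∑ v ∈ D, nb H (range n \ D) v

/-- The potential of the local search. -/
noncomputable def potential (n : ℕ) (H : SimpleGraph ℕ) (D : Finset ℕ) : ℕ :=
  2 * cut n H D + if 2 * #D = n then 0 else 1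

theorem nb_insert {v x : ℕ} (hx : x ∉ D) [Decidable (H.Adj v x)] :
    nb H (insert x D) v = nb H D v + if H.Adj v x then 1 else 0 := by
  classical
  rw [nb, filter_insert]
  split_ifs with h
  · rw [card_insert_of_notMem (by simp [hx])]; rfl
  · rfl

theorem nb_add_compl (hD : D ⊆ range n) (v : ℕ) :
    nb H D v + nb H (range n \ D) v = nb H (range n) v := by
  rw [← nb_union disjoint_sdiff, union_sdiff_of_subset hD]

/-- Moving `v` out of `D` removes its edges to the other side from the cut and adds its edges to
`D`. The identity is stated with sums to avoid truncated subtraction. -/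
theorem cut_erase {v : ℕ} (hv : v ∈ D) (hvn : v < n) :
    cut n H (D.erase v) + nb H (range n \ D) v = cut n H D + nb H D v := by
  classical
  have h1 : range n \ D.erase v = insert v (range n \ D) := by
    ext x; simp only [mem_sdiff, mem_range, mem_erase, mem_insert]; grind
  have h2 : nb H D v = ∑ u ∈ D.erase v, if H.Adj u v then 1 else 0 := by
    rw [← card_filter, nb]
    congr 1
    ext x
    simp only [mem_filter, mem_erase, H.adj_comm v x]
    constructor
    · rintro ⟨h, h'⟩; exact ⟨⟨h'.ne, h⟩, h'⟩
    · rintro ⟨⟨-, h⟩, h'⟩; exact ⟨h, h'⟩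
  rw [cut, cut, h1, h2, ← add_sum_erase D _ hv]
  simp only [nb_insert (show v ∉ range n \ D by simp [hv]), sum_add_distrib]
  omega

theorem cut_insert {v : ℕ} (hv : v ∉ D) (hvn : v < n) :
    cut n H (insert v D) + nb H D v = cut n H D + nb H (range n \ D) v := by
  classical
  have h := cut_erase (H := H) (mem_insert_self v D) hvn
  rw [erase_insert hv, nb_insert hv, if_neg (H.irrefl)] at h
  have h1 : range n \ D = insert v (range n \ insert v D) := by
    ext x; simp only [mem_sdiff, mem_range, mem_insert]; grind
  have h2 : nb H (range n \ D) v = nb H (range n \ insert v D) v := by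
    rw [h1, nb_insert (by simp), if_neg H.irrefl, add_zero]
  omega

/-- No vertex outside of `D` can be moved to `D` in the local search. -/
def Stable (n : ℕ) (H : SimpleGraph ℕ) (D : Finset ℕ) : Prop :=
  ∀ v < n, v ∉ D → nb H (range n \ D) v ≤ nb H D v ∧
    (2 * #D = n → nb H (range n \ D) v = nb H D v → nb H D v = 0)

/-- If `2 * #D ≤ n - 1`, it suffices that half of the neighbours of `v` lie in `D`. If `2 * #D = n`,
a strict majority is needed, as the second clause of `Stable` guarantees for non-isolated vertices;
with degree `δ ≤ n - 1` it gives `2 * nb H D v * (n - 1) ≥ (δ + 1) * (n - 1) ≥ δ * n`. -/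
theorem Stable.good (h : Stable n H D) (hD : D ⊆ range n) (hn : 3 ≤ n) (hpos : 1 ≤ #D)
    (hcard : 2 * #D ≤ n) : Good n H D := by
  classical
  refine ⟨hD, hpos, by omega, fun v hv hvD => ?_⟩
  obtain ⟨h1, h2⟩ := h v hv hvD
  have h3 := nb_add_compl (H := H) hD v
  rcases hcard.lt_or_eq with hlt | heq
  · calc nb H (range n) v * #D ≤ (2 * nb H D v) * #D := Nat.mul_le_mul_right _ (by omega)
      _ = nb H D v * (2 * #D) := by ring
      _ ≤ _ := Nat.mul_le_mul_left _ (by omega)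
  · by_cases h0 : nb H D v = 0
    · rw [← h3, h0, show nb H (range n \ D) v = 0 by omega]; simp
    · have h4 : nb H (range n \ D) v ≠ nb H D v := fun he => h0 (h2 heq he)
      have h5 : nb H (range n) v ≤ n - 1 := by
        have : nb H (range n) v ≤ #((range n).erase v) := by
          refine card_le_card fun x hx => ?_
          obtain ⟨hx, hvx⟩ := mem_filter.1 hx
          exact mem_erase.2 ⟨hvx.ne', hx⟩
        rwa [card_erase_of_mem (by simpa), card_range] at this
      obtain ⟨m, rfl⟩ : ∃ m, n = m + 1 := ⟨n - 1, by omega⟩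
      rw [Nat.add_sub_cancel] at h5 ⊢
      have h6 : (nb H (range (m + 1)) v + 1) * m ≤ (2 * nb H D v) * m :=
        Nat.mul_le_mul_right _ (by omega)
      have h7 : 2 * (nb H (range (m + 1)) v * #D) = nb H (range (m + 1)) v * (m + 1) := by
        rw [← heq]; ring
      nlinarith

/-- A strict gain raises twice the cut by at least two, more than the balance term can lose. A tie
is broken only at exact balance: the cut stays and the balance term rises from `0` to `1`. -/
theorem potential_erase {v : ℕ} (hv : v ∈ D) (hvn : v < n)
    (h : nb H (range n \ D) v < nb H D v ∨
      (2 * #D = n ∧ nb H (range n \ D) v = nb H D v)) :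
    potential n H D < potential n H (D.erase v) := by
  have h1 := cut_erase (H := H) hv hvn
  have h2 := card_erase_of_mem hv
  have h3 := card_pos.2 ⟨v, hv⟩
  unfold potential
  split_ifs <;> omega

theorem potential_insert {v : ℕ} (hv : v ∉ D) (hvn : v < n)
    (h : nb H D v < nb H (range n \ D) v ∨
      (2 * #D = n ∧ nb H D v = nb H (range n \ D) v)) :
    potential n H D < potential n H (insert v D) := by
  have h1 := cut_insert (H := H) hv hvn
  have h2 := card_insert_of_notMem hv
  unfold potential
  split_ifs <;> omega

/-- The cut is at most the sum of all degrees, hence at most `4 * n`: two for every vertex and `n`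
more for each of `a` and `b`. Linearity of this bound keeps the local search quadratic. -/
theorem potential_le {a b : ℕ} (hl : LowGraph n H a b) (hD : D ⊆ range n) :
    potential n H D ≤ 8 * n + 1 := by
  have h1 : cut n H D ≤ ∑ v ∈ range n, nb H (range n) v :=
    (sum_le_sum fun v _ => nb_mono sdiff_subset).trans (sum_le_sum_of_subset hD)
  have h2 : ∑ v ∈ range n, nb H (range n) v ≤
      ∑ v ∈ range n, (2 + (if v = a then n else 0) + if v = b then n else 0) := by
    refine sum_le_sum fun v _ => ?_
    have h3 : nb H (range n) v ≤ n := by simpa using nb_le_card (H := H) (D := range n) (v := v)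
    by_cases ha : v = a
    · simp only [ha, if_true] at *; omega
    by_cases hb : v = b
    · simp only [hb, if_true] at *; omega
    have := hl.low v ha hb
    omega
  have h4 : ∑ v ∈ range n, (2 + (if v = a then n else 0) + if v = b then n else 0) = 4 * n := by
    simp only [sum_add_distrib, sum_ite_eq', mem_range, hl.a_lt, hl.b_lt, if_true, sum_const,
      card_range, smul_eq_mul]
    omega
  unfold potential
  split_ifs <;> omega

end Cut

end PDS

/-! ### The program -/

notation "aBest" => 3
notation "aBestCard" => 4
notation "aDeg" => 5
notation "aA" => 6
notation "aB" => 7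
notation "aCand" => 8
notation "aCandCard" => 9
notation "aCandDeg" => 10
notation "aBad" => 11
notation "aSide" => 12
notation "aSideDeg" => 13
notation "aFlip" => 14
notation "aSideCard" => 15
notation "aTarget" => 16
notation "aTargetDeg" => 17
notation "aVisited" => 18
notation "aCur" => 19
notation "aComp" => 20
notation "aRes" => 21
notation "aLast" => 22
notation "aNext" => 23
notation "aShift" => 24
notation "aLeft" => 25
notation "aI" => 26
notation "aJ" => 27

namespace RAM

namespace Expr

/-- Inequality test. -/
def ne (e f : Expr) : Expr := .add (.sub e f) (.sub f e)

@[simp] theorem eval_ne (e f : Expr) (σ : Memory) :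
    (e.ne f).eval σ ≠ 0 ↔ e.eval σ ≠ f.eval σ := by
  simp only [ne, eval]
  omega

end Expr

namespace Stmt

open RAM.Expr

/-- Compute the degrees in the complement of the input graph. -/
def degrees : Stmt := countAll aI aJ aDeg (coadj (var aI) (var aJ))

/-- Find two vertices such that all other vertices have degree at most two in the complement. -/
def pick : Stmt :=
  seq (find aI aA (.sub (.read aDeg (var aI)) (.const 2)))
  (seq (cond (.sub .size (var aA)) skip (store aA (.const 0) (.const 0)))
  (seq (find aI aB (.mul (.sub (.read aDeg (var aI)) (.const 2)) (ne (var aI) (var aA))))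
    (cond (.sub .size (var aB)) skip (find aI aB (ne (var aI) (var aA))))))

/-- Start the local search with the vertex `0`. -/
def initSide : Stmt :=
  seq (map aI aSide (Expr.eq (var aI) (.const 0)))
    (map aI aSideDeg (coadj (var aI) (.const 0)))

/-- The number of neighbours of `aI` on its own side. -/
def sameSide : Expr :=
  .add (.mul (.read aSide (var aI)) (.read aSideDeg (var aI)))
    (.mul (.sub (.const 1) (.read aSide (var aI)))
      (.sub (.read aDeg (var aI)) (.read aSideDeg (var aI))))

/-- The number of neighbours of `aI` on the other side. -/
def otherSide : Expr :=
  .add (.mul (.read aSide (var aI)) (.sub (.read aDeg (var aI)) (.read aSideDeg (var aI))))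
    (.mul (.sub (.const 1) (.read aSide (var aI))) (.read aSideDeg (var aI)))

/-- Test whether the local search may move `aI` to the other side. -/
def flippable : Expr :=
  .add (.sub sameSide otherSide)
    (.mul (.mul (Expr.eq sameSide otherSide) sameSide)
      (Expr.eq (.add (var aSideCard) (var aSideCard)) .size))

/-- Move the vertex `aFlip` to the other side. -/
def moveSide : Stmt :=
  seq (forN aI (cond (coadj (var aI) (var aFlip))
      (cond (.read aSide (var aFlip))
        (store aSideDeg (var aI) (.sub (.read aSideDeg (var aI)) (.const 1)))
        (inc aSideDeg (var aI))) skip))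
    (store aSide (var aFlip) (.sub (.const 1) (.read aSide (var aFlip))))

/-- One step of the local search. -/
def searchStep : Stmt :=
  seq (count aI aSideCard (.const 0) (.read aSide (var aI)))
  (seq (find aI aFlip flippable)
    (cond (.sub .size (var aFlip)) moveSide skip))

/-- Repeat a statement. -/
def rep : ℕ → Stmt → Stmt
  | 0, _ => skip
  | k + 1, s => seq (rep k s) s

/-- The loop performs `9 * n` steps. This exceeds the largest possible potential, `8 * n + 1`, and
every step before the end of the search gains at least one. -/
def localSearch : Stmt := seq initSide (forN aJ (rep 9 searchStep))

/-- Check whether `aCand` is good and smaller than `aBest`, and replace `aBest` if so. -/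
def consider : Stmt :=
  seq (count aI aCandCard (.const 0) (.read aCand (var aI)))
  (seq (countAll aI aJ aCandDeg (.mul (.read aCand (var aJ)) (coadj (var aI) (var aJ))))
  (seq (count aI aBad (.const 0) (.mul (.sub (.const 1) (.read aCand (var aI)))
      (.sub (.mul (.read aDeg (var aI)) (var aCandCard))
        (.mul (.read aCandDeg (var aI)) (.sub .size (.const 1))))))
    (cond (var aBad) skip
      (cond (.mul (.mul (var aCandCard) (.sub (.sub .size (.const 1)) (var aCandCard)))
          (.sub (var aBestCard) (var aCandCard)))
        (seq (map aI aBest (.read aCand (var aI))) (store aBestCard (.const 0) (var aCandCard)))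
        skip))))

/-- Compute the vertices to be dominated; `x` and `y` tell whether `a` and `b` are selected. -/
def initTargets (x y : ℕ) : Stmt :=
  seq (map aI aTarget (.sub (.const 1)
      (.add (.add (.add (Expr.eq (var aI) (var aA)) (Expr.eq (var aI) (var aB)))
          (.sub (.const 1) (.read aDeg (var aI))))
        (.add (.mul (.const x) (coadj (var aI) (var aA)))
          (.mul (.const y) (coadj (var aI) (var aB)))))))
    (countAll aI aJ aTargetDeg (.mul (.read aTarget (var aJ)) (coadj (var aI) (var aJ))))

/-- Test whether `aI` is an unvisited target. -/
def unvisited : Expr := .mul (.read aTarget (var aI)) (.sub (.const 1) (.read aVisited (var aI)))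

/-- Find an unvisited target that continues the walk. -/
def findNext : Stmt :=
  find aI aNext (.mul (.mul (.sub .size (var aCur)) unvisited) (coadj (var aCur) (var aI)))

/-- Find an unvisited target where a new walk may start. -/
def findStart : Stmt :=
  seq (find aI aNext (.mul unvisited (.sub (.const 2) (.read aTargetDeg (var aI)))))
    (cond (.sub .size (var aNext)) skip (find aI aNext unvisited))

/-- Append `aNext` to the walk. -/
def appendNext : Stmt :=
  seq (store aComp (var aNext) (.read aComp (var aCur)))
    (cond (.read aRes (var aCur))
      (cond (.sub (.read aRes (var aCur)) (.const 1))
        (store aRes (var aNext) (.const 0)) (store aRes (var aNext) (.const 2)))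
      (store aRes (var aNext) (.const 1)))

/-- Start a new walk at `aNext`. -/
def startNext : Stmt :=
  seq (store aComp (var aNext) (var aNext)) (store aRes (var aNext) (.const 0))

/-- Mark `aNext` as visited. -/
def visitNext : Stmt :=
  seq (store aVisited (var aNext) (.const 1))
  (seq (store aCur (.const 0) (var aNext))
    (store aLast (.read aComp (var aNext)) (var aNext)))

/-- Visit one more vertex. -/
def walkStep : Stmt :=
  seq findNext
    (cond (.sub .size (var aNext))
      (seq appendNext visitNext)
      (seq findStart
        (cond (.sub .size (var aNext)) (seq startNext visitNext) skip)))

/-- The value `n` of `aCur` means that there is no current vertex. Each of the `n` rounds visits a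
vertex as long as one is left. -/
def walk : Stmt :=
  seq (map aI aVisited (.const 0))
  (seq (store aCur (.const 0) .size) (forN aJ walkStep))

/-- The last vertex of the component with name `aI`. -/
abbrev lastOf (I : ℕ) : Expr := .read aLast (var I)

/-- Choose the initial shifts of the components, with preference for neighbours of `b`. -/
def initShift : Stmt :=
  map aI aShift (.sub (.const 1) (.sub (.const 1)
    (.add (Expr.eq (.read aRes (lastOf aI)) (.const 2))
      (.mul (Expr.eq (.read aRes (lastOf aI)) (.const 1))
        (.mul (.sub (.const 1) (coadj (var aI) (var aB)))
          (.add (coadj (lastOf aI) (var aA)) (coadj (lastOf aI) (var aB))))))))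

/-- Compute the candidate that the shifts determine. -/
def choose (x y : ℕ) : Stmt :=
  map aI aCand (.sub (.const 1) (.sub (.const 1)
    (.add (.mul (.read aTarget (var aI))
        (Expr.eq (.read aRes (var aI)) (.read aShift (.read aComp (var aI)))))
      (.add (.mul (.const x) (Expr.eq (var aI) (var aA)))
        (.mul (.const y) (Expr.eq (var aI) (var aB)))))))

/-- Test whether `aJ` is the name of a component with a choice between a neighbour of `a` and a
neighbour of `b`. -/
def flexible : Expr :=
  .mul (.mul (.read aTarget (var aJ)) (Expr.eq (.read aComp (var aJ)) (var aJ)))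
    (.mul (Expr.eq (.read aRes (lastOf aJ)) (.const 1))
      (.add (.mul (coadj (var aJ) (var aA)) (coadj (lastOf aJ) (var aB)))
        (.mul (coadj (var aJ) (var aB)) (coadj (lastOf aJ) (var aA)))))

/-- Change the choice in the component `aJ` if there is one and `a` is not satisfied. -/
def adjustStep (x y : ℕ) : Stmt :=
  seq (choose x y)
  (seq (count aI aCandCard (.const 0) (.read aCand (var aI)))
  (seq (count aI aLeft (.const 0) (.mul (.read aCand (var aI)) (coadj (var aA) (var aI))))
    (cond (.mul flexible (.sub (.mul (.read aDeg (var aA)) (var aCandCard))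
        (.mul (var aLeft) (.sub .size (.const 1)))))
      (store aShift (var aJ) (.sub (.const 1) (.read aShift (var aJ)))) skip)))

/-- Compute the candidate that contains `a` if `x = 1` and `b` if `y = 1`. -/
def candidate (x y : ℕ) : Stmt :=
  seq (initTargets x y)
  (seq walk (seq initShift (seq (forN aJ (adjustStep x y)) (choose x y))))

/-- The size `n`, which no good set has, marks that nothing has been found yet. -/
def prepare : Stmt := seq degrees (seq pick (store aBestCard (.const 0) .size))

/-- Only a side with at most `n / 2` vertices is certain to be good; testing both sides avoids a
comparison. -/
def considerSides : Stmt :=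
  seq localSearch
  (seq (map aI aCand (.read aSide (var aI)))
  (seq consider
  (seq (map aI aCand (.sub (.const 1) (.read aSide (var aI)))) consider)))

def considerCandidate (x y : ℕ) : Stmt := seq (candidate x y) consider

def considerCandidates : Stmt :=
  seq (considerCandidate 0 0) (seq (considerCandidate 0 1)
    (seq (considerCandidate 1 0) (considerCandidate 1 1)))

def main : Stmt :=
  seq prepare (seq considerSides (seq considerCandidates
    (map aI 2 (.sub (.const 1) (.read aBest (var aI))))))

theorem wf_main : main.wf = true := by decide

/-- The source of the quadratic running time: no three loops are nested. -/
theorem depth_main : main.depth = 2 := by decide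

end Stmt

end RAM

namespace RAM

open PDS Stmt

/-! ### Verification of the program -/

theorem Expr.mul_ne (e f : Expr) (σ : Memory) :
    (Expr.mul e f).eval σ ≠ 0 ↔ e.eval σ ≠ 0 ∧ f.eval σ ≠ 0 := by
  simp [Expr.eval]

theorem Expr.sub_ne (e f : Expr) (σ : Memory) :
    (Expr.sub e f).eval σ ≠ 0 ↔ f.eval σ < e.eval σ := by
  simp only [Expr.eval]
  omega

theorem Stmt.sem_cond_true {e : Expr} {σ : Memory} (h : e.eval σ ≠ 0) (p q : Stmt) :
    (cond e p q).sem σ = p.sem σ := if_pos h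

theorem Stmt.sem_cond_false {e : Expr} {σ : Memory} (h : ¬e.eval σ ≠ 0) (p q : Stmt) :
    (cond e p q).sem σ = q.sem σ := if_neg h

/-- The set of the vertices for which array `x` is nonzero. -/
def supp (n : ℕ) (σ : Memory) (x : ℕ) : Finset ℕ := {v ∈ range n | σ x v ≠ 0}

theorem mem_supp {n : ℕ} {σ : Memory} {x v : ℕ} : v ∈ supp n σ x ↔ v < n ∧ σ x v ≠ 0 := by
  simp [supp]

theorem supp_subset {n : ℕ} {σ : Memory} {x : ℕ} : supp n σ x ⊆ range n := filter_subset _ _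

theorem supp_congr {n : ℕ} {σ τ : Memory} {x y : ℕ} (h : ∀ v < n, σ x v ≠ 0 ↔ τ y v ≠ 0) :
    supp n σ x = supp n τ y := by
  ext v
  simp only [mem_supp]
  exact and_congr_right (h v)

theorem Input.write {n : ℕ} {H : SimpleGraph ℕ} {σ : Memory} (h : Input n H σ) {a : ℕ} (i v : ℕ)
    (ha : 2 ≤ a) : Input n H (σ.write a i v) :=
  h.congr (σ.write_of_ne _ _ (by omega)) (σ.write_of_ne _ _ (by omega))

theorem Input.coadj_ne {n : ℕ} {H : SimpleGraph ℕ} {σ : Memory} (h : Input n H σ) {e f : Expr}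
    {i j : ℕ} (he : e.eval σ = i) (hf : f.eval σ = j) (hi : i < n) (hj : j < n) :
    (e.coadj f).eval σ ≠ 0 ↔ H.Adj i j := by
  subst he hf
  rw [h.eval_coadj hi hj]
  split_ifs <;> simp [*]

theorem Input.coadj_of_adj {n : ℕ} {H : SimpleGraph ℕ} {σ : Memory} (h : Input n H σ) {e f : Expr}
    {i j : ℕ} (he : e.eval σ = i) (hf : f.eval σ = j) (hi : i < n) (hj : j < n) (hij : H.Adj i j) :
    (e.coadj f).eval σ = 1 := by
  subst he hf
  rw [h.eval_coadj hi hj, if_pos hij]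

theorem Input.coadj_of_not_adj {n : ℕ} {H : SimpleGraph ℕ} {σ : Memory} (h : Input n H σ)
    {e f : Expr} {i j : ℕ} (he : e.eval σ = i) (hf : f.eval σ = j) (hi : i < n) (hj : j < n)
    (hij : ¬H.Adj i j) : (e.coadj f).eval σ = 0 := by
  subst he hf
  rw [h.eval_coadj hi hj, if_neg hij]

theorem card_eq_nb {n : ℕ} {H : SimpleGraph ℕ} {D : Finset ℕ} {v : ℕ} (hD : D ⊆ range n)
    {p : ℕ → Prop} [DecidablePred p] (h : ∀ j < n, p j ↔ j ∈ D ∧ H.Adj v j) :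
    #{j ∈ range n | p j} = nb H D v := by
  classical
  rw [nb]
  congr 1
  ext j
  simp only [mem_filter, mem_range]
  constructor
  · rintro ⟨hj, hp⟩; exact (h j hj).1 hp
  · intro hj
    have := mem_range.1 (hD hj.1)
    exact ⟨this, (h j this).2 hj⟩

theorem card_eq_card {n : ℕ} {D : Finset ℕ} (hD : D ⊆ range n)
    {p : ℕ → Prop} [DecidablePred p] (h : ∀ j < n, p j ↔ j ∈ D) :
    #{j ∈ range n | p j} = #D := by
  congr 1
  ext j
  simp only [mem_filter, mem_range]
  constructor
  · rintro ⟨hj, hp⟩; exact (h j hj).1 hp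
  · intro hj
    have := mem_range.1 (hD hj)
    exact ⟨this, (h j this).2 hj⟩

/-- The degrees and the vertices `a` and `b` have been computed. -/
structure Ctx (n : ℕ) (H : SimpleGraph ℕ) (a b : ℕ) (σ : Memory) : Prop where
  input : Input n H σ
  deg : ∀ v < n, σ aDeg v = nb H (range n) v
  left : σ aA 0 = a
  right : σ aB 0 = b

theorem Ctx.write {n a b : ℕ} {H : SimpleGraph ℕ} {σ : Memory} (h : Ctx n H a b σ) {x : ℕ}
    (i v : ℕ) (hx : 8 ≤ x) : Ctx n H a b (σ.write x i v) := by
  refine ⟨h.input.write _ _ (by omega), ?_, ?_, ?_⟩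
  · rw [σ.write_of_ne _ _ (by omega)]; exact h.deg
  · rw [σ.write_of_ne _ _ (by omega)]; exact h.left
  · rw [σ.write_of_ne _ _ (by omega)]; exact h.right

/-- The statement does not write to the input, the degrees and the vertices `a` and `b`. -/
def Stmt.keepsCtx (s : Stmt) : Bool :=
  !(s.writes 0 || s.writes 1 || s.writes aDeg || s.writes aA || s.writes aB)

theorem Ctx.sem {n a b : ℕ} {H : SimpleGraph ℕ} {σ : Memory} (h : Ctx n H a b σ) (s : Stmt)
    (hs : s.keepsCtx = true) : Ctx n H a b (s.sem σ) := by
  simp only [keepsCtx, Bool.not_eq_true', Bool.or_eq_false_iff] at hs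
  obtain ⟨⟨⟨⟨h0, h1⟩, h2⟩, h3⟩, h4⟩ := hs
  refine ⟨h.input.congr (sem_frame s σ h0) (sem_frame s σ h1), ?_, ?_, ?_⟩
  · rw [sem_frame s σ h2]; exact h.deg
  · rw [sem_frame s σ h3]; exact h.left
  · rw [sem_frame s σ h4]; exact h.right

theorem degrees_spec {n : ℕ} {H : SimpleGraph ℕ} {σ : Memory} (h : Input n H σ) :
    Input n H (degrees.sem σ) ∧ ∀ v < n, degrees.sem σ aDeg v = nb H (range n) v := by
  refine ⟨h.congr (sem_frame _ _ rfl) (sem_frame _ _ rfl), fun v hv => ?_⟩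
  rw [degrees, sem_countAll h.size (by decide) (by decide) (by decide) (by decide) (by decide)
    (by decide) rfl hv]
  refine card_eq_nb Subset.rfl fun j hj => ?_
  rw [((h.write _ _ (by decide)).write _ _ (by decide)).coadj_ne (i := v) (j := j)
    (by simp [Expr.eval, Memory.write_apply]) (by simp [Expr.eval, Memory.write_apply]) hv hj]
  simp [hj]

/-- At most two vertices have degree greater than two. -/
theorem pick_spec {n : ℕ} {H : SimpleGraph ℕ} {σ : Memory} (h : Input n H σ) (hn : 3 ≤ n)
    (hdeg : ∀ v < n, σ aDeg v = nb H (range n) v) (hadj : ∀ {u v}, H.Adj u v → v < n)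
    (hcard : #{v ∈ range n | 3 ≤ nb H (range n) v} ≤ 2) :
    ∃ a b, LowGraph n H a b ∧ Ctx n H a b (pick.sem σ) := by
  have hfr : ∀ s : Stmt, s.writes 0 = false → s.sem σ 0 0 = n := fun s hs => by
    rw [sem_frame s σ hs, h.size]
  have hctx : Input n H (pick.sem σ) ∧ ∀ v < n, pick.sem σ aDeg v = nb H (range n) v := by
    refine ⟨h.congr (sem_frame _ _ rfl) (sem_frame _ _ rfl), ?_⟩
    rw [sem_frame pick σ rfl]; exact hdeg
  suffices LowGraph n H (pick.sem σ aA 0) (pick.sem σ aB 0) from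
    ⟨_, _, this, hctx.1, hctx.2, rfl, rfl⟩
  set p1 : Stmt := seq (find aI aA (.sub (.read aDeg (.var aI)) (.const 2)))
    (cond (.sub .size (.var aA)) skip (store aA (.const 0) (.const 0))) with hp1
  set p2 : Stmt := seq (find aI aB (.mul (.sub (.read aDeg (.var aI)) (.const 2))
      (Expr.ne (.var aI) (.var aA))))
    (cond (.sub .size (.var aB)) skip (find aI aB (Expr.ne (.var aI) (.var aA)))) with hp2
  have hpick : pick.sem σ = p2.sem (p1.sem σ) := rfl
  set τ := p1.sem σ with hτ
  have hτ0 : τ 0 0 = n := hfr p1 rfl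
  have hτd : ∀ v < n, τ aDeg v = nb H (range n) v := by
    rw [hτ, sem_frame p1 σ rfl]; exact hdeg
  -- If there is no vertex of degree at least three, any vertex may serve as `a`, and `0` is taken.
  have hA : τ aA 0 < n ∧ (3 ≤ nb H (range n) (τ aA 0) ∨ ∀ v < n, nb H (range n) v ≤ 2) := by
    rw [hτ, hp1, Stmt.sem, sem_find h.size (by decide) (by decide) (by decide) rfl]
    have := findLast_spec (fun j => ((Expr.read aDeg (.var aI)).sub (.const 2)).eval
      (σ.write aI 0 j) ≠ 0) n n
    set r := findLast (fun j => ((Expr.read aDeg (.var aI)).sub (.const 2)).eval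
      (σ.write aI 0 j) ≠ 0) n n with hr
    simp only [Expr.sub_ne] at this
    simp [Expr.eval, Memory.write_apply] at this
    set ρ := (σ.write aA 0 r).write aI 0 n with hρ
    have hρ0 : ρ 0 0 = n := by simp [hρ, Memory.write_apply, h.size]
    have hρA : ρ aA 0 = r := by simp [hρ, Memory.write_apply]
    rcases this with ⟨h1, h2⟩ | ⟨h1, h2⟩
    · rw [sem_cond_true (by rw [Expr.sub_ne]; simp [Expr.eval, hρ0, hρA, h1]), Stmt.sem, hρA]
      rw [hdeg r h1] at h2
      exact ⟨h1, .inl (by omega)⟩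
    · rw [sem_cond_false (by rw [Expr.sub_ne]; simp [Expr.eval, hρ0, hρA, h1])]
      simp only [Stmt.sem, Expr.eval, Memory.write_apply, and_self, if_true]
      refine ⟨by omega, .inr fun v hv => ?_⟩
      have := h2 v hv
      rw [hdeg v hv] at this
      omega
  have hB : p2.sem τ aB 0 < n ∧ p2.sem τ aB 0 ≠ τ aA 0 ∧
      (3 ≤ nb H (range n) (p2.sem τ aB 0) ∨ ∀ v < n, v ≠ τ aA 0 → nb H (range n) v ≤ 2) := by
    rw [hp2, Stmt.sem, sem_find hτ0 (by decide) (by decide) (by decide) rfl]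
    have := findLast_spec (fun j => (((Expr.read aDeg (.var aI)).sub (.const 2)).mul
      (Expr.ne (.var aI) (.var aA))).eval (τ.write aI 0 j) ≠ 0) n n
    set r := findLast (fun j => (((Expr.read aDeg (.var aI)).sub (.const 2)).mul
      (Expr.ne (.var aI) (.var aA))).eval (τ.write aI 0 j) ≠ 0) n n with hr
    simp only [Expr.mul_ne, Expr.sub_ne, Expr.eval_ne] at this
    simp [Expr.eval, Memory.write_apply] at this
    set ρ := (τ.write aB 0 r).write aI 0 n with hρ
    have hρ0 : ρ 0 0 = n := by simp [hρ, Memory.write_apply, hτ0]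
    have hρA : ρ aA 0 = τ aA 0 := by simp [hρ, Memory.write_apply]
    have hρB : ρ aB 0 = r := by simp [hρ, Memory.write_apply]
    rcases this with ⟨h1, h2, h3⟩ | ⟨h1, h2⟩
    · rw [sem_cond_true (by rw [Expr.sub_ne]; simp [Expr.eval, hρ0, hρB, h1]), Stmt.sem, hρB]
      rw [hτd r h1] at h2
      exact ⟨h1, h3, .inl (by omega)⟩
    · rw [sem_cond_false (by rw [Expr.sub_ne]; simp [Expr.eval, hρ0, hρB, h1]),
        sem_find hρ0 (by decide) (by decide) (by decide) rfl]
      have := findLast_spec (fun j => (Expr.ne (.var aI) (.var aA)).eval (ρ.write aI 0 j) ≠ 0) n n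
      set q := findLast (fun j => (Expr.ne (.var aI) (.var aA)).eval (ρ.write aI 0 j) ≠ 0) n n
      simp only [Expr.eval_ne] at this
      simp [Expr.eval, Memory.write_apply, hρA] at this
      simp [Memory.write_apply]
      rcases this with ⟨h4, h5⟩ | ⟨h4, h5⟩
      · refine ⟨h4, h5, .inr fun v hv hva => ?_⟩
        have := hτd v hv
        by_contra! hne
        exact hva (h2 v hv (by omega))
      · exfalso
        -- The fallback search cannot fail, since `0` and `1` do not both equal `a`.
        have e0 := h5 0 (by omega)
        have e1 := h5 1 (by omega)
        omega
  have hAA : pick.sem σ aA 0 = τ aA 0 := by rw [hpick, sem_frame p2 τ rfl]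
  rw [hAA, hpick]
  obtain ⟨hA1, hA2⟩ := hA
  obtain ⟨hB1, hB2, hB3⟩ := hB
  set a := τ aA 0
  set b := p2.sem τ aB 0
  refine ⟨hadj, hA1, hB1, hB2.symm, fun v hva hvb => ?_⟩
  by_cases hvn : v < n
  swap
  · have : nb H (range n) v = 0 := by
      by_contra hne
      obtain ⟨x, -, hx⟩ := nb_pos.1 (Nat.pos_of_ne_zero hne)
      exact hvn (hadj hx.symm)
    omega
  rcases hA2 with hA2 | hA2
  swap
  · exact hA2 v hvn
  rcases hB3 with hB3 | hB3
  swap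
  · exact hB3 v hvn hva
  by_contra! hlt
  have : #({a, b, v} : Finset ℕ) ≤ #{v ∈ range n | 3 ≤ nb H (range n) v} := by
    refine card_le_card fun x hx => ?_
    simp only [mem_insert, mem_singleton] at hx
    rcases hx with rfl | rfl | rfl <;> simp [*] <;> omega
  rw [card_eq_three.2 ⟨a, b, v, hB2.symm, hva.symm, hvb.symm, rfl⟩] at this
  omega

/-- The set `aBest` is good, and it has `aBestCard` elements, unless `aBestCard` is still `n`. -/
structure BestInv (n : ℕ) (H : SimpleGraph ℕ) (σ : Memory) : Prop where
  le : σ aBestCard 0 ≤ n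
  good : σ aBestCard 0 < n → Good n H (supp n σ aBest) ∧ #(supp n σ aBest) = σ aBestCard 0

theorem BestInv.congr {n : ℕ} {H : SimpleGraph ℕ} {σ τ : Memory} (h : BestInv n H σ)
    (h1 : τ aBest = σ aBest) (h2 : τ aBestCard = σ aBestCard) : BestInv n H τ := by
  have : supp n τ aBest = supp n σ aBest := supp_congr fun v _ => by rw [h1]
  exact ⟨by rw [h2]; exact h.le, by rw [h2, this]; exact h.good⟩

/-- The recorded size never increases and drops to at most the size of every good set that is
considered, while `BestInv` keeps it attained. After a series of calls it is thus at most the size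
of each good set among those considered. -/
theorem consider_spec {n a b : ℕ} {H : SimpleGraph ℕ} {σ : Memory} (h : Ctx n H a b σ)
    (hb : BestInv n H σ) (hcand : ∀ v < n, σ aCand v ≤ 1) :
    BestInv n H (consider.sem σ) ∧ consider.sem σ aBestCard 0 ≤ σ aBestCard 0 ∧
      (Good n H (supp n σ aCand) → consider.sem σ aBestCard 0 ≤ #(supp n σ aCand)) := by
  set C := supp n σ aCand with hC
  set s1 : Stmt := count aI aCandCard (.const 0) (.read aCand (.var aI)) with hs1
  set s2 : Stmt := countAll aI aJ aCandDeg
    (.mul (.read aCand (.var aJ)) (.coadj (.var aI) (.var aJ))) with hs2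
  set e3 : Expr := (.mul (.sub (.const 1) (.read aCand (.var aI)))
      (.sub (.mul (.read aDeg (.var aI)) (.var aCandCard))
        (.mul (.read aCandDeg (.var aI)) (.sub .size (.const 1))))) with he3
  set s3 : Stmt := count aI aBad (.const 0) e3 with hs3
  have h1 : Ctx n H a b (s1.sem σ) := h.sem _ rfl
  have h2 : Ctx n H a b (s2.sem (s1.sem σ)) := h1.sem _ rfl
  have h3 : Ctx n H a b (s3.sem (s2.sem (s1.sem σ))) := h2.sem _ rfl
  have hk : s1.sem σ aCandCard 0 = #C := by
    rw [hs1, sem_count h.input.size (by decide) (by decide) (by decide) rfl rfl rfl]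
    simp [Memory.write_apply, Expr.eval]
    rfl
  have hd : ∀ v < n, s2.sem (s1.sem σ) aCandDeg v = nb H C v := by
    intro v hv
    rw [hs2, sem_countAll h1.input.size (by decide) (by decide) (by decide) (by decide) (by decide)
      (by decide) rfl hv]
    refine card_eq_nb supp_subset fun j hj => ?_
    simp only [Expr.eval, ne_eq, mul_eq_zero, not_or]
    rw [← ne_eq (Expr.eval _ (Expr.coadj _ _)), ((h1.input.write _ _ (by decide)).write _ _
      (by decide)).coadj_ne (i := v) (j := j) (by simp [Expr.eval, Memory.write_apply])
      (by simp [Expr.eval, Memory.write_apply]) hv hj]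
    have : s1.sem σ aCand = σ aCand := sem_frame s1 σ rfl
    simp [Memory.write_apply, this, mem_supp, hj]
  set τ := s3.sem (s2.sem (s1.sem σ)) with hτ
  have hτK : τ aCandCard 0 = #C := by rw [hτ, sem_frame s3 _ rfl, sem_frame s2 _ rfl, hk]
  have hτC : τ aCand = σ aCand := by
    rw [hτ, sem_frame s3 _ rfl, sem_frame s2 _ rfl, sem_frame s1 _ rfl]
  have hτB : τ aBest = σ aBest := by
    rw [hτ, sem_frame s3 _ rfl, sem_frame s2 _ rfl, sem_frame s1 _ rfl]
  have hτBK : τ aBestCard = σ aBestCard := by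
    rw [hτ, sem_frame s3 _ rfl, sem_frame s2 _ rfl, sem_frame s1 _ rfl]
  -- A truncated difference vanishes exactly if the inequality holds, so `aBad` counts the
  -- violations outside of the candidate.
  have hbad : τ aBad 0 = 0 ↔ ∀ v < n, v ∉ C → nb H (range n) v * #C ≤ nb H C v * (n - 1) := by
    rw [hτ, hs3, sem_count h2.input.size (by decide) (by decide) (by decide) rfl rfl rfl]
    simp only [Memory.write_apply, Expr.eval]
    simp only [he3, Expr.eval, Memory.write_apply]
    simp only [Nat.reduceEqDiff, false_and, if_false, if_true, and_self, card_eq_zero,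
      filter_eq_empty_iff, mem_range, not_not, h2.input.size]
    refine forall₂_congr fun v hv => ?_
    have e1 : s2.sem (s1.sem σ) aCand = σ aCand := by rw [sem_frame s2 _ rfl, sem_frame s1 _ rfl]
    have e2 : s2.sem (s1.sem σ) aCandCard 0 = #C := by rw [sem_frame s2 _ rfl, hk]
    have e3 := hd v hv
    have e4 := h2.deg v hv
    have e5 := hcand v hv
    simp only [hC, mem_supp, hv, true_and, not_not]
    rw [← hC]
    simp [e1, e2, e3, e4]
    have : σ aCand v = 0 ∨ σ aCand v = 1 := by omega
    rcases this with h0 | h0 <;> simp [h0, Nat.sub_eq_zero_iff_le]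
  have hsem : consider.sem σ = (cond (.var aBad) skip
      (cond (.mul (.mul (.var aCandCard) (.sub (.sub .size (.const 1)) (.var aCandCard)))
          (.sub (.var aBestCard) (.var aCandCard)))
        (seq (map aI aBest (.read aCand (.var aI))) (store aBestCard (.const 0) (.var aCandCard)))
        skip)).sem τ := rfl
  have hbτ : BestInv n H τ := hb.congr hτB hτBK
  rw [hsem]
  by_cases c1 : (Expr.var aBad).eval τ ≠ 0
  · rw [sem_cond_true c1]
    refine ⟨hbτ, by rw [Stmt.sem, hτBK], fun hg => absurd (hbad.2 hg.sat) c1⟩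
  rw [sem_cond_false c1]
  replace c1 : τ aBad 0 = 0 := by simpa [Expr.eval] using c1
  by_cases c2 : ((((Expr.var aCandCard).mul ((Expr.size.sub (.const 1)).sub (.var aCandCard))).mul
      ((Expr.var aBestCard).sub (.var aCandCard))).eval τ ≠ 0)
  · rw [sem_cond_true c2]
    simp only [Expr.mul_ne, Expr.sub_ne] at c2
    simp only [Expr.eval, hτK, hτBK, h3.input.size] at c2
    obtain ⟨⟨c2, c3⟩, c4⟩ := c2
    simp only [Stmt.sem, Expr.eval]
    have hgood : Good n H C := ⟨supp_subset, by omega, by omega, hbad.1 c1⟩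
    have hmap : ∀ v < n, (map aI aBest (.read aCand (.var aI))).sem τ aBest v = σ aCand v := by
      intro v hv
      rw [sem_map h3.input.size (by decide) (by decide) (by decide) rfl hv]
      simp [Expr.eval, Memory.write_apply, hτC]
    set ρ := (map aI aBest (.read aCand (.var aI))).sem τ with hρ
    have hρK : ρ aCandCard 0 = #C := by
      rw [hρ, sem_frame (map aI aBest (.read aCand (.var aI))) τ rfl, hτK]
    have hsupp : supp n (ρ.write aBestCard 0 (ρ aCandCard 0)) aBest = C := by
      refine supp_congr fun v hv => ?_
      simp [Memory.write_apply, hmap v hv]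
    have hK : (ρ.write aBestCard 0 (ρ aCandCard 0)) aBestCard 0 = #C := by
      simp [Memory.write_apply, hρK]
    have := hgood.card
    refine ⟨⟨by rw [hK]; omega, fun _ => by rw [hsupp, hK]; exact ⟨hgood, rfl⟩⟩, ?_, ?_⟩
    · rw [hK]; omega
    · intro _; rw [hK]
  · rw [sem_cond_false c2, Stmt.sem]
    refine ⟨hbτ, by rw [hτBK], fun hg => ?_⟩
    rw [hτBK]
    by_contra! hlt
    have h5 := hg.pos
    have h6 := hg.card
    simp only [Expr.mul_ne, Expr.sub_ne] at c2
    simp only [Expr.eval, hτK, hτBK, h3.input.size] at c2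
    omega

end RAM

/-! ### Verification of the local search -/

namespace RAM

open PDS Stmt

/-- The vertex `v` may be moved to the other side, where it has `o` neighbours, while it has `s`
neighbours on its own side. -/
def Movable (n : ℕ) (D : Finset ℕ) (s o : ℕ) : Prop := o < s ∨ (2 * #D = n ∧ s = o ∧ s ≠ 0)

/-- The local search is finished. -/
def Finished (n : ℕ) (H : SimpleGraph ℕ) (D : Finset ℕ) : Prop :=
  (∀ v < n, v ∉ D → ¬Movable n D (nb H (range n \ D) v) (nb H D v)) ∧
    ∀ v < n, v ∈ D → ¬Movable n D (nb H D v) (nb H (range n \ D) v)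

theorem Finished.stable {n : ℕ} {H : SimpleGraph ℕ} {D : Finset ℕ} (h : Finished n H D) :
    Stable n H D := by
  intro v hv hvD
  have := h.1 v hv hvD
  unfold Movable at this
  omega

/-- The rule for moves treats both sides alike: exact balance is symmetric, and so are the two
neighbour counts. -/
theorem Finished.stable_compl {n : ℕ} {H : SimpleGraph ℕ} {D : Finset ℕ} (h : Finished n H D)
    (hD : D ⊆ range n) : Stable n H (range n \ D) := by
  intro v hv hvD
  have hvD : v ∈ D := by simpa [hv] using hvD
  have h1 := h.2 v hv hvD
  have h2 := card_sdiff_of_subset hD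
  have h3 := card_le_card hD
  rw [card_range] at h2 h3
  rw [Finset.sdiff_sdiff_eq_self hD]
  unfold Movable at h1
  omega

/-- The arrays of the local search describe `D`. -/
structure SideInv (n : ℕ) (H : SimpleGraph ℕ) (D : Finset ℕ) (σ : Memory) : Prop where
  sub : D ⊆ range n
  pos : 1 ≤ #D
  card : #D < n
  side : ∀ v < n, σ aSide v = if v ∈ D then 1 else 0
  deg : ∀ v < n, σ aSideDeg v = nb H D v

theorem SideInv.congr {n : ℕ} {H : SimpleGraph ℕ} {D : Finset ℕ} {σ τ : Memory}
    (h : SideInv n H D σ) (h1 : τ aSide = σ aSide) (h2 : τ aSideDeg = σ aSideDeg) :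
    SideInv n H D τ :=
  ⟨h.sub, h.pos, h.card, by rw [h1]; exact h.side, by rw [h2]; exact h.deg⟩

theorem initSide_spec {n : ℕ} {H : SimpleGraph ℕ} {σ : Memory} (hn : 3 ≤ n) (h : Input n H σ) :
    SideInv n H {0} (initSide.sem σ) := by
  classical
  set s1 : Stmt := map aI aSide (Expr.eq (.var aI) (.const 0)) with hs1
  set s2 : Stmt := map aI aSideDeg (.coadj (.var aI) (.const 0)) with hs2
  have h1 : Input n H (s1.sem σ) := h.congr (sem_frame _ _ rfl) (sem_frame _ _ rfl)
  have hsem : initSide.sem σ = s2.sem (s1.sem σ) := rfl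
  rw [hsem]
  refine ⟨by simp; omega, by simp, by simp; omega, fun v hv => ?_, fun v hv => ?_⟩
  · rw [sem_frame s2 _ rfl, hs1, sem_map h.size (by decide) (by decide) (by decide) rfl hv]
    simp [Expr.eval, Memory.write_apply]
  · rw [hs2, sem_map h1.size (by decide) (by decide) (by decide) rfl hv, nb_singleton]
    split_ifs with hadj
    · exact (h1.write _ _ (by decide)).coadj_of_adj (j := 0) (by simp [Expr.eval, Memory.write_apply]) rfl
        hv (by omega) hadj
    · exact (h1.write _ _ (by decide)).coadj_of_not_adj (j := 0) (by simp [Expr.eval, Memory.write_apply])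
        rfl hv (by omega) hadj

/-- Moving a vertex to the other side. -/
def toggle (D : Finset ℕ) (f : ℕ) : Finset ℕ := if f ∈ D then D.erase f else insert f D

theorem mem_toggle {D : Finset ℕ} {f v : ℕ} :
    v ∈ toggle D f ↔ if v = f then f ∉ D else v ∈ D := by
  unfold toggle
  split_ifs with h1 h2 h2 <;> simp [*]

theorem nb_toggle {H : SimpleGraph ℕ} {D : Finset ℕ} {f v : ℕ} [Decidable (H.Adj v f)] :
    nb H (toggle D f) v = if H.Adj v f then (if f ∈ D then nb H D v - 1 else nb H D v + 1)
      else nb H D v := by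
  unfold toggle
  by_cases h : f ∈ D
  · have := nb_insert (H := H) (v := v) (notMem_erase f D)
    rw [insert_erase h] at this
    simp only [h, if_true, this]
    split_ifs <;> omega
  · simp only [h, if_false, nb_insert h]
    split_ifs <;> omega

/-- The counts are updated in place, so that a move takes linear time. The side of `f` changes only
after the loop, whose body consults it to decide between increment and decrement. -/
theorem moveSide_spec {n a b : ℕ} {H : SimpleGraph ℕ} {σ : Memory} {D : Finset ℕ}
    (h : Ctx n H a b σ) (hs : SideInv n H D σ) (hf : σ aFlip 0 < n) :
    (∀ v < n, moveSide.sem σ aSide v = if v ∈ toggle D (σ aFlip 0) then 1 else 0) ∧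
      ∀ v < n, moveSide.sem σ aSideDeg v = nb H (toggle D (σ aFlip 0)) v := by
  classical
  set f := σ aFlip 0 with hfdef
  set body : Stmt := cond (.coadj (.var aI) (.var aFlip))
      (cond (.read aSide (.var aFlip))
        (store aSideDeg (.var aI) (.sub (.read aSideDeg (.var aI)) (.const 1)))
        (inc aSideDeg (.var aI))) skip with hbody
  have hloop := forN_induction (p := body) (I := aI) h.input.size (by decide) rfl
    (fun k τ => (∀ x, x ≠ aSideDeg → x ≠ aI → τ x = σ x) ∧
      ∀ v < n, τ aSideDeg v = if v < k then nb H (toggle D f) v else nb H D v) ?_ ?_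
  · set τ := (forN aI body).sem σ with hτ
    obtain ⟨h1, h2⟩ := hloop
    have hsem : moveSide.sem σ = τ.write aSide (τ aFlip 0) (1 - τ aSide (τ aFlip 0)) := rfl
    rw [hsem, h1 aFlip (by decide) (by decide), h1 aSide (by decide) (by decide), ← hfdef]
    refine ⟨fun v hv => ?_, fun v hv => ?_⟩
    · rw [Memory.write_apply, h1 aSide (by decide) (by decide), hs.side v hv, hs.side f hf]
      simp only [true_and, mem_toggle]
      by_cases hvf : v = f <;> by_cases hfD : f ∈ D <;> simp [hvf, hfD]
    · rw [Memory.write_of_ne _ _ _ (by decide), h2 v hv, if_pos hv]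
  · refine ⟨fun x _ hx => σ.write_of_ne _ _ hx, fun v hv => ?_⟩
    rw [σ.write_of_ne _ _ (by decide), hs.deg v hv]; simp
  · rintro k τ hk h0 hkI ⟨h1, h2⟩
    have hin : Input n H τ := h.input.congr (h1 0 (by decide) (by decide))
      (h1 1 (by decide) (by decide))
    have hfl : (Expr.var aFlip).eval τ = f := by
      simp [Expr.eval, h1 aFlip (by decide) (by decide), hfdef]
    have hkv : (Expr.var aI).eval τ = k := by simpa [Expr.eval] using hkI
    have hside : (Expr.read aSide (.var aFlip)).eval τ = if f ∈ D then 1 else 0 := by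
      simp only [Expr.eval] at hfl ⊢
      rw [hfl, h1 aSide (by decide) (by decide), hs.side f hf]
    have hdk : τ aSideDeg k = nb H D k := by rw [h2 k hk]; simp
    have hbsem : body.sem τ = τ.write aSideDeg k (nb H (toggle D f) k) := by
      by_cases hadj : H.Adj k f
      · rw [hbody, sem_cond_true ((hin.coadj_ne hkv hfl hk hf).2 hadj), nb_toggle, if_pos hadj]
        by_cases hfD : f ∈ D
        · rw [sem_cond_true (by simp [hside, hfD])]
          simp only [Stmt.sem, hkv, hfD, if_true]
          simp [Expr.eval, hkI, hdk]
        · rw [sem_cond_false (by simp [hside, hfD])]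
          simp only [Stmt.sem, hkv, hfD, if_false]
          -- The guard of `inc` does not interfere, as `D` has fewer than `n` elements.
          have hlt : nb H D k < n := nb_le_card.trans_lt hs.card
          rw [if_pos (by rw [hdk, h0]; exact hlt), hdk]
      · rw [hbody, sem_cond_false (by rw [hin.coadj_ne hkv hfl hk hf]; exact hadj), nb_toggle,
          if_neg hadj, Stmt.sem, ← hdk]
        funext x j
        rw [Memory.write_apply]
        split_ifs with hx
        · rw [hx.1, hx.2]
        · rfl
    rw [hbsem]
    refine ⟨fun x hx hxI => ?_, fun v hv => ?_⟩
    · rw [Memory.write_of_ne _ _ _ hxI, Memory.write_of_ne _ _ _ hx, h1 x hx hxI]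
    · rw [Memory.write_of_ne _ _ _ (by decide), Memory.write_apply]
      by_cases hvk : v = k
      · simp [hvk]
      · simp only [true_and, hvk, if_false, h2 v hv]
        have : v < k + 1 ↔ v < k := by omega
        simp only [this]

/-- A movable vertex has a neighbour on its own side. Hence no side is ever emptied, and every move
raises the potential; if the search for one fails, both sides are stable. -/
theorem searchStep_spec {n a b : ℕ} {H : SimpleGraph ℕ} {σ : Memory} {D : Finset ℕ}
    (h : Ctx n H a b σ) (hs : SideInv n H D σ) :
    ∃ D', SideInv n H D' (searchStep.sem σ) ∧
      ((D' = D ∧ Finished n H D) ∨ (¬Finished n H D ∧ potential n H D < potential n H D')) := by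
  classical
  set s1 : Stmt := count aI aSideCard (.const 0) (.read aSide (.var aI)) with hs1
  set s2 : Stmt := find aI aFlip flippable with hs2
  have h1 : Ctx n H a b (s1.sem σ) := h.sem _ rfl
  have h2 : Ctx n H a b (s2.sem (s1.sem σ)) := h1.sem _ rfl
  have hk : s1.sem σ aSideCard 0 = #D := by
    rw [hs1, sem_count h.input.size (by decide) (by decide) (by decide) rfl rfl rfl]
    simp [Memory.write_apply, Expr.eval]
    refine card_eq_card hs.sub fun j hj => ?_
    rw [hs.side j hj]; simp
  set ρ := s1.sem σ with hρ
  have hsρ : SideInv n H D ρ := hs.congr (sem_frame s1 _ rfl) (sem_frame s1 _ rfl)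
  set τ := s2.sem ρ with hτ
  have hsτ : SideInv n H D τ := hsρ.congr (sem_frame s2 _ rfl) (sem_frame s2 _ rfl)
  have hsem : searchStep.sem σ = (cond (.sub .size (.var aFlip)) moveSide skip).sem τ := rfl
  have hflip : ∀ v < n, flippable.eval (ρ.write aI 0 v) ≠ 0 ↔
      if v ∈ D then Movable n D (nb H D v) (nb H (range n \ D) v)
      else Movable n D (nb H (range n \ D) v) (nb H D v) := by
    intro v hv
    have e1 := hsρ.side v hv
    have e2 := hsρ.deg v hv
    have e3 := h1.deg v hv
    have e4 := nb_add_compl (H := H) hs.sub v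
    have e5 := h1.input.size
    simp only [flippable, sameSide, otherSide, Expr.eval, Expr.eval_eq, Memory.write_apply]
    simp [e1, e2, e3, e5, hk]
    have e6 : nb H (range n) v - nb H D v = nb H (range n \ D) v := by omega
    rw [e6]
    unfold Movable
    by_cases hvD : v ∈ D
    · simp [hvD]
      by_cases he : nb H D v = nb H (range n \ D) v
      · simp [he, two_mul]
      · simp [he]; omega
    · simp [hvD]
      by_cases he : nb H (range n \ D) v = nb H D v
      · simp [he, two_mul]
      · simp [he]; omega
  have hfind := findLast_spec (fun j => flippable.eval (ρ.write aI 0 j) ≠ 0) n n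
  have hτf : τ aFlip 0 = findLast (fun j => flippable.eval (ρ.write aI 0 j) ≠ 0) n n := by
    rw [hτ, hs2, sem_find h1.input.size (by decide) (by decide) (by decide) rfl]
    simp [Memory.write_apply]
  rw [← hτf] at hfind
  set f := τ aFlip 0 with hf
  rcases hfind with ⟨hfn, hfm⟩ | ⟨hfn, hno⟩
  · rw [hsem, sem_cond_true (by rw [Expr.sub_ne]; simp [Expr.eval, h2.input.size, ← hf, hfn])]
    have hmove := moveSide_spec h2 hsτ (by rw [← hf]; exact hfn)
    rw [← hf] at hmove
    rw [hflip f hfn] at hfm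
    -- A movable vertex of `D` has a neighbour in `D` other than itself, so `D` stays nonempty
    -- without it; the next bound is its analogue for the other side.
    have hnb1 : nb H D f ≤ #(D.erase f) := by
      refine card_le_card fun x hx => ?_
      obtain ⟨hx, hfx⟩ := mem_filter.1 hx
      exact mem_erase.2 ⟨hfx.ne', hx⟩
    have hnb2 : nb H (range n \ D) f ≤ #((range n \ D).erase f) := by
      refine card_le_card fun x hx => ?_
      obtain ⟨hx, hfx⟩ := mem_filter.1 hx
      exact mem_erase.2 ⟨hfx.ne', hx⟩
    have hcD := card_sdiff_of_subset hs.sub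
    rw [card_range] at hcD
    have hpos := hs.pos
    have hlt := hs.card
    refine ⟨toggle D f, ⟨?_, ?_, ?_, hmove.1, hmove.2⟩, .inr ⟨?_, ?_⟩⟩
    · intro v hv
      rw [mem_toggle] at hv
      split_ifs at hv with hvf
      · rw [hvf]; simpa using hfn
      · exact hs.sub hv
    · unfold toggle
      split_ifs at hfm ⊢ with hfD
      · unfold Movable at hfm; omega
      · exact card_pos.2 ⟨f, mem_insert_self _ _⟩
    · unfold toggle
      split_ifs at hfm ⊢ with hfD
      · exact (card_le_card (erase_subset _ _)).trans_lt hlt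
      · rw [card_insert_of_notMem hfD]
        rw [card_erase_of_mem (by simp [hfn, hfD])] at hnb2
        unfold Movable at hfm; omega
    · intro hfin
      split_ifs at hfm with hfD
      exacts [hfin.2 f hfn hfD hfm, hfin.1 f hfn hfD hfm]
    · unfold toggle
      split_ifs at hfm ⊢ with hfD
      · exact potential_erase hfD hfn (by unfold Movable at hfm; omega)
      · exact potential_insert hfD hfn (by unfold Movable at hfm; omega)
  · rw [hsem, sem_cond_false (by rw [Expr.sub_ne]; simp [Expr.eval, h2.input.size, ← hf, hfn])]
    refine ⟨D, hsτ, .inl ⟨rfl, fun v hv hvD => ?_, fun v hv hvD => ?_⟩⟩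
    · have := hno v hv
      rwa [hflip v hv, if_neg hvD] at this
    · have := hno v hv
      rwa [hflip v hv, if_pos hvD] at this

theorem rep_searchStep_spec {n a b : ℕ} {H : SimpleGraph ℕ} {σ : Memory} {m : ℕ} :
    ∀ k, Ctx n H a b σ → (∃ D, SideInv n H D σ ∧ (Finished n H D ∨ m ≤ potential n H D)) →
      Ctx n H a b ((rep k searchStep).sem σ) ∧ ∃ D, SideInv n H D ((rep k searchStep).sem σ) ∧
        (Finished n H D ∨ m + k ≤ potential n H D)
  | 0, h, hs => ⟨h, hs⟩
  | k + 1, h, hs => by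
    obtain ⟨h1, D, h2, h3⟩ := rep_searchStep_spec k h hs
    refine ⟨h1.sem searchStep rfl, ?_⟩
    obtain ⟨D', h4, h5⟩ := searchStep_spec h1 h2
    refine ⟨D', h4, ?_⟩
    rcases h5 with ⟨rfl, h5⟩ | ⟨h5, h6⟩
    · exact .inl h5
    · exact .inr (by have := h3.resolve_left h5; omega)

/-- After `k` rounds of nine steps the search is finished or the potential is at least `9 * k`. For
`k = n` the latter contradicts `potential_le`. -/
theorem localSearch_spec {n a b : ℕ} {H : SimpleGraph ℕ} {σ : Memory} (hn : 3 ≤ n)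
    (hl : LowGraph n H a b) (h : Ctx n H a b σ) :
    ∃ D, SideInv n H D (localSearch.sem σ) ∧ Finished n H D := by
  have h1 : Ctx n H a b (initSide.sem σ) := h.sem _ rfl
  have hs := initSide_spec hn h.input
  have hloop := forN_induction (p := rep 9 searchStep) (I := aJ) h1.input.size (by decide) rfl
    (fun k τ => Ctx n H a b τ ∧ ∃ D, SideInv n H D τ ∧
      (Finished n H D ∨ 9 * k ≤ potential n H D)) ?_ ?_
  · obtain ⟨-, D, h2, h3⟩ := hloop
    refine ⟨D, h2, h3.resolve_right fun h4 => ?_⟩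
    have := potential_le hl h2.sub
    omega
  · exact ⟨h1.write _ _ (by decide), {0}, hs.congr (Memory.write_of_ne _ _ _ (by decide))
      (Memory.write_of_ne _ _ _ (by decide)), .inr (by omega)⟩
  · rintro k τ hk h0 hkI ⟨h2, h3⟩
    obtain ⟨h4, D, h5, h6⟩ := rep_searchStep_spec 9 h2 h3
    exact ⟨h4.write _ _ (by decide), D, h5.congr (Memory.write_of_ne _ _ _ (by decide))
      (Memory.write_of_ne _ _ _ (by decide)), h6.imp_right fun h7 => by omega⟩

/-- The local search finds a good set with at most `n / 2` vertices. -/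
theorem considerSides_spec {n a b : ℕ} {H : SimpleGraph ℕ} {σ : Memory} (hn : 3 ≤ n)
    (hl : LowGraph n H a b) (h : Ctx n H a b σ) (hb : BestInv n H σ) :
    Ctx n H a b (considerSides.sem σ) ∧ BestInv n H (considerSides.sem σ) ∧
      2 * considerSides.sem σ aBestCard 0 ≤ n := by
  obtain ⟨D, hs, hfin⟩ := localSearch_spec hn hl h
  set s2 : Stmt := map aI aCand (.read aSide (.var aI)) with hs2
  set s4 : Stmt := map aI aCand (.sub (.const 1) (.read aSide (.var aI))) with hs4
  set σ1 := localSearch.sem σ with hσ1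
  set σ2 := s2.sem σ1 with hσ2
  set σ3 := consider.sem σ2 with hσ3
  set σ4 := s4.sem σ3 with hσ4
  have hsem : considerSides.sem σ = consider.sem σ4 := rfl
  have c1 : Ctx n H a b σ1 := h.sem _ rfl
  have c2 : Ctx n H a b σ2 := c1.sem _ rfl
  have c3 : Ctx n H a b σ3 := c2.sem _ rfl
  have c4 : Ctx n H a b σ4 := c3.sem _ rfl
  have b2 : BestInv n H σ2 := hb.congr
    ((sem_frame s2 σ1 rfl).trans (sem_frame localSearch σ rfl))
    ((sem_frame s2 σ1 rfl).trans (sem_frame localSearch σ rfl))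
  have v2 : ∀ v < n, σ2 aCand v = if v ∈ D then 1 else 0 := fun v hv => by
    rw [hσ2, hs2, sem_map c1.input.size (by decide) (by decide) (by decide) rfl hv]
    simp [Expr.eval, Memory.write_apply, hs.side v hv]
  have hsupp2 : supp n σ2 aCand = D := by
    ext v
    rw [mem_supp]
    constructor
    · rintro ⟨hv, hne⟩
      by_contra hvD
      exact hne (by rw [v2 v hv, if_neg hvD])
    · intro hvD
      have hv := mem_range.1 (hs.sub hvD)
      exact ⟨hv, by rw [v2 v hv, if_pos hvD]; simp⟩
  obtain ⟨b3, -, g3⟩ := consider_spec c2 b2 fun v hv => by rw [v2 v hv]; split_ifs <;> simp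
  have b4 : BestInv n H σ4 := b3.congr (sem_frame s4 σ3 rfl) (sem_frame s4 σ3 rfl)
  have v4 : ∀ v < n, σ4 aCand v = if v ∈ D then 0 else 1 := fun v hv => by
    rw [hσ4, hs4, sem_map c3.input.size (by decide) (by decide) (by decide) rfl hv]
    have e1 : σ3 aSide = σ1 aSide := (sem_frame consider σ2 rfl).trans (sem_frame s2 σ1 rfl)
    have e2 := hs.side v hv
    simp only [Expr.eval, Memory.write_apply]
    simp [e1, e2]
    split_ifs <;> rfl
  have hsupp4 : supp n σ4 aCand = range n \ D := by
    ext v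
    rw [mem_supp, mem_sdiff, mem_range]
    refine and_congr_right fun hv => ?_
    rw [v4 v hv]
    split_ifs with hvD <;> simp [hvD]
  obtain ⟨b5, l5, g5⟩ := consider_spec c4 b4 fun v hv => by rw [v4 v hv]; split_ifs <;> simp
  rw [hsem]
  refine ⟨c4.sem _ rfl, b5, ?_⟩
  have hcD := card_sdiff_of_subset hs.sub
  rw [card_range] at hcD
  have hpos := hs.pos
  have hlt := hs.card
  by_cases hsmall : 2 * #D ≤ n
  · have h6 := g3 (by rw [hsupp2]; exact hfin.stable.good hs.sub hn hpos hsmall)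
    rw [hsupp2, ← hσ3] at h6
    have h7 : σ4 aBestCard = σ3 aBestCard := sem_frame s4 σ3 rfl
    rw [h7] at l5
    omega
  · have h6 := g5 (by
      rw [hsupp4]
      exact (hfin.stable_compl hs.sub).good sdiff_subset hn (by omega) (by omega))
    rw [hsupp4] at h6
    omega

end RAM

namespace PDS

/-! ### Choosing between the ends of the components -/

section Shift

variable {n a b : ℕ} {H : SimpleGraph ℕ} {X : Finset ℕ} {comp pos last s : ℕ → ℕ} {cur c : ℕ}

local notation "𝓤" => targets n H a b X

theorem LowGraph.nb_targets_le (hl : LowGraph n H a b) : ∀ v ∈ 𝓤, nb H 𝓤 v ≤ 2 := fun v hv =>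
  (nb_mono targets_subset).trans (hl.low v (ne_of_mem_targets hv).1 (ne_of_mem_targets hv).2)

theorem notMem_of_adj {v z : ℕ} (hv : v ∈ 𝓤) (hvz : H.Adj v z) : z ∉ X := by
  simp only [targets, mem_filter] at hv
  exact fun hz => hv.2.2.2.2 z hz hvz

theorem name_mem (hw : Walk H 𝓤 𝓤 comp pos last cur) (hc : c ∈ image comp 𝓤) :
    c ∈ cls 𝓤 comp c ∧ pos c = 0 := by
  obtain ⟨v, hv, rfl⟩ := mem_image.1 hc
  exact ⟨mem_cls.2 ⟨hw.comp_mem v hv, hw.comp_comp v hv⟩, hw.pos_comp v hv⟩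

theorem last_mem (hw : Walk H 𝓤 𝓤 comp pos last cur) (hc : c ∈ image comp 𝓤) :
    last c ∈ cls 𝓤 comp c := by
  obtain ⟨v, hv, rfl⟩ := mem_image.1 hc
  exact mem_cls.2 ⟨hw.last_mem v hv, hw.comp_last v hv⟩

theorem mem_image_of_cls {v : ℕ} (hv : v ∈ cls 𝓤 comp c) : c ∈ image comp 𝓤 := by
  obtain ⟨h1, rfl⟩ := mem_cls.1 hv
  exact mem_image_of_mem _ h1

theorem eq_name_or_last (hl : LowGraph n H a b) (hw : Walk H 𝓤 𝓤 comp pos last cur) {v z : ℕ}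
    (hz : z = a ∨ z = b) (hv : v ∈ cls 𝓤 comp c) (hvz : H.Adj v z) : v = c ∨ v = last c := by
  have hd := hw.decomp hl.nb_targets_le
  have hc := mem_image_of_cls hv
  have h1 := hw.pos_last hl.nb_targets_le hc
  obtain ⟨h2, h3⟩ := name_mem hw hc
  rcases pos_eq_of_adj hl hd hz hv hvz with h | h
  · exact .inl (hd.injOn c hv h2 (by rw [h, h3]))
  · exact .inr (hd.injOn c hv (last_mem hw hc) (by omega))

theorem mem_sel_ends (hl : LowGraph n H a b) (hw : Walk H 𝓤 𝓤 comp pos last cur) {r : ℕ}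
    (hc : c ∈ image comp 𝓤) (hm : #(cls 𝓤 comp c) % 3 = 2) :
    (c ∈ sel 𝓤 comp pos c r ↔ r = 0) ∧ (last c ∈ sel 𝓤 comp pos c r ↔ r = 1) := by
  have h1 := hw.pos_last hl.nb_targets_le hc
  obtain ⟨h2, h3⟩ := name_mem hw hc
  have h4 := last_mem hw hc
  rw [mem_sel, mem_sel, h3]
  rw [mem_cls] at h2 h4
  have : pos (last c) % 3 = 1 := by omega
  simp only [h2, h4, this, true_and, Nat.zero_mod]
  exact ⟨eq_comm, eq_comm⟩

/-- One end of the component is adjacent to `a` and the other one to `b`, and a smallest dominating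
set contains only one of them. -/
def Flexible (H : SimpleGraph ℕ) (U : Finset ℕ) (a b : ℕ) (comp last : ℕ → ℕ) (c : ℕ) : Prop :=
  c ∈ image comp U ∧ #(cls U comp c) % 3 = 2 ∧
    ((H.Adj c a ∧ H.Adj (last c) b) ∨ (H.Adj c b ∧ H.Adj (last c) a))

/-- The invariant for the adjustment of the choices in the components `0, …, k - 1`. -/
structure ShiftInv (n : ℕ) (H : SimpleGraph ℕ) (a b : ℕ) (X : Finset ℕ) (comp pos last : ℕ → ℕ)
    (k : ℕ) (s : ℕ → ℕ) : Prop where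
  valid : ∀ c ∈ image comp (targets n H a b X), ValidShift #(cls (targets n H a b X) comp c) (s c)
  hits_both : Hits H (targets n H a b X) comp pos s ({a, b} \ X)
  hits_right : b ∉ X → Hits H (targets n H a b X) comp pos s {b} ∨
    (a ∉ X ∧ nb H (X ∪ selection (targets n H a b X) comp pos s) a * (n - 1) <
      nb H (range n) a * #(X ∪ selection (targets n H a b X) comp pos s) + (n - 1))
  done : a ∉ X → (∀ c < k, Flexible H (targets n H a b X) a b comp last c → ∃ w ∈ sel (targets n H a b X) comp pos c (s c), H.Adj w a) ∨
    nb H (range n) a * #(X ∪ selection (targets n H a b X) comp pos s) ≤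
      nb H (X ∪ selection (targets n H a b X) comp pos s) a * (n - 1)
  fresh : ∀ c, k ≤ c → Flexible H (targets n H a b X) a b comp last c → ∃ w ∈ sel (targets n H a b X) comp pos c (s c), H.Adj w b

/-- The initial choice prefers ends adjacent to `b`, and takes an end adjacent to `a` if there is no
such end. So every component with a choice hits `b` whenever possible, and hits `a` or `b` whenever
possible. -/
theorem shiftInv_zero (hl : LowGraph n H a b) (hw : Walk H 𝓤 𝓤 comp pos last cur)
    (hs : ∀ c ∈ image comp 𝓤, (#(cls 𝓤 comp c) % 3 = 0 ∧ s c = 1) ∨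
      (#(cls 𝓤 comp c) % 3 = 1 ∧ s c = 0) ∨ (#(cls 𝓤 comp c) % 3 = 2 ∧
        ((s c = 1 ∧ ¬H.Adj c b ∧ (H.Adj (last c) a ∨ H.Adj (last c) b)) ∨
          (s c = 0 ∧ (H.Adj c b ∨ (¬H.Adj (last c) a ∧ ¬H.Adj (last c) b)))))) :
    ShiftInv n H a b X comp pos last 0 s := by
  have hb : Hits H 𝓤 comp pos s {b} := by
    rintro c hm ⟨v, hv, z, hz, hvz⟩
    obtain rfl := mem_singleton.1 hz
    have hc := mem_image_of_cls hv
    have hends := mem_sel_ends hl hw (r := s c) hc hm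
    have hvc := eq_name_or_last hl hw (.inr rfl) hv hvz
    rcases hs c hc with h | h | ⟨-, ⟨h1, h2, -⟩ | ⟨h1, h2⟩⟩
    · omega
    · omega
    · rcases hvc with rfl | rfl
      · exact absurd hvz h2
      · exact ⟨_, hends.2.2 h1, z, by simp, hvz⟩
    · rcases hvc with rfl | rfl
      · exact ⟨_, hends.1.2 h1, z, by simp, hvz⟩
      · exact ⟨_, hends.1.2 h1, z, by simp, h2.resolve_right fun h => h.2 hvz⟩
  refine ⟨fun c hc => ?_, ?_, fun _ => .inl hb, fun _ => .inl (by simp), ?_⟩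
  · have := hs c hc
    unfold ValidShift
    omega
  · rintro c hm ⟨v, hv, z, hz, hvz⟩
    have hc := mem_image_of_cls hv
    have hends := mem_sel_ends hl hw (r := s c) hc hm
    have hzab : z = a ∨ z = b := by simpa using (mem_sdiff.1 hz).1
    have hvc := eq_name_or_last hl hw hzab hv hvz
    have hin : ∀ w ∈ cls 𝓤 comp c, ∀ y, y = a ∨ y = b → H.Adj w y → y ∈ ({a, b} : Finset ℕ) \ X :=
      fun w hw y hy hwy => mem_sdiff.2 ⟨by simpa using hy, notMem_of_adj (mem_cls.1 hw).1 hwy⟩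
    have hcc := (name_mem hw hc).1
    have hlc := last_mem hw hc
    rcases hs c hc with h | h | ⟨-, ⟨h1, -, h2⟩ | ⟨h1, h2⟩⟩
    · omega
    · omega
    · rcases h2 with h2 | h2
      · exact ⟨_, hends.2.2 h1, a, hin _ hlc a (.inl rfl) h2, h2⟩
      · exact ⟨_, hends.2.2 h1, b, hin _ hlc b (.inr rfl) h2, h2⟩
    · rcases h2 with h2 | h2
      · exact ⟨_, hends.1.2 h1, b, hin _ hcc b (.inr rfl) h2, h2⟩
      · refine ⟨_, hends.1.2 h1, z, hz, ?_⟩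
        rcases hvc with rfl | rfl
        · exact hvz
        · rcases hzab with rfl | rfl
          exacts [absurd hvz h2.1, absurd hvz h2.2]
  · rintro c - ⟨hc, hm, hf⟩
    have : ∃ v ∈ cls 𝓤 comp c, ∃ z ∈ ({b} : Finset ℕ), H.Adj v z := by
      rcases hf with hf | hf
      exacts [⟨_, last_mem hw hc, b, by simp, hf.2⟩, ⟨_, (name_mem hw hc).1, b, by simp, hf.1⟩]
    obtain ⟨w, hw, z, hz, hwz⟩ := hb c hm this
    obtain rfl := mem_singleton.1 hz
    exact ⟨w, hw, hwz⟩

/-- A choice is left with `b` only if there is nothing to trade or `a` is already satisfied. -/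
theorem ShiftInv.skip {k : ℕ} (h : ShiftInv n H a b X comp pos last k s)
    (hk : Flexible H 𝓤 a b comp last k →
      nb H (range n) a * #(X ∪ selection 𝓤 comp pos s) ≤
        nb H (X ∪ selection 𝓤 comp pos s) a * (n - 1)) :
    ShiftInv n H a b X comp pos last (k + 1) s := by
  refine ⟨h.valid, h.hits_both, h.hits_right, fun ha => ?_, fun c hc => h.fresh c (by omega)⟩
  by_cases hf : Flexible H 𝓤 a b comp last k
  · exact .inr (hk hf)
  · refine (h.done ha).imp_left fun h1 c hc hcf => ?_
    rcases Nat.lt_succ_iff_lt_or_eq.1 hc with hc | rfl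
    exacts [h1 c hc hcf, absurd hcf hf]

/-- By `fresh` the component `k` still contributes its end adjacent to `b`; switching the shift
selects the other end `e`, which is adjacent to `a`. All sizes stay the same and `a` gains at most
one neighbour. As `a` was unsatisfied before, it would be so again with one neighbour less, which is
the second alternative of `hits_right`. -/
theorem ShiftInv.flip (hl : LowGraph n H a b) (hw : Walk H 𝓤 𝓤 comp pos last cur)
    (hX : X ⊆ {a, b}) {k : ℕ}
    (h : ShiftInv n H a b X comp pos last k s) (hk : Flexible H 𝓤 a b comp last k)
    (hlt : nb H (X ∪ selection 𝓤 comp pos s) a * (n - 1) <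
      nb H (range n) a * #(X ∪ selection 𝓤 comp pos s)) :
    ShiftInv n H a b X comp pos last (k + 1) (Function.update s k (1 - s k)) := by
  classical
  have hd := hw.decomp hl.nb_targets_le
  obtain ⟨hc, hm, hf⟩ := id hk
  have hcc := (name_mem hw hc).1
  have hlc := last_mem hw hc
  have hcU := (mem_cls.1 hcc).1
  have hlU := (mem_cls.1 hlc).1
  have haX : a ∉ X := by
    rcases hf with hf | hf
    exacts [notMem_of_adj hcU hf.1, notMem_of_adj hlU hf.2]
  have hbX : b ∉ X := by
    rcases hf with hf | hf
    exacts [notMem_of_adj hlU hf.2, notMem_of_adj hcU hf.1]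
  have hm2 : 2 ≤ #(cls 𝓤 comp k) := by omega
  set s' := Function.update s k (1 - s k) with hs'
  have hs'k : s' k = 1 - s k := by simp [hs']
  have hs'c : ∀ c, c ≠ k → s' c = s c := fun c hc => by simp [hs', hc]
  have hends := mem_sel_ends hl hw (r := s k) hc hm
  have hends' := mem_sel_ends hl hw (r := s' k) hc hm
  have hvk : s k ≤ 1 := by
    have := h.valid k hc
    unfold ValidShift at this
    omega
  obtain ⟨e, he, hea, hnot⟩ : ∃ e ∈ sel 𝓤 comp pos k (s' k), H.Adj e a ∧
      ∀ v ∈ sel 𝓤 comp pos k (s' k), H.Adj v a → v = e := by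
    obtain ⟨w, hw', hwb⟩ := h.fresh k le_rfl hk
    have hwc : w ∈ cls 𝓤 comp k := (mem_filter.1 hw').1
    have huniq : ∀ e, (e = k ∨ e = last k) → e ∈ sel 𝓤 comp pos k (s' k) →
        ∀ v ∈ sel 𝓤 comp pos k (s' k), H.Adj v a → v = e := by
      intro e he hes v hv hva
      have hvc : v ∈ cls 𝓤 comp k := (mem_filter.1 hv).1
      rcases eq_name_or_last hl hw (.inl rfl) hvc hva with rfl | rfl <;> rcases he with rfl | rfl
      · rfl
      · have := hends'.1.1 hv
        have := hends'.2.1 hes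
        omega
      · have := hends'.2.1 hv
        have := hends'.1.1 hes
        omega
      · rfl
    rcases eq_name_or_last hl hw (.inr rfl) hwc hwb with rfl | rfl
    · have h0 := hends.1.1 hw'
      have hes := hends'.2.2 (by omega)
      refine ⟨_, hes, ?_, huniq _ (.inr rfl) hes⟩
      rcases hf with hf | hf
      exacts [(not_adj_both hl hd hcc hm2 hf.1 hwb).elim, hf.2]
    · have h0 := hends.2.1 hw'
      have hes := hends'.1.2 (by omega)
      refine ⟨_, hes, ?_, huniq _ (.inl rfl) hes⟩
      rcases hf with hf | hf
      exacts [hf.1, (not_adj_both hl hd hlc hm2 hf.2 hwb).elim]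
  have hvalid : ∀ c ∈ image comp 𝓤, ValidShift #(cls 𝓤 comp c) (s' c) := by
    intro c hc'
    by_cases hck : c = k
    · subst hck
      exact .inr (.inr ⟨hm, by omega⟩)
    · rw [hs'c c hck]; exact h.valid c hc'
  have hcard : #(X ∪ selection 𝓤 comp pos s') = #(X ∪ selection 𝓤 comp pos s) := by
    rw [card_union_of_disjoint (disjoint_of_ne hX fun x hx => Candidate.ne_of_mem hx),
      card_union_of_disjoint (disjoint_of_ne hX fun x hx => Candidate.ne_of_mem hx),
      hd.card_selection hvalid, hd.card_selection h.valid]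
  have hnb : nb H (X ∪ selection 𝓤 comp pos s') a ≤ nb H (X ∪ selection 𝓤 comp pos s) a + 1 := by
    refine le_trans (card_le_card (t := insert e {x ∈ X ∪ selection 𝓤 comp pos s | H.Adj a x})
      fun x hx => ?_) (card_insert_le _ _)
    obtain ⟨hx, hax⟩ := mem_filter.1 hx
    rcases mem_union.1 hx with hx | hx
    · exact mem_insert_of_mem (mem_filter.2 ⟨mem_union_left _ hx, hax⟩)
    · obtain ⟨hxU, hxs⟩ := mem_selection.1 hx
      by_cases hxk : comp x = k
      · rw [hnot x (mem_sel.2 ⟨⟨hxU, hxk⟩, by rw [hxs, hxk]⟩) hax.symm]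
        exact mem_insert_self _ _
      · rw [hs'c _ hxk] at hxs
        exact mem_insert_of_mem (mem_filter.2
          ⟨mem_union_right _ (mem_selection.2 ⟨hxU, hxs⟩), hax⟩)
  refine ⟨hvalid, ?_, fun _ => .inr ⟨haX, ?_⟩, fun ha => .inl fun c hc' hcf => ?_,
    fun c hc' hcf => ?_⟩
  · intro c hmc hv
    by_cases hck : c = k
    · subst hck
      exact ⟨e, he, a, by simp [haX], hea⟩
    · rw [hs'c c hck]; exact h.hits_both c hmc hv
  · rw [hcard]
    calc nb H (X ∪ selection 𝓤 comp pos s') a * (n - 1)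
        ≤ (nb H (X ∪ selection 𝓤 comp pos s) a + 1) * (n - 1) := Nat.mul_le_mul_right _ hnb
      _ < _ := by rw [add_mul, one_mul]; omega
  · by_cases hck : c = k
    · subst hck; exact ⟨e, he, hea⟩
    · rw [hs'c c hck]
      exact (h.done ha).resolve_right (by omega) c (by omega) hcf
  · rw [hs'c c (by omega)]
    exact h.fresh c (by omega) hcf

/-- If all flexible components give to `a`, then `a` is hit wherever possible: a component with a
neighbour of `a` whose selection hits only `b` would have one end adjacent to each of them and so be
flexible. -/
theorem ShiftInv.candidate (hl : LowGraph n H a b) (hw : Walk H 𝓤 𝓤 comp pos last cur)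
    (h : ShiftInv n H a b X comp pos last n s) :
    Candidate n H a b X (X ∪ selection 𝓤 comp pos s) comp pos s := by
  have hd := hw.decomp hl.nb_targets_le
  refine ⟨hd, h.valid, rfl, h.hits_both, h.hits_right, fun ha => (h.done ha).imp_left ?_⟩
  rintro h1 c hm ⟨v, hv, z, hz, hva⟩
  obtain rfl : a = z := (mem_singleton.1 hz).symm
  obtain ⟨w, hws, y, hy, hwy⟩ := h.hits_both c hm ⟨v, hv, a, by simp [ha], hva⟩
  have hwc : w ∈ cls 𝓤 comp c := (mem_filter.1 hws).1
  have hyab : a = y ∨ b = y := by simpa [eq_comm] using (mem_sdiff.1 hy).1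
  rcases hyab with rfl | rfl
  · exact ⟨w, hws, a, by simp, hwy⟩
  · have hc := mem_image_of_cls hv
    have hcn : c < n := mem_range.1 (targets_subset (mem_cls.1 (name_mem hw hc).1).1)
    suffices hf : Flexible H 𝓤 a b comp last c by
      obtain ⟨x, hx, hxz⟩ := h1 c hcn hf
      exact ⟨x, hx, a, by simp, hxz⟩
    refine ⟨hc, hm, ?_⟩
    have hne : v ≠ w := fun he => not_adj_both hl hd hv (by omega) hva (he ▸ hwy)
    rcases eq_name_or_last hl hw (.inl rfl) hv hva with hv' | hv' <;>
      rcases eq_name_or_last hl hw (.inr rfl) hwc hwy with hw' | hw'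
    · exact absurd (hv'.trans hw'.symm) hne
    · exact .inl ⟨hv' ▸ hva, hw' ▸ hwy⟩
    · exact .inr ⟨hw' ▸ hwy, hv' ▸ hva⟩
    · exact absurd (hv'.trans hw'.symm) hne

end Shift

end PDS

namespace RAM

open PDS Stmt

/-! ### Verification of the walk -/

/-- The subset of `{a, b}` that is given by `x` and `y`. -/
def selected (x y a b : ℕ) : Finset ℕ := (if x = 0 then ∅ else {a}) ∪ (if y = 0 then ∅ else {b})

theorem mem_selected {x y a b v : ℕ} :
    v ∈ selected x y a b ↔ (x ≠ 0 ∧ v = a) ∨ (y ≠ 0 ∧ v = b) := by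
  unfold selected
  split_ifs <;> simp [*]

theorem selected_subset {x y a b : ℕ} : selected x y a b ⊆ {a, b} := by
  intro v hv
  rcases mem_selected.1 hv with h | h <;> simp [h]

/-- The set `U` and the degrees into it have been computed. -/
structure TargetInv (n : ℕ) (H : SimpleGraph ℕ) (U : Finset ℕ) (σ : Memory) : Prop where
  target : ∀ v < n, σ aTarget v ≠ 0 ↔ v ∈ U
  deg : ∀ v < n, σ aTargetDeg v = nb H U v

theorem TargetInv.congr {n : ℕ} {H : SimpleGraph ℕ} {U : Finset ℕ} {σ τ : Memory}
    (h : TargetInv n H U σ) (h1 : τ aTarget = σ aTarget) (h2 : τ aTargetDeg = σ aTargetDeg) :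
    TargetInv n H U τ :=
  ⟨by rw [h1]; exact h.target, by rw [h2]; exact h.deg⟩

theorem initTargets_spec {n a b : ℕ} {H : SimpleGraph ℕ} {σ : Memory} (hl : LowGraph n H a b)
    (h : Ctx n H a b σ) (x y : ℕ) :
    TargetInv n H (targets n H a b (selected x y a b)) ((initTargets x y).sem σ) := by
  classical
  set e1 : Expr := (.sub (.const 1)
      (.add (.add (.add (Expr.eq (.var aI) (.var aA)) (Expr.eq (.var aI) (.var aB)))
          (.sub (.const 1) (.read aDeg (.var aI))))
        (.add (.mul (.const x) (.coadj (.var aI) (.var aA)))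
          (.mul (.const y) (.coadj (.var aI) (.var aB)))))) with he1
  set s1 : Stmt := map aI aTarget e1 with hs1
  set s2 : Stmt := countAll aI aJ aTargetDeg
    (.mul (.read aTarget (.var aJ)) (.coadj (.var aI) (.var aJ))) with hs2
  have hsem : (initTargets x y).sem σ = s2.sem (s1.sem σ) := rfl
  have h1 : Ctx n H a b (s1.sem σ) := h.sem _ rfl
  have ht : ∀ v < n, s1.sem σ aTarget v ≠ 0 ↔ v ∈ targets n H a b (selected x y a b) := by
    intro v hv
    rw [hs1, sem_map h.input.size (by decide) (by decide) (by decide) rfl hv]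
    have hw : Ctx n H a b (σ.write aI 0 v) := h.write _ _ (by decide)
    set ρ := σ.write aI 0 v with hρ
    have hI : ρ aI 0 = v := by simp [hρ, Memory.write_apply]
    have ca := hw.input.coadj_ne (e := .var aI) (f := .var aA) hI hw.left hv hl.a_lt
    have cb := hw.input.coadj_ne (e := .var aI) (f := .var aB) hI hw.right hv hl.b_lt
    have hd := hw.deg v hv
    have hX : (∀ z ∈ selected x y a b, ¬H.Adj v z) ↔
        (x = 0 ∨ ¬H.Adj v a) ∧ (y = 0 ∨ ¬H.Adj v b) := by
      simp only [mem_selected]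
      constructor
      · intro hz
        constructor
        · by_contra! hc; exact hz a (.inl ⟨hc.1, rfl⟩) hc.2
        · by_contra! hc; exact hz b (.inr ⟨hc.1, rfl⟩) hc.2
      · rintro ⟨h1, h2⟩ z (⟨h3, rfl⟩ | ⟨h3, rfl⟩)
        exacts [h1.resolve_left h3, h2.resolve_left h3]
    rw [targets, mem_filter, mem_range, hX, ← ca, ← cb, he1, Expr.sub_ne]
    simp only [Expr.eval, Expr.eval_eq, hI, hd, hw.left, hw.right, Nat.lt_one_iff,
      Nat.add_eq_zero_iff, mul_eq_zero, not_not, hv, true_and]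
    by_cases hva : v = a <;> by_cases hvb : v = b <;> simp [hva, hvb, Nat.pos_iff_ne_zero]
    omega
  rw [hsem]
  refine ⟨by rw [sem_frame s2 _ rfl]; exact ht, fun v hv => ?_⟩
  rw [hs2, sem_countAll h1.input.size (by decide) (by decide) (by decide) (by decide) (by decide)
    (by decide) rfl hv]
  refine card_eq_nb targets_subset fun j hj => ?_
  rw [Expr.mul_ne, ((h1.input.write _ _ (by decide)).write _ _
    (by decide)).coadj_ne (i := v) (j := j) (by simp [Expr.eval, Memory.write_apply])
    (by simp [Expr.eval, Memory.write_apply]) hv hj, ← ht j hj]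
  simp [Expr.eval, Memory.write_apply]

/-- The walks have visited the vertices in `W`. -/
structure WalkInv (n : ℕ) (H : SimpleGraph ℕ) (U W : Finset ℕ) (pos : ℕ → ℕ) (σ : Memory) :
    Prop where
  walk : Walk H U W (σ aComp) pos (σ aLast) (σ aCur 0)
  visited : ∀ v < n, σ aVisited v = 0 ↔ v ∉ W
  res : ∀ v ∈ W, σ aRes v = pos v % 3
  cur : σ aCur 0 ∈ W ∨ σ aCur 0 = n

theorem WalkInv.congr {n : ℕ} {H : SimpleGraph ℕ} {U W : Finset ℕ} {pos : ℕ → ℕ} {σ τ : Memory}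
    (h : WalkInv n H U W pos σ) (h1 : τ aComp = σ aComp) (h2 : τ aLast = σ aLast)
    (h3 : τ aCur = σ aCur) (h4 : τ aVisited = σ aVisited) (h5 : τ aRes = σ aRes) :
    WalkInv n H U W pos τ :=
  ⟨by rw [h1, h2, h3]; exact h.walk, by rw [h4]; exact h.visited, by rw [h5]; exact h.res,
    by rw [h3]; exact h.cur⟩

section

variable {n a b : ℕ} {H : SimpleGraph ℕ} {U W : Finset ℕ} {pos : ℕ → ℕ} {σ : Memory}

theorem unvisited_ne (ht : TargetInv n H U σ) (hw : WalkInv n H U W pos σ) {v : ℕ} (hv : v < n) :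
    unvisited.eval (σ.write aI 0 v) ≠ 0 ↔ v ∈ U ∧ v ∉ W := by
  rw [unvisited, Expr.mul_ne, Expr.sub_ne]
  have h1 := ht.target v hv
  have h2 := hw.visited v hv
  simp [Expr.eval, Memory.write_apply]
  rw [← ne_eq, h1, h2]

/-- The value `n` encodes both the absence of a current vertex and an unsuccessful search. In the
former case the factor `n - cur` vanishes, so the matrix entry read out of range is irrelevant. -/
theorem findNext_spec (hU : U ⊆ range n) (h : Ctx n H a b σ) (ht : TargetInv n H U σ)
    (hw : WalkInv n H U W pos σ) :
    let x := findNext.sem σ aNext 0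
    (x < n ∧ σ aCur 0 ∈ W ∧ x ∈ U ∧ x ∉ W ∧ H.Adj (σ aCur 0) x) ∨
      (x = n ∧ (σ aCur 0 ∈ W → ∀ v ∈ U, v ∉ W → ¬H.Adj (σ aCur 0) v)) := by
  intro x
  set e : Expr := (.mul (.mul (.sub .size (.var aCur)) unvisited) (.coadj (.var aCur) (.var aI)))
    with he
  have hx : x = findLast (fun j => e.eval (σ.write aI 0 j) ≠ 0) n n := by
    change (find aI aNext e).sem σ aNext 0 = _
    rw [sem_find h.input.size (by decide) (by decide) (by decide) rfl]
    simp [Memory.write_apply]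
  have hev : ∀ v < n, e.eval (σ.write aI 0 v) ≠ 0 ↔
      σ aCur 0 ∈ W ∧ (v ∈ U ∧ v ∉ W) ∧ H.Adj (σ aCur 0) v := by
    intro v hv
    rw [he, Expr.mul_ne, Expr.mul_ne, Expr.sub_ne, unvisited_ne ht hw hv]
    have e1 : (Expr.var aCur).eval (σ.write aI 0 v) = σ aCur 0 := by
      simp [Expr.eval, Memory.write_apply]
    have e2 : Expr.size.eval (σ.write aI 0 v) = n := by
      simp [Expr.eval, Memory.write_apply, h.input.size]
    rw [e1, e2]
    have hlt : σ aCur 0 < n ↔ σ aCur 0 ∈ W :=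
      ⟨fun hc => hw.cur.resolve_right hc.ne, fun hc => mem_range.1 (hU (hw.walk.sub hc))⟩
    by_cases hc : σ aCur 0 < n
    · rw [(h.input.write _ _ (by decide)).coadj_ne (i := σ aCur 0) (j := v) e1
        (by simp [Expr.eval, Memory.write_apply]) hc hv, hlt]
      tauto
    · simp [hc, ← hlt]
  rcases findLast_spec (fun j => e.eval (σ.write aI 0 j) ≠ 0) n n with ⟨h1, h2⟩ | ⟨h1, h2⟩ <;>
    rw [← hx] at h1
  · rw [← hx, hev x h1] at h2
    exact .inl ⟨h1, h2.1, h2.2.1.1, h2.2.1.2, h2.2.2⟩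
  · refine .inr ⟨h1, fun hc v hv hvW hcv => ?_⟩
    have hvn := mem_range.1 (hU hv)
    exact h2 v hvn ((hev v hvn).2 ⟨hc, ⟨hv, hvW⟩, hcv⟩)

/-- Vertices with at most one target neighbour come first. A failure of the first search certifies
that all unvisited targets have degree at least two, as `Walk.start` requires for cycles. -/
theorem findStart_spec (hU : U ⊆ range n) (h : Ctx n H a b σ) (ht : TargetInv n H U σ)
    (hw : WalkInv n H U W pos σ) :
    let x := findStart.sem σ aNext 0
    (x < n ∧ x ∈ U ∧ x ∉ W ∧ (nb H U x ≤ 1 ∨ ∀ w ∈ U, w ∉ W → 2 ≤ nb H U w)) ∨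
      (x = n ∧ U ⊆ W) := by
  intro x
  set e : Expr := (.mul unvisited (.sub (.const 2) (.read aTargetDeg (.var aI)))) with he
  set s1 : Stmt := find aI aNext e with hs1
  have hev : ∀ v < n, e.eval (σ.write aI 0 v) ≠ 0 ↔ (v ∈ U ∧ v ∉ W) ∧ nb H U v ≤ 1 := by
    intro v hv
    rw [he, Expr.mul_ne, Expr.sub_ne, unvisited_ne ht hw hv]
    have := ht.deg v hv
    simp [Expr.eval, Memory.write_apply, this]
  set τ := s1.sem σ with hτ
  have hy : τ aNext 0 = findLast (fun j => e.eval (σ.write aI 0 j) ≠ 0) n n := by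
    rw [hτ, hs1, sem_find h.input.size (by decide) (by decide) (by decide) rfl]
    simp [Memory.write_apply]
  have hsem : findStart.sem σ =
    (cond (.sub .size (.var aNext)) skip (find aI aNext unvisited)).sem τ := rfl
  have hτc : Ctx n H a b τ := h.sem _ rfl
  have hspec := findLast_spec (fun j => e.eval (σ.write aI 0 j) ≠ 0) n n
  rw [← hy] at hspec
  rcases hspec with ⟨h1, h2⟩ | ⟨h1, h2⟩
  · have hx : x = τ aNext 0 := by
      change findStart.sem σ aNext 0 = _
      rw [hsem, sem_cond_true (by rw [Expr.sub_ne]; simp [Expr.eval, hτc.input.size, h1]), Stmt.sem]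
    rw [hev _ h1] at h2
    rw [hx]
    exact .inl ⟨h1, h2.1.1, h2.1.2, .inl h2.2⟩
  · have htτ : TargetInv n H U τ := ht.congr (sem_frame s1 _ rfl) (sem_frame s1 _ rfl)
    have hwτ : WalkInv n H U W pos τ := hw.congr (sem_frame s1 _ rfl) (sem_frame s1 _ rfl)
      (sem_frame s1 _ rfl) (sem_frame s1 _ rfl) (sem_frame s1 _ rfl)
    have hx : x = findLast (fun j => unvisited.eval (τ.write aI 0 j) ≠ 0) n n := by
      change findStart.sem σ aNext 0 = _
      rw [hsem, sem_cond_false (by rw [Expr.sub_ne]; simp [Expr.eval, hτc.input.size, h1]),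
        sem_find hτc.input.size (by decide) (by decide) (by decide) rfl]
      simp [Memory.write_apply]
    have hspec := findLast_spec (fun j => unvisited.eval (τ.write aI 0 j) ≠ 0) n n
    rw [← hx] at hspec
    rcases hspec with ⟨h3, h4⟩ | ⟨h3, h4⟩
    · rw [unvisited_ne htτ hwτ h3] at h4
      refine .inl ⟨h3, h4.1, h4.2, .inr fun w hwU hwW => ?_⟩
      by_contra hlt
      have hwn := mem_range.1 (hU hwU)
      exact h2 w hwn ((hev w hwn).2 ⟨⟨hwU, hwW⟩, by omega⟩)
    · refine .inr ⟨h3, fun v hv => ?_⟩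
      by_contra hvW
      have hvn := mem_range.1 (hU hv)
      exact h4 v hvn ((unvisited_ne htτ hwτ hvn).2 ⟨hv, hvW⟩)

theorem visitNext_spec {x : ℕ} (hx : σ aNext 0 = x)
    (hw : Walk H U (insert x W) (σ aComp) pos (Function.update (σ aLast) (σ aComp x) x) x)
    (hv : ∀ v < n, σ aVisited v = 0 ↔ v ∉ W) (hr : ∀ v ∈ insert x W, σ aRes v = pos v % 3) :
    WalkInv n H U (insert x W) pos (visitNext.sem σ) := by
  have hsem : visitNext.sem σ =
      ((σ.write aVisited x 1).write aCur 0 x).write aLast (σ aComp x) x := by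
    simp [visitNext, Stmt.sem, Expr.eval, Memory.write_apply, hx]
  rw [hsem]
  refine ⟨?_, fun v hvn => ?_, fun v hvW => ?_, .inl ?_⟩
  · simpa [Memory.write_array] using hw
  · have := hv v hvn
    by_cases hvx : v = x
    · simp [Memory.write_apply, hvx]
    · simp [Memory.write_apply, hvx, this]
  · simpa [Memory.write_apply] using hr v hvW
  · simp [Memory.write_apply]

/-- The machine has no division, so positions are stored modulo three and advanced by a case
distinction. -/
theorem appendNext_sem {x c : ℕ} (hx : σ aNext 0 = x) (hc : σ aCur 0 = c) (hr : σ aRes c < 3) :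
    appendNext.sem σ = (σ.write aComp x (σ aComp c)).write aRes x ((σ aRes c + 1) % 3) := by
  have h3 : σ aRes c = 0 ∨ σ aRes c = 1 ∨ σ aRes c = 2 := by omega
  rcases h3 with h3 | h3 | h3 <;>
    simp [appendNext, Stmt.sem, Expr.eval, Memory.write_apply, hx, hc, h3]

/-- A stuck walk has completed its component by `closed_of_stuck`, so a new one may be started; if
no start is found, everything has been visited. -/
theorem walkStep_spec (hU : U ⊆ range n) (hU2 : ∀ v ∈ U, nb H U v ≤ 2) (h : Ctx n H a b σ)
    (ht : TargetInv n H U σ) (hw : WalkInv n H U W pos σ) :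
    ∃ W' pos', WalkInv n H U W' pos' (walkStep.sem σ) ∧ (#W + 1 ≤ #W' ∨ W' = U) := by
  have hspec := findNext_spec hU h ht hw
  set τ := findNext.sem σ with hτ
  have hτc : Ctx n H a b τ := h.sem findNext rfl
  have htτ : TargetInv n H U τ := ht.congr (sem_frame findNext _ rfl) (sem_frame findNext _ rfl)
  have hwτ : WalkInv n H U W pos τ := hw.congr (sem_frame findNext _ rfl)
    (sem_frame findNext _ rfl) (sem_frame findNext _ rfl) (sem_frame findNext _ rfl)
    (sem_frame findNext _ rfl)
  have hcur : σ aCur = τ aCur := (sem_frame findNext σ rfl).symm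
  rw [hcur] at hspec
  set x := τ aNext 0 with hx
  have hsem : walkStep.sem σ = (cond (.sub .size (.var aNext)) (seq appendNext visitNext)
      (seq findStart (cond (.sub .size (.var aNext)) (seq startNext visitNext) skip))).sem τ := rfl
  rw [hsem]
  rcases hspec with ⟨h1, h2, h3, h4, h5⟩ | ⟨h1, h2⟩
  · rw [sem_cond_true (by rw [Expr.sub_ne]; simp [Expr.eval, hτc.input.size, ← hx, h1])]
    have hr := hwτ.res _ h2
    have hne : ∀ v ∈ W, v ≠ x := fun v hv he => h4 (he ▸ hv)
    have hext := hwτ.walk.extend h2 h3 h4 h5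
    refine ⟨insert x W, Function.update pos x (pos (τ aCur 0) + 1), ?_, .inl (card_insert_of_notMem h4).ge⟩
    rw [Stmt.sem, appendNext_sem hx.symm rfl (by omega)]
    refine visitNext_spec (W := W) (by simp [Memory.write_apply, hx]) ?_ (fun v hv => ?_) ?_
    · simpa [Memory.write_array] using hext
    · simpa [Memory.write_apply] using hwτ.visited v hv
    · intro v hv
      rcases mem_insert.1 hv with rfl | hv
      · simp [Memory.write_apply, hr, Nat.add_mod]
      · simp [Memory.write_apply, hne v hv, hwτ.res v hv]
  · rw [sem_cond_false (by rw [Expr.sub_ne]; simp [Expr.eval, hτc.input.size, ← hx, h1])]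
    have hcl := hwτ.walk.closed_of_stuck hU2 h2
    have hspec := findStart_spec hU hτc htτ hwτ
    rw [Stmt.sem]
    set ρ := findStart.sem τ with hρ
    have hρc : Ctx n H a b ρ := hτc.sem findStart rfl
    have hwρ : WalkInv n H U W pos ρ := hwτ.congr (sem_frame findStart _ rfl)
      (sem_frame findStart _ rfl) (sem_frame findStart _ rfl) (sem_frame findStart _ rfl)
      (sem_frame findStart _ rfl)
    have hcomp : τ aComp = ρ aComp := (sem_frame findStart τ rfl).symm
    rw [hcomp] at hcl
    set z := ρ aNext 0 with hz
    rcases hspec with ⟨h3, h4, h5, h6⟩ | ⟨h3, h4⟩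
    · rw [sem_cond_true (by rw [Expr.sub_ne]; simp [Expr.eval, hρc.input.size, ← hz, h3])]
      have hne : ∀ v ∈ W, v ≠ z := fun v hv he => h5 (he ▸ hv)
      have hext := hwρ.walk.restart hcl h4 h5 h6
      refine ⟨insert z W, Function.update pos z 0, ?_, .inl (card_insert_of_notMem h5).ge⟩
      have hst : startNext.sem ρ = (ρ.write aComp z z).write aRes z 0 := by
        simp [startNext, Stmt.sem, Expr.eval, Memory.write_apply, ← hz]
      rw [Stmt.sem, hst]
      refine visitNext_spec (W := W) (by simp [Memory.write_apply, hz]) ?_ (fun v hv => ?_) ?_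
      · simpa [Memory.write_array] using hext
      · simpa [Memory.write_apply] using hwρ.visited v hv
      · intro v hv
        rcases mem_insert.1 hv with rfl | hv
        · simp [Memory.write_apply]
        · simp [Memory.write_apply, hne v hv, hwρ.res v hv]
    · rw [sem_cond_false (by rw [Expr.sub_ne]; simp [Expr.eval, hρc.input.size, ← hz, h3])]
      exact ⟨W, pos, hwρ, .inr (hwρ.walk.sub.antisymm h4)⟩

/-- The function `pos` is a ghost variable, of which the memory holds only residues. It changes from
round to round and is therefore quantified existentially in the loop invariant. -/
theorem walk_spec (hU : U ⊆ range n) (hU2 : ∀ v ∈ U, nb H U v ≤ 2) (h : Ctx n H a b σ)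
    (ht : TargetInv n H U σ) : ∃ pos, WalkInv n H U U pos (Stmt.walk.sem σ) := by
  set s1 : Stmt := map aI aVisited (.const 0) with hs1
  set τ := (s1.sem σ).write aCur 0 n with hτ
  have h1 : Ctx n H a b (s1.sem σ) := h.sem _ rfl
  have hsem : Stmt.walk.sem σ = (forN aJ walkStep).sem τ := by
    rw [hτ, ← h1.input.size]
    rfl
  have hτc : Ctx n H a b τ := h1.write _ _ (by decide)
  have hv : ∀ v < n, τ aVisited v = 0 := fun v hv => by
    have := sem_map (I := aI) (a := aVisited) (e := .const 0) h.input.size (by decide) (by decide)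
      (by decide) rfl hv
    simpa [hτ, Memory.write_apply, Expr.eval] using this
  have hloop := forN_induction (p := walkStep) (I := aJ) hτc.input.size (by decide) rfl
    (fun k τ => Ctx n H a b τ ∧ TargetInv n H U τ ∧ ∃ W pos, WalkInv n H U W pos τ ∧
      (k ≤ #W ∨ W = U)) ?_ ?_
  · rw [hsem]
    obtain ⟨-, -, W, pos, h2, h3⟩ := hloop
    have hWU : W = U := by
      rcases h3 with h3 | h3
      · refine eq_of_subset_of_card_le h2.walk.sub ?_
        have := card_le_card hU
        rw [card_range] at this
        omega
      · exact h3
    exact ⟨pos, hWU ▸ h2⟩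
  · refine ⟨hτc.write _ _ (by decide), ht.congr ?_ ?_, ∅, fun _ => 0, ⟨.empty _ _ _ _, ?_, by simp,
      .inr ?_⟩, .inl (by simp)⟩
    · simp [hτ, Memory.write_array, sem_frame s1 σ (a := aTarget) rfl]
    · simp [hτ, Memory.write_array, sem_frame s1 σ (a := aTargetDeg) rfl]
    · simpa [Memory.write_apply] using hv
    · simp [hτ, Memory.write_apply]
  · rintro k τ hk h0 hkJ ⟨h2, h3, W, pos, h4, h5⟩
    obtain ⟨W', pos', h6, h7⟩ := walkStep_spec hU hU2 h2 h3 h4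
    refine ⟨(h2.sem walkStep rfl).write _ _ (by decide), h3.congr ?_ ?_, W', pos',
      h6.congr ?_ ?_ ?_ ?_ ?_, ?_⟩
    · rw [Memory.write_of_ne _ _ _ (by decide), sem_frame walkStep _ rfl]
    · rw [Memory.write_of_ne _ _ _ (by decide), sem_frame walkStep _ rfl]
    · rw [Memory.write_of_ne _ _ _ (by decide)]
    · rw [Memory.write_of_ne _ _ _ (by decide)]
    · rw [Memory.write_of_ne _ _ _ (by decide)]
    · rw [Memory.write_of_ne _ _ _ (by decide)]
    · rw [Memory.write_of_ne _ _ _ (by decide)]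
    · rcases h7 with h7 | h7
      · rcases h5 with h5 | rfl
        · exact .inl (by omega)
        · have := card_le_card h6.walk.sub
          omega
      · exact .inr h7

end

end RAM

namespace RAM

open PDS Stmt

/-! ### Verification of the candidates -/

section

variable {n a b : ℕ} {H : SimpleGraph ℕ} {U W : Finset ℕ} {pos : ℕ → ℕ} {σ : Memory}

theorem Expr.eq_ne (e f : Expr) (σ : Memory) :
    (e.eq f).eval σ ≠ 0 ↔ e.eval σ = f.eval σ := by
  rw [Expr.eval_eq]
  split_ifs <;> simp [*]

theorem Expr.add_ne (e f : Expr) (σ : Memory) :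
    (Expr.add e f).eval σ ≠ 0 ↔ e.eval σ ≠ 0 ∨ f.eval σ ≠ 0 := by
  simp only [Expr.eval]
  omega

theorem Expr.one_sub_one_sub_ne (e : Expr) (σ : Memory) :
    (Expr.sub (.const 1) (.sub (.const 1) e)).eval σ ≠ 0 ↔ e.eval σ ≠ 0 := by
  simp only [Expr.eval]
  omega

/-- The last vertex has position `m - 1`, so its stored residue `2`, `0` or `1` tells whether `m` is
congruent to `0`, `1` or `2` modulo three. -/
theorem initShift_spec {X : Finset ℕ} (hl : LowGraph n H a b) (h : Ctx n H a b σ)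
    (hw : WalkInv n H (targets n H a b X) (targets n H a b X) pos σ) :
    ShiftInv n H a b X (σ aComp) pos (σ aLast) 0 (initShift.sem σ aShift) := by
  refine shiftInv_zero hl hw.walk fun c hc => ?_
  have hcm := mem_cls.1 (name_mem hw.walk hc).1
  have hlm := mem_cls.1 (PDS.last_mem hw.walk hc)
  have hcn := mem_range.1 (targets_subset hcm.1)
  have hln := mem_range.1 (targets_subset hlm.1)
  have hpos := hw.walk.pos_last hl.nb_targets_le hc
  have hres := hw.res _ hlm.1
  set m := #(cls (targets n H a b X) (σ aComp) c)
  set e : Expr := (.sub (.const 1) (.sub (.const 1)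
    (.add (Expr.eq (.read aRes (lastOf aI)) (.const 2))
      (.mul (Expr.eq (.read aRes (lastOf aI)) (.const 1))
        (.mul (.sub (.const 1) (.coadj (.var aI) (.var aB)))
          (.add (.coadj (lastOf aI) (.var aA)) (.coadj (lastOf aI) (.var aB)))))))) with he
  have hval : initShift.sem σ aShift c = e.eval (σ.write aI 0 c) :=
    sem_map h.input.size (by decide) (by decide) (by decide) rfl hcn
  have hρ : Ctx n H a b (σ.write aI 0 c) := h.write _ _ (by decide)
  set ρ := σ.write aI 0 c with hρd
  have eI : (Expr.var aI).eval ρ = c := by simp [hρd, Expr.eval, Memory.write_apply]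
  have eL : (lastOf aI).eval ρ = σ aLast c := by simp [hρd, Expr.eval, Memory.write_apply]
  have eR : (Expr.read aRes (lastOf aI)).eval ρ = σ aRes (σ aLast c) := by
    simp [hρd, Expr.eval, Memory.write_apply]
  have c1 := hρ.input.coadj_ne (f := .var aB) eI hρ.right hcn hl.b_lt
  have c2 := hρ.input.coadj_ne (f := .var aA) eL hρ.left hln hl.a_lt
  have c3 := hρ.input.coadj_ne (f := .var aB) eL hρ.right hln hl.b_lt
  rw [hval, ← c1, ← c2, ← c3, he]
  set k1 := ((Expr.var aI).coadj (.var aB)).eval ρ with hk1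
  set k2 := ((lastOf aI).coadj (.var aA)).eval ρ with hk2
  set k3 := ((lastOf aI).coadj (.var aB)).eval ρ with hk3
  have hev : ∀ r, σ aRes (σ aLast c) = r → e.eval ρ = 1 - (1 - ((if r = 2 then 1 else 0) +
      (if r = 1 then 1 else 0) * ((1 - k1) * (k2 + k3)))) := by
    rintro r rfl
    rw [he, hk1, hk2, hk3, ← eR]
    simp only [Expr.eval, Expr.eval_eq]
    rfl
  have hq : (1 - k1) * (k2 + k3) ≠ 0 ↔ k1 = 0 ∧ (k2 ≠ 0 ∨ k3 ≠ 0) := by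
    rw [mul_ne_zero_iff]
    omega
  set q := (1 - k1) * (k2 + k3)
  rw [← he]
  have h3 : m % 3 = 0 ∨ m % 3 = 1 ∨ m % 3 = 2 := by omega
  rcases h3 with h3 | h3 | h3
  · refine .inl ⟨h3, ?_⟩
    rw [hev 2 (by omega)]
    simp
  · refine .inr (.inl ⟨h3, ?_⟩)
    rw [hev 0 (by omega)]
    simp
  · refine .inr (.inr ⟨h3, ?_⟩)
    rw [hev 1 (by omega)]
    simp only [OfNat.one_ne_ofNat, if_false, if_true, zero_add, one_mul]
    omega

theorem choose_spec {X : Finset ℕ} {x y : ℕ} (hX : X = selected x y a b)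
    (h : Ctx n H a b σ) (ht : TargetInv n H U σ) (hw : WalkInv n H U U pos σ) :
    ∀ v < n, ((Stmt.choose x y).sem σ aCand v ≠ 0 ↔ v ∈ X ∪ selection U (σ aComp) pos (σ aShift)) ∧
      (Stmt.choose x y).sem σ aCand v ≤ 1 := by
  intro v hv
  have hval := sem_map (I := aI) (a := aCand) (e := (.sub (.const 1) (.sub (.const 1)
    (.add (.mul (.read aTarget (.var aI))
        (Expr.eq (.read aRes (.var aI)) (.read aShift (.read aComp (.var aI)))))
      (.add (.mul (.const x) (Expr.eq (.var aI) (.var aA)))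
        (.mul (.const y) (Expr.eq (.var aI) (.var aB)))))))) h.input.size
    (by decide) (by decide) (by decide) rfl hv
  have htv := ht.target v hv
  rw [Stmt.choose, hval]
  refine ⟨?_, Nat.sub_le _ _⟩
  rw [mem_union, hX, mem_selected, mem_selection, Expr.one_sub_one_sub_ne, Expr.add_ne, Expr.add_ne,
    Expr.mul_ne, Expr.mul_ne, Expr.mul_ne, Expr.eq_ne, Expr.eq_ne, Expr.eq_ne, or_comm]
  simp only [Expr.eval, Memory.write_apply]
  simp only [Nat.reduceEqDiff, false_and, if_false, and_self, if_true, h.left, h.right, htv]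
  refine or_congr_right (and_congr_right fun hvU => ?_)
  rw [hw.res v hvU]

theorem flexible_ne {X : Finset ℕ} (hl : LowGraph n H a b) (h : Ctx n H a b σ)
    (ht : TargetInv n H (targets n H a b X) σ)
    (hw : WalkInv n H (targets n H a b X) (targets n H a b X) pos σ) {k : ℕ} (hk : k < n)
    (hσ : σ aJ 0 = k) :
    flexible.eval σ ≠ 0 ↔ Flexible H (targets n H a b X) a b (σ aComp) (σ aLast) k := by
  rw [flexible, Expr.mul_ne, Expr.mul_ne, Expr.mul_ne]
  have e1 : (Expr.read aTarget (.var aJ)).eval σ ≠ 0 ↔ k ∈ targets n H a b X := by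
    rw [← ht.target k hk, ← hσ]; rfl
  have e2 : (Expr.eq (.read aComp (.var aJ)) (.var aJ)).eval σ ≠ 0 ↔ σ aComp k = k := by
    rw [Expr.eq_ne, ← hσ]
    rfl
  have e3 : k ∈ targets n H a b X ∧ σ aComp k = k ↔ k ∈ image (σ aComp) (targets n H a b X) := by
    constructor
    · rintro ⟨h1, h2⟩
      exact mem_image.2 ⟨k, h1, h2⟩
    · intro hc
      exact mem_cls.1 (name_mem hw.walk hc).1
  rw [e1, e2, e3]
  refine and_congr_right fun hc => ?_
  have hlm := mem_cls.1 (PDS.last_mem hw.walk hc)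
  have hln := mem_range.1 (targets_subset hlm.1)
  have hpos := hw.walk.pos_last hl.nb_targets_le hc
  have hres := hw.res _ hlm.1
  have eJ : (Expr.var aJ).eval σ = k := hσ
  have eL : (lastOf aJ).eval σ = σ aLast k := by rw [← hσ]; rfl
  have c1 := h.input.coadj_ne (f := .var aA) eJ h.left hk hl.a_lt
  have c2 := h.input.coadj_ne (f := .var aB) eJ h.right hk hl.b_lt
  have c3 := h.input.coadj_ne (f := .var aA) eL h.left hln hl.a_lt
  have c4 := h.input.coadj_ne (f := .var aB) eL h.right hln hl.b_lt
  refine and_congr ?_ ?_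
  · have eR : (Expr.read aRes (lastOf aJ)).eval σ = pos (σ aLast k) % 3 := by rw [← hres, ← eL]; rfl
    rw [Expr.eq_ne, eR, Expr.eval]
    omega
  · rw [← c1, ← c2, ← c3, ← c4]
    rw [Expr.add_ne, Expr.mul_ne, Expr.mul_ne]

/-- The candidate and its counts are recomputed from the current shifts in linear time for each
component, which keeps the adjustment quadratic and avoids incremental bookkeeping. -/
theorem adjustStep_spec {X : Finset ℕ} {x y : ℕ} (hX : X = selected x y a b)
    (hl : LowGraph n H a b) (h : Ctx n H a b σ) (ht : TargetInv n H (targets n H a b X) σ)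
    (hw : WalkInv n H (targets n H a b X) (targets n H a b X) pos σ) {k : ℕ} (hk : k < n)
    (hσ : σ aJ 0 = k) (hs : ShiftInv n H a b X (σ aComp) pos (σ aLast) k (σ aShift)) :
    ShiftInv n H a b X (σ aComp) pos (σ aLast) (k + 1) ((adjustStep x y).sem σ aShift) := by
  set C := X ∪ selection (targets n H a b X) (σ aComp) pos (σ aShift) with hC
  have hCn : C ⊆ range n := by
    refine union_subset (fun v hv => ?_) ((filter_subset _ _).trans targets_subset)
    rw [hX] at hv
    rcases mem_selected.1 hv with ⟨-, rfl⟩ | ⟨-, rfl⟩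
    exacts [mem_range.2 hl.a_lt, mem_range.2 hl.b_lt]
  have hcand := choose_spec hX h ht hw
  set s2 : Stmt := count aI aCandCard (.const 0) (.read aCand (.var aI)) with hs2
  set s3 : Stmt := count aI aLeft (.const 0)
    (.mul (.read aCand (.var aI)) (.coadj (.var aA) (.var aI))) with hs3
  set σ1 := (Stmt.choose x y).sem σ with hσ1
  set σ2 := s2.sem σ1 with hσ2
  set σ3 := s3.sem σ2 with hσ3
  have c1 : Ctx n H a b σ1 := h.sem _ rfl
  have c2 : Ctx n H a b σ2 := c1.sem _ rfl
  have c3 : Ctx n H a b σ3 := c2.sem _ rfl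
  have hframe : ∀ i, (Stmt.choose x y).writes i = false → s2.writes i = false → s3.writes i = false →
      σ3 i = σ i := fun i f1 f2 f3 => by
    rw [hσ3, sem_frame s3 _ f3, hσ2, sem_frame s2 _ f2, hσ1, sem_frame _ _ f1]
  have ht3 : TargetInv n H (targets n H a b X) σ3 :=
    ht.congr (hframe _ rfl rfl rfl) (hframe _ rfl rfl rfl)
  have hw3 : WalkInv n H (targets n H a b X) (targets n H a b X) pos σ3 :=
    hw.congr (hframe _ rfl rfl rfl) (hframe _ rfl rfl rfl) (hframe _ rfl rfl rfl)
      (hframe _ rfl rfl rfl) (hframe _ rfl rfl rfl)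
  have hJ : σ3 aJ 0 = k := by rw [hframe _ rfl rfl rfl, hσ]
  have hsh : σ3 aShift = σ aShift := hframe _ rfl rfl rfl
  have hflex := flexible_ne hl c3 ht3 hw3 hk hJ
  rw [hframe aComp rfl rfl rfl, hframe aLast rfl rfl rfl] at hflex
  have hcard : σ3 aCandCard 0 = #C := by
    rw [hσ3, sem_frame s3 _ rfl, hσ2, hs2,
      sem_count c1.input.size (by decide) (by decide) (by decide) rfl rfl rfl]
    simp [Memory.write_apply, Expr.eval]
    exact card_eq_card hCn fun j hj => (hcand j hj).1
  have hleft : σ3 aLeft 0 = nb H C a := by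
    rw [hσ3, hs3, sem_count c2.input.size (by decide) (by decide) (by decide) rfl rfl rfl]
    simp [Memory.write_apply, -ne_eq]
    refine card_eq_nb hCn fun j hj => ?_
    rw [Expr.mul_ne, (c2.input.write _ _ (by decide)).coadj_ne (i := a) (j := j)
      (by simpa [Expr.eval, Memory.write_apply] using c2.left)
      (by simp [Expr.eval, Memory.write_apply]) hl.a_lt hj]
    refine and_congr_left fun _ => ?_
    rw [← (hcand j hj).1]
    have : σ2 aCand = σ1 aCand := sem_frame s2 _ rfl
    simp [Expr.eval, Memory.write_apply, this]
  set e : Expr := .mul flexible (.sub (.mul (.read aDeg (.var aA)) (.var aCandCard))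
        (.mul (.var aLeft) (.sub .size (.const 1)))) with he
  have hev : e.eval σ3 ≠ 0 ↔ Flexible H (targets n H a b X) a b (σ aComp) (σ aLast) k ∧
      nb H C a * (n - 1) < nb H (range n) a * #C := by
    rw [he, Expr.mul_ne, Expr.sub_ne, hflex]
    simp only [Expr.eval, hcard, hleft, c3.left, c3.deg a hl.a_lt, c3.input.size]
  have hsem : (adjustStep x y).sem σ = (cond e (store aShift (.var aJ)
    (.sub (.const 1) (.read aShift (.var aJ)))) skip).sem σ3 := rfl
  rw [hsem]
  by_cases hc : e.eval σ3 ≠ 0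
  · rw [sem_cond_true hc, Stmt.sem]
    obtain ⟨hc1, hc2⟩ := hev.1 hc
    simp only [Expr.eval, hJ, Memory.write_array, if_true, hsh]
    exact hs.flip hl hw.walk (hX ▸ selected_subset) hc1 hc2
  · rw [sem_cond_false hc, Stmt.sem, hsh]
    refine hs.skip fun hf => ?_
    by_contra! hlt
    exact hc (hev.2 ⟨hf, hlt⟩)

theorem candidate_spec (hl : LowGraph n H a b) (h : Ctx n H a b σ) (x y : ℕ) :
    IsCandidate n H a b (selected x y a b) (supp n ((candidate x y).sem σ) aCand) ∧
      ∀ v < n, (candidate x y).sem σ aCand v ≤ 1 := by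
  set X := selected x y a b with hX
  set σ1 := (initTargets x y).sem σ with hσ1
  have c1 : Ctx n H a b σ1 := h.sem _ rfl
  have t1 : TargetInv n H (targets n H a b X) σ1 := initTargets_spec hl h x y
  obtain ⟨pos, w2⟩ := walk_spec targets_subset hl.nb_targets_le c1 t1
  set σ2 := Stmt.walk.sem σ1 with hσ2
  have c2 : Ctx n H a b σ2 := c1.sem Stmt.walk rfl
  have t2 : TargetInv n H (targets n H a b X) σ2 :=
    t1.congr (sem_frame Stmt.walk _ rfl) (sem_frame Stmt.walk _ rfl)
  have i2 := initShift_spec hl c2 w2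
  set σ3 := initShift.sem σ2 with hσ3
  have c3 : Ctx n H a b σ3 := c2.sem initShift rfl
  have t3 : TargetInv n H (targets n H a b X) σ3 :=
    t2.congr (sem_frame initShift _ rfl) (sem_frame initShift _ rfl)
  have w3 : WalkInv n H (targets n H a b X) (targets n H a b X) pos σ3 :=
    w2.congr (sem_frame initShift _ rfl) (sem_frame initShift _ rfl) (sem_frame initShift _ rfl)
      (sem_frame initShift _ rfl) (sem_frame initShift _ rfl)
  have f1 : σ2 aComp = σ3 aComp := (sem_frame initShift σ2 rfl).symm
  have f2 : σ2 aLast = σ3 aLast := (sem_frame initShift σ2 rfl).symm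
  rw [f1, f2] at i2
  have hloop := forN_induction (p := adjustStep x y) (I := aJ) c3.input.size (by decide) rfl
    (fun k τ => Ctx n H a b τ ∧ TargetInv n H (targets n H a b X) τ ∧
      WalkInv n H (targets n H a b X) (targets n H a b X) pos τ ∧
      ShiftInv n H a b X (τ aComp) pos (τ aLast) k (τ aShift)) ?_ ?_
  · set σ4 := (forN aJ (adjustStep x y)).sem σ3 with hσ4
    obtain ⟨c4, t4, w4, i4⟩ := hloop
    have hcand := choose_spec hX c4 t4 w4
    have hsem : (candidate x y).sem σ = (Stmt.choose x y).sem σ4 := rfl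
    rw [hsem]
    refine ⟨⟨σ4 aComp, pos, σ4 aShift, ?_⟩, fun v hv => (hcand v hv).2⟩
    have := i4.candidate hl w4.walk
    convert this using 1
    ext v
    rw [mem_supp]
    constructor
    · rintro ⟨hv, hne⟩
      exact (hcand v hv).1.1 hne
    · intro hv
      have hvn : v < n := by
        rcases mem_union.1 hv with hv | hv
        · rcases mem_selected.1 hv with ⟨-, rfl⟩ | ⟨-, rfl⟩
          exacts [hl.a_lt, hl.b_lt]
        · exact mem_range.1 (targets_subset (mem_selection.1 hv).1)
      exact ⟨hvn, (hcand v hvn).1.2 hv⟩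
  · exact ⟨c3.write _ _ (by decide), t3.congr rfl rfl, w3.congr rfl rfl rfl rfl rfl, i2⟩
  · rintro k τ hk h0 hkJ ⟨d1, d2, d3, d4⟩
    have d5 := adjustStep_spec hX hl d1 d2 d3 hk hkJ d4
    have f3 : τ aComp = (adjustStep x y).sem τ aComp := (sem_frame (adjustStep x y) _ rfl).symm
    have f4 : τ aLast = (adjustStep x y).sem τ aLast := (sem_frame (adjustStep x y) _ rfl).symm
    rw [f3, f4] at d5
    exact ⟨(d1.sem (adjustStep x y) rfl).write _ _ (by decide),
      d2.congr (sem_frame (adjustStep x y) _ rfl) (sem_frame (adjustStep x y) _ rfl),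
      d3.congr f3.symm f4.symm (sem_frame (adjustStep x y) _ rfl)
        (sem_frame (adjustStep x y) _ rfl) (sem_frame (adjustStep x y) _ rfl), d5⟩

theorem considerCandidate_spec (hl : LowGraph n H a b) (h : Ctx n H a b σ) (hb : BestInv n H σ)
    (x y : ℕ) :
    Ctx n H a b ((considerCandidate x y).sem σ) ∧ BestInv n H ((considerCandidate x y).sem σ) ∧
      (considerCandidate x y).sem σ aBestCard 0 ≤ σ aBestCard 0 ∧
      ∃ C, IsCandidate n H a b (selected x y a b) C ∧
        (Good n H C → (considerCandidate x y).sem σ aBestCard 0 ≤ #C) := by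
  obtain ⟨h1, h2⟩ := candidate_spec hl h x y
  have f1 : (candidate x y).sem σ aBestCard = σ aBestCard := sem_frame (candidate x y) _ rfl
  have hbτ : BestInv n H ((candidate x y).sem σ) := hb.congr (sem_frame (candidate x y) _ rfl) f1
  have hc : Ctx n H a b ((candidate x y).sem σ) := h.sem (candidate x y) rfl
  obtain ⟨h3, h4, h5⟩ := consider_spec hc hbτ h2
  exact ⟨hc.sem consider rfl, h3, f1 ▸ h4, _, h1, h5⟩

theorem exists_selected {X : Finset ℕ} (hX : X ⊆ {a, b}) :
    ∃ x y, (x = 0 ∨ x = 1) ∧ (y = 0 ∨ y = 1) ∧ X = selected x y a b := by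
  refine ⟨if a ∈ X then 1 else 0, if b ∈ X then 1 else 0, by split_ifs <;> simp,
    by split_ifs <;> simp, ?_⟩
  ext v
  rw [mem_selected]
  constructor
  · intro hv
    have := hX hv
    simp only [mem_insert, mem_singleton] at this
    rcases this with rfl | rfl <;> simp [hv]
  · rintro (⟨h1, rfl⟩ | ⟨h1, rfl⟩)
    · by_contra hv; simp [hv] at h1
    · by_contra hv; simp [hv] at h1

theorem considerCandidates_spec (hl : LowGraph n H a b) (h : Ctx n H a b σ) (hb : BestInv n H σ) :
    BestInv n H (considerCandidates.sem σ) ∧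
      considerCandidates.sem σ aBestCard 0 ≤ σ aBestCard 0 ∧
      ∀ D, Good n H D → 2 * #D < n → considerCandidates.sem σ aBestCard 0 ≤ #D := by
  obtain ⟨h1, b1, l1, C1, i1, g1⟩ := considerCandidate_spec hl h hb 0 0
  obtain ⟨h2, b2, l2, C2, i2, g2⟩ := considerCandidate_spec hl h1 b1 0 1
  obtain ⟨h3, b3, l3, C3, i3, g3⟩ := considerCandidate_spec hl h2 b2 1 0
  obtain ⟨h4, b4, l4, C4, i4, g4⟩ := considerCandidate_spec hl h3 b3 1 1
  have hsem : considerCandidates.sem σ = (considerCandidate 1 1).sem ((considerCandidate 1 0).sem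
    ((considerCandidate 0 1).sem ((considerCandidate 0 0).sem σ))) := rfl
  rw [hsem]
  set r := (considerCandidate 1 1).sem ((considerCandidate 1 0).sem
    ((considerCandidate 0 1).sem ((considerCandidate 0 0).sem σ))) aBestCard 0
  refine ⟨b4, by omega, fun D hD hsmall => ?_⟩
  have hex : ∀ X ⊆ ({a, b} : Finset ℕ), ∃ C, IsCandidate n H a b X C ∧ (Good n H C → r ≤ #C) := by
    intro X hX
    obtain ⟨x, y, rfl | rfl, rfl | rfl, rfl⟩ := exists_selected hX
    · exact ⟨C1, i1, fun hg => by have := g1 hg; omega⟩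
    · exact ⟨C2, i2, fun hg => by have := g2 hg; omega⟩
    · exact ⟨C3, i3, fun hg => by have := g3 hg; omega⟩
    · exact ⟨C4, i4, g4⟩
  choose! C hC1 hC2 using hex
  obtain ⟨X, hX, hg, hle⟩ := exists_good_candidate hl hC1 hD hsmall
  exact (hC2 X hX hg).trans hle

end

end RAM

/-! ### Correctness of the whole program -/

namespace RAM

open PDS Stmt

theorem prepare_spec {n : ℕ} {H : SimpleGraph ℕ} {σ : Memory} (h : Input n H σ) (hn : 3 ≤ n)
    (hadj : ∀ {u v}, H.Adj u v → v < n) (hcard : #{v ∈ range n | 3 ≤ nb H (range n) v} ≤ 2) :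
    ∃ a b, LowGraph n H a b ∧ Ctx n H a b (prepare.sem σ) ∧ BestInv n H (prepare.sem σ) := by
  obtain ⟨h1, h2⟩ := degrees_spec h
  obtain ⟨a, b, hl, hc⟩ := pick_spec h1 hn h2 hadj hcard
  set τ := pick.sem (degrees.sem σ) with hτ
  have hsem : prepare.sem σ = τ.write aBestCard 0 n := by
    rw [← hc.input.size, hτ]
    rfl
  have hb : prepare.sem σ aBestCard 0 = n := by simp [hsem, Memory.write_apply]
  refine ⟨a, b, hl, ?_, hb.le, fun hlt => absurd hb hlt.ne⟩
  exact hsem ▸ ⟨hc.input.write _ _ (by decide), hc.deg, hc.left, hc.right⟩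

/-- The program computes the complement of a smallest good set. -/
theorem main_spec {n : ℕ} {H : SimpleGraph ℕ} {σ : Memory} (h : Input n H σ) (hn : 3 ≤ n)
    (hadj : ∀ {u v}, H.Adj u v → v < n) (hcard : #{v ∈ range n | 3 ≤ nb H (range n) v} ≤ 2) :
    ∃ D, Good n H D ∧ (∀ E, Good n H E → #D ≤ #E) ∧ ∀ v < n, main.sem σ 2 v ≠ 0 ↔ v ∉ D := by
  obtain ⟨a, b, hl, c1, b1⟩ := prepare_spec h hn hadj hcard
  obtain ⟨c2, b2, l2⟩ := considerSides_spec hn hl c1 b1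
  obtain ⟨b3, l3, g3⟩ := considerCandidates_spec hl c2 b2
  set τ := considerCandidates.sem (considerSides.sem (prepare.sem σ)) with hτ
  have c3 : Ctx n H a b τ := c2.sem considerCandidates rfl
  obtain ⟨hg, hc⟩ := b3.good (by omega)
  refine ⟨_, hg, fun E hE => ?_, fun v hv => ?_⟩
  · rw [hc]
    -- The candidates beat all sets with fewer than `n / 2` vertices; larger sets are no better than
    -- the outcome of the local search.
    by_cases hsmall : 2 * #E < n
    · exact g3 E hE hsmall
    · omega
  · have hsem : main.sem σ =
      (Stmt.map aI 2 (.sub (.const 1) (.read aBest (.var aI)))).sem τ := by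
      rw [hτ, Stmt.main, Stmt.sem, Stmt.sem, Stmt.sem]
    have hval := sem_map (I := aI) (a := 2) (e := .sub (.const 1) (.read aBest (.var aI)))
      c3.input.size (by decide) (by decide) (by decide) rfl hv
    rw [hsem, hval, Expr.sub_ne, mem_supp]
    simp [Expr.eval, Memory.write_apply, hv]

theorem valid_inputMemory {n : ℕ} (hn : 3 ≤ n) (G : SimpleGraph (Fin n)) [DecidableRel G.Adj] :
    Valid n (inputMemory G) := by
  refine ⟨by simp [inputMemory], fun a i => ?_⟩
  unfold inputMemory
  split_ifs <;> omega

theorem input_inputMemory {n : ℕ} (G : SimpleGraph (Fin n)) [DecidableRel G.Adj] :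
    Input n (Gᶜ.map Fin.valEmbedding) (inputMemory G) := by
  refine ⟨by simp [inputMemory], fun x y hx hy hxy => ?_⟩
  have h1 : (Gᶜ.map Fin.valEmbedding).Adj x y ↔ Gᶜ.Adj ⟨x, hx⟩ ⟨y, hy⟩ :=
    SimpleGraph.map_adj_apply (f := Fin.valEmbedding) (a := ⟨x, hx⟩) (b := ⟨y, hy⟩)
  have h2 : (∃ i j : Fin n, x * n + y = (i : ℕ) * n + j ∧ G.Adj i j) ↔ G.Adj ⟨x, hx⟩ ⟨y, hy⟩ := by
    constructor
    · rintro ⟨i, j, hij, hadj⟩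
      have hn : 0 < n := by omega
      have e1 : x = i := by
        have := congrArg (· / n) hij
        simpa [Nat.add_div_of_dvd_right, Nat.mul_div_cancel _ hn, Nat.div_eq_of_lt hy,
          Nat.div_eq_of_lt j.2] using this
      have e2 : y = j := by
        rw [e1] at hij
        omega
      subst e1 e2
      exact hadj
    · exact fun hadj => ⟨⟨x, hx⟩, ⟨y, hy⟩, rfl, hadj⟩
  rw [h1, SimpleGraph.compl_adj]
  simp only [inputMemory, h2, one_ne_zero, false_and, if_false, true_and]
  split_ifs with hadj <;> simp [hadj, hxy]

end RAM

/-! ### Proportionally dense subgraphs as good sets, domination and connectivity -/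

namespace SimpleGraph

open PDS

variable {n : ℕ} {G : SimpleGraph (Fin n)} [DecidableRel G.Adj] {S T : Finset (Fin n)} {v : Fin n}

theorem lt_of_map_adj {K : SimpleGraph (Fin n)} {x y : ℕ} (h : (K.map Fin.valEmbedding).Adj x y) :
    y < n := by
  obtain ⟨u, w, -, -, rfl⟩ := (SimpleGraph.map_adj ..).1 h
  exact w.2

theorem nb_map (K : SimpleGraph (Fin n)) [DecidableRel K.Adj] (D : Finset (Fin n)) (v : Fin n) :
    nb (K.map Fin.valEmbedding) (D.map Fin.valEmbedding) v = #{w ∈ D | K.Adj v w} := by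
  rw [nb, ← card_map Fin.valEmbedding (s := {w ∈ D | K.Adj v w})]
  congr 1
  ext x
  simp only [mem_filter, mem_map]
  constructor
  · rintro ⟨⟨w, hw, rfl⟩, h⟩
    exact ⟨w, ⟨hw, (map_adj_apply (f := Fin.valEmbedding) (a := v) (b := w)).1 h⟩, rfl⟩
  · rintro ⟨w, ⟨hw, h⟩, rfl⟩
    exact ⟨⟨w, hw, rfl⟩, (map_adj_apply (f := Fin.valEmbedding) (a := v) (b := w)).2 h⟩

theorem map_univ_eq_range : (univ : Finset (Fin n)).map Fin.valEmbedding = range n := by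
  ext x
  simp only [mem_map, mem_univ, true_and, mem_range, Fin.valEmbedding_apply]
  exact ⟨fun ⟨i, hi⟩ => hi ▸ i.2, fun hx => ⟨⟨x, hx⟩, rfl⟩⟩

theorem nb_map_range (K : SimpleGraph (Fin n)) [DecidableRel K.Adj] (v : Fin n) :
    nb (K.map Fin.valEmbedding) (range n) v = K.degree v := by
  rw [← map_univ_eq_range, nb_map, ← K.card_neighborFinset_eq_degree]
  congr 1
  ext w
  simp

theorem card_map_three_le (K : SimpleGraph (Fin n)) [DecidableRel K.Adj] :
    #{v ∈ range n | 3 ≤ nb (K.map Fin.valEmbedding) (range n) v} = #{v | 3 ≤ K.degree v} := by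
  conv_lhs => rw [← map_univ_eq_range (n := n)]
  rw [filter_map, card_map, map_univ_eq_range]
  congr 1
  refine filter_congr fun w _ => ?_
  exact iff_of_eq (congrArg (3 ≤ ·) (nb_map_range K w))

theorem degreeIn_add_card (v : Fin n) (T : Finset (Fin n)) :
    G.degreeIn T v + #{w ∈ T | Gᶜ.Adj v w} = #(T.erase v) := by
  rw [degreeIn, ← card_union_of_disjoint]
  · congr 1
    ext w
    simp only [mem_union, mem_inter, mem_neighborFinset, mem_filter, compl_adj, mem_erase]
    constructor
    · rintro (⟨h1, h2⟩ | ⟨h1, h2, -⟩)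
      exacts [⟨h1.ne', h2⟩, ⟨h2.symm, h1⟩]
    · rintro ⟨h1, h2⟩
      by_cases h3 : G.Adj v w
      exacts [.inl ⟨h3, h2⟩, .inr ⟨h2, h1.symm, h3⟩]
  · rw [Finset.disjoint_left]
    intro w h1 h2
    simp only [mem_inter, mem_neighborFinset, mem_filter, compl_adj] at h1 h2
    exact h2.2.2 h1.1

theorem degreeIn_add_degreeIn_compl (v : Fin n) (S : Finset (Fin n)) :
    G.degreeIn S v + G.degreeIn Sᶜ v = G.degree v := by
  rw [degreeIn, degreeIn, ← card_neighborFinset_eq_degree, ← card_union_of_disjoint,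
    ← inter_union_distrib_left, union_compl, inter_univ]
  exact disjoint_compl_right.mono inter_subset_right inter_subset_right

/-- With `p` and `q` the numbers of non-neighbours of `v` in `S` and in its complement of size `d`,
clearing denominators gives `(d - q) * (#S - 1) ≤ (#S - 1 - p) * d`, that is, `p * d ≤ q * (#S -
1)`. Adding `q * d` yields the inequality of `Good`, as `#S - 1 + d = n - 1`. -/
theorem isPDS_iff (hn : 3 ≤ n) :
    G.IsPDS S ↔ Good n (Gᶜ.map Fin.valEmbedding) (Sᶜ.map Fin.valEmbedding) := by
  have hcc : #S + #Sᶜ = n := by rw [card_add_card_compl, Fintype.card_fin]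
  have hsub : Sᶜ.map Fin.valEmbedding ⊆ range n := by
    rw [← map_univ_eq_range]
    exact map_subset_map.2 (subset_univ _)
  suffices hsat : 2 ≤ #S → #S < n →
      ((∀ v ∈ S, (G.degreeIn Sᶜ v : ℚ) / (#Sᶜ : ℚ) ≤ (G.degreeIn S v : ℚ) / ((#S : ℚ) - 1)) ↔
      ∀ v < n, v ∉ Sᶜ.map Fin.valEmbedding →
        nb (Gᶜ.map Fin.valEmbedding) (range n) v * #(Sᶜ.map Fin.valEmbedding) ≤
          nb (Gᶜ.map Fin.valEmbedding) (Sᶜ.map Fin.valEmbedding) v * (n - 1)) by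
    constructor
    · rintro ⟨h1, h2, h3⟩
      rw [Fintype.card_fin] at h2
      exact ⟨hsub, by rw [card_map]; omega, by rw [card_map]; omega, (hsat h1 h2).1 h3⟩
    · rintro ⟨-, h1, h2, h3⟩
      rw [card_map] at h1 h2
      exact ⟨by omega, by rw [Fintype.card_fin]; omega, (hsat (by omega) (by omega)).2 h3⟩
  intro h1 h2
  have key : ∀ v : Fin n, v ∈ S →
      ((G.degreeIn Sᶜ v : ℚ) / (#Sᶜ : ℚ) ≤ (G.degreeIn S v : ℚ) / ((#S : ℚ) - 1) ↔
      nb (Gᶜ.map Fin.valEmbedding) (range n) v * #(Sᶜ.map Fin.valEmbedding) ≤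
          nb (Gᶜ.map Fin.valEmbedding) (Sᶜ.map Fin.valEmbedding) v * (n - 1)) := by
    intro v hv
    have e1 := degreeIn_add_card (G := G) v S
    have e2 := degreeIn_add_card (G := G) v Sᶜ
    have e3 : nb (Gᶜ.map Fin.valEmbedding) (range n) v =
        #{w ∈ S | Gᶜ.Adj v w} + #{w ∈ Sᶜ | Gᶜ.Adj v w} := by
      rw [← map_univ_eq_range, nb_map, ← card_union_of_disjoint, ← filter_union, union_compl]
      exact disjoint_filter_filter disjoint_compl_right
    rw [e3, nb_map, card_map]
    rw [card_erase_of_mem hv] at e1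
    rw [erase_eq_of_notMem (by simpa using hv)] at e2
    generalize #{w ∈ S | Gᶜ.Adj v w} = p at *
    generalize #{w ∈ Sᶜ | Gᶜ.Adj v w} = q at *
    generalize G.degreeIn S v = x at *
    generalize G.degreeIn Sᶜ v = y at *
    generalize #S = s at *
    generalize #Sᶜ = d at *
    -- All sizes are expressed by `x`, `y`, `p` and `q`, so that no truncated subtraction remains
    -- before the cast to the rationals.
    obtain ⟨s, rfl⟩ : ∃ k, s = k + 1 := ⟨s - 1, by omega⟩
    obtain rfl : n = s + 1 + d := hcc.symm
    obtain rfl : d = y + q := e2.symm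
    obtain rfl : s = x + p := by omega
    rw [div_le_div_iff₀ (by exact_mod_cast (by omega : 0 < y + q))
      (by push_cast; rw [add_sub_cancel_right]; exact_mod_cast (by omega : 0 < x + p))]
    have e4 : x + p + 1 + (y + q) - 1 = x + p + y + q := by omega
    rw [e4, ← Nat.cast_le (α := ℚ)]
    push_cast
    constructor <;> intro h <;> nlinarith
  constructor
  · intro h v hv hvS
    have hv' : (⟨v, hv⟩ : Fin n) ∈ S := by
      by_contra hc
      exact hvS (mem_map.2 ⟨⟨v, hv⟩, mem_compl.2 hc, rfl⟩)
    exact (key ⟨v, hv⟩ hv').1 (h _ hv')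
  · intro h v hv
    refine (key v hv).2 (h v v.2 fun hc => ?_)
    obtain ⟨w, hw, hwv⟩ := mem_map.1 hc
    obtain rfl : w = v := Fin.ext hwv
    exact mem_compl.1 hw hv

/-- For a non-isolated vertex outside of the complement of `S` the left side of the inequality of
`Good` is positive, so the vertex has a neighbour there. -/
theorem IsPDS.dominates (hn : 3 ≤ n) (h : G.IsPDS S) : Gᶜ.DominatesNonisolated Sᶜ := by
  intro v hv
  by_cases hvS : v ∈ Sᶜ
  · exact .inl hvS
  have hg := (isPDS_iff hn).1 h
  have h1 := hg.sat v v.2 fun hc => hvS ((mem_map' _).1 hc)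
  rw [nb_map_range, nb_map] at h1
  have h2 : 0 < #{w ∈ Sᶜ | Gᶜ.Adj v w} := by
    refine Nat.pos_of_ne_zero fun h0 => ?_
    rw [h0, zero_mul] at h1
    exact (Nat.mul_pos hv hg.pos).ne' (Nat.le_zero.1 h1)
  obtain ⟨w, hw⟩ := card_pos.1 h2
  exact .inr ⟨w, (mem_filter.1 hw).1, (mem_filter.1 hw).2⟩

/-- A single vertex without neighbours in the rest of `S` would have density zero in `S`, hence no
neighbours outside of `S` either, and be isolated. -/
theorem IsPDS.one_lt_card_part (h : G.IsPDS S) (hdeg : ∀ v, 1 ≤ G.degree v) {X Y : Finset (Fin n)}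
    (hS : S = X ∪ Y) (hX : X.Nonempty) (hXY : ∀ x ∈ X, ∀ y ∈ Y, ¬G.Adj x y) : 1 < #X := by
  by_contra hc
  have h1 : #X = 1 := by
    have := card_pos.2 hX
    omega
  obtain ⟨x, rfl⟩ := card_eq_one.1 h1
  have h0 : G.degreeIn S x = 0 := by
    rw [degreeIn, card_eq_zero, ← Finset.disjoint_iff_inter_eq_empty, Finset.disjoint_left]
    intro w hw hwS
    rw [mem_neighborFinset] at hw
    rw [hS, mem_union, mem_singleton] at hwS
    rcases hwS with rfl | hwY
    · exact G.irrefl hw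
    · exact hXY x (mem_singleton_self x) w hwY hw
  have h2 := h.satisfied x (by simp [hS])
  rw [h0, Nat.cast_zero, zero_div] at h2
  have h3 : 0 < #Sᶜ := by
    have := h.card_lt
    have := card_add_card_compl S
    omega
  have h4 : G.degreeIn Sᶜ x = 0 := by
    rw [div_le_iff₀ (by exact_mod_cast h3), zero_mul] at h2
    exact_mod_cast (Nat.cast_nonpos.1 h2)
  have h5 := degreeIn_add_degreeIn_compl (G := G) x S
  have := hdeg x
  omega

/-- In the complement graph `x` is adjacent to all of `Y`, which gives two neighbours, and by
domination to a third one outside of `S`. -/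
theorem IsPDS.degree_of_part (hn : 3 ≤ n) (h : G.IsPDS S) {X Y : Finset (Fin n)} (hS : S = X ∪ Y)
    (hd : Disjoint X Y) (hXY : ∀ x ∈ X, ∀ y ∈ Y, ¬G.Adj x y) (hY : 1 < #Y) {x : Fin n}
    (hx : x ∈ X) : 3 ≤ Gᶜ.degree x := by
  have hsub : Y ⊆ Gᶜ.neighborFinset x := by
    intro y hy
    rw [mem_neighborFinset, compl_adj]
    exact ⟨fun he => Finset.disjoint_left.1 hd hx (he ▸ hy), hXY x hx y hy⟩
  have h1 := card_le_card hsub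
  rw [card_neighborFinset_eq_degree] at h1
  obtain ⟨w, hw, hxw⟩ := (h.dominates hn x (by omega)).resolve_left (by simp [hS, hx])
  have hwY : w ∉ Y := fun hwY => by simp [hS, hwY] at hw
  have h2 : insert w Y ⊆ Gᶜ.neighborFinset x :=
    insert_subset ((mem_neighborFinset ..).2 hxw) hsub
  have h3 := card_le_card h2
  rw [card_neighborFinset_eq_degree, card_insert_of_notMem hwY] at h3
  omega

/-- If `S` split into two parts without edges between them, each part would have at least two
vertices, and all these vertices, at least four, would have degree at least three in the complement.
-/
theorem IsPDS.connected (hn : 3 ≤ n) (h : G.IsPDS S) (hcard : #{v | 3 ≤ Gᶜ.degree v} ≤ 2)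
    (hdeg : ∀ v, 1 ≤ G.degree v) : (G.induce (S : Set (Fin n))).Connected := by
  classical
  have hne : Nonempty (S : Set (Fin n)) := by
    obtain ⟨v, hv⟩ := card_pos.1 (Nat.lt_of_lt_of_le two_pos h.two_le_card)
    exact ⟨⟨v, hv⟩⟩
  refine ⟨fun x y => ?_⟩
  by_contra hxy
  set X : Finset (Fin n) := {v ∈ S | ∃ hv : v ∈ S, (G.induce (S : Set (Fin n))).Reachable x ⟨v, hv⟩}
    with hX
  have hXS : X ⊆ S := filter_subset _ _
  have hno : ∀ u ∈ X, ∀ v ∈ S \ X, ¬G.Adj u v := by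
    intro u hu v hv huv
    obtain ⟨hvS, hvX⟩ := mem_sdiff.1 hv
    obtain ⟨-, huS, hxu⟩ := mem_filter.1 hu
    refine hvX (mem_filter.2 ⟨hvS, hvS, hxu.trans (Adj.reachable ?_)⟩)
    exact huv
  have hS : S = X ∪ (S \ X) := (union_sdiff_of_subset hXS).symm
  have hS' : S = (S \ X) ∪ X := by rw [union_comm]; exact hS
  have hno' : ∀ u ∈ S \ X, ∀ v ∈ X, ¬G.Adj u v := fun u hu v hv huv => hno v hv u hu huv.symm
  have h1 := h.one_lt_card_part hdeg hS ⟨x, mem_filter.2 ⟨x.2, x.2, .rfl⟩⟩ hno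
  have h2 := h.one_lt_card_part hdeg hS' ⟨y, mem_sdiff.2 ⟨y.2, fun hy => by
    obtain ⟨_, _, hr⟩ := mem_filter.1 hy
    exact hxy hr⟩⟩ hno'
  have h3 : S ⊆ ({v | 3 ≤ Gᶜ.degree v} : Finset (Fin n)) := by
    intro v hv
    rw [mem_filter]
    refine ⟨mem_univ _, ?_⟩
    by_cases hvX : v ∈ X
    · exact h.degree_of_part hn hS disjoint_sdiff hno h2 hvX
    · exact h.degree_of_part hn hS' sdiff_disjoint hno' h1 (mem_sdiff.2 ⟨hv, hvX⟩)
  have h4 := card_le_card h3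
  have h5 := card_sdiff_add_card_eq_card hXS
  omega

theorem card_le_two_of_hIndex_le {V : Type*} [Fintype V] [DecidableEq V] (K : SimpleGraph V)
    [DecidableRel K.Adj] (h : K.hIndex ≤ 2) : #{v | 3 ≤ K.degree v} ≤ 2 := by
  by_contra! hc
  have hb : BddAbove {h : ℕ | h ≤ #{v : V | h ≤ K.degree v}} :=
    ⟨Fintype.card V, fun k hk => le_trans hk (card_le_univ _)⟩
  have : 3 ≤ K.hIndex := le_csSup hb (Set.mem_ofPred.2 hc)
  omega

theorem card_le_two_of_le_minDegree (h : n - 3 ≤ G.minDegree) : #{v | 3 ≤ Gᶜ.degree v} ≤ 2 := by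
  rw [filter_false_of_mem]
  · simp
  · intro v _
    have h1 := G.minDegree_le_degree v
    have h2 := G.degree_compl (v := v)
    rw [Fintype.card_fin] at h2
    omega

end SimpleGraph

/-! ### The main theorem -/

namespace RAM

theorem exists_solvesMaxPDS : ∃ c, ∀ (n : ℕ) (G : SimpleGraph (Fin n)) [DecidableRel G.Adj],
    3 ≤ n → #{v | 3 ≤ Gᶜ.degree v} ≤ 2 → SolvesMaxPDS Stmt.main.compile c G := by
  obtain ⟨c, hc⟩ := Stmt.main.exists_exec_compile Stmt.wf_main
  refine ⟨c, fun n G _ hn hcard => ?_⟩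
  obtain ⟨-, t, ht, hexec⟩ := hc n (inputMemory G) hn (valid_inputMemory hn G)
  rw [Stmt.depth_main] at ht
  obtain ⟨D, hD, hmin, hout⟩ := main_spec (input_inputMemory G) hn SimpleGraph.lt_of_map_adj
    (by rw [SimpleGraph.card_map_three_le]; exact hcard)
  have hS : (outputSet n (Stmt.main.sem (inputMemory G)))ᶜ.map Fin.valEmbedding = D := by
    ext v
    simp only [mem_map, mem_compl, outputSet, mem_filter, mem_univ, true_and,
      Fin.valEmbedding_apply]
    constructor
    · rintro ⟨i, hi, rfl⟩
      by_contra hiD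
      exact hi ((hout i i.2).2 hiD)
    · intro hv
      have hvn := mem_range.1 (hD.sub hv)
      exact ⟨⟨v, hvn⟩, fun hne => (hout v hvn).1 hne hv, rfl⟩
  have hpds : G.IsPDS (outputSet n (Stmt.main.sem (inputMemory G))) :=
    (SimpleGraph.isPDS_iff hn).2 (hS ▸ hD)
  refine ⟨t, _, hexec, ht, ⟨hpds, fun T hT => ?_⟩, hpds.dominates hn,
    fun hdeg => hpds.connected hn hcard hdeg⟩
  have h1 := hmin _ ((SimpleGraph.isPDS_iff hn).1 hT)
  rw [← hS, card_map, card_map, card_compl, card_compl, Fintype.card_fin] at h1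
  have h2 := hpds.card_lt
  have h3 := hT.card_lt
  rw [Fintype.card_fin] at h2 h3
  omega

end RAM

theorem mainTheorem7 :
    ∃ (p : RAM.Program) (c : ℕ),
      (∀ (n : ℕ) (G : SimpleGraph (Fin n)) [DecidableRel G.Adj],
        3 ≤ n → Gᶜ.hIndex ≤ 2 → RAM.SolvesMaxPDS p c G) ∧
      (∀ (n : ℕ) (G : SimpleGraph (Fin n)) [DecidableRel G.Adj],
        3 ≤ n → n - 3 ≤ G.minDegree → RAM.SolvesMaxPDS p c G) := by
  obtain ⟨c, hc⟩ := RAM.exists_solvesMaxPDS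
  exact ⟨_, c, fun n G _ hn h => hc n G hn (SimpleGraph.card_le_two_of_hIndex_le _ h),
    fun n G _ hn h => hc n G hn (SimpleGraph.card_le_two_of_le_minDegree h)⟩
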